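/- Let $k\ge l\ge 1$ and fix a maximal triangulation (into standard lattice triangles) of the trapezoid with vertices $(0,0),(0,1),(k,0),(l,1)$. Let $X$ be the smooth compact toric threefold whose maximal cones in $\mathbb R^3$ are the cones over the triangles placed at height $1$, together with the cones spanned by $\{(1,0,0),(k,0,1),(l,1,1)\}$, $\{(-1,0,0),(0,0,1),(0,1,1)\}$; $\{(i,0,1),(i+1,0,1),(0,-1,-1)\}$ $(0\le i<k)$, $\{(1,0,0),(k,0,1),(0,-1,-1)\}$, $\{(-1,0,0),(0,0,1),(0,-1,-1)\}$; $\{(j,1,1),(j+1,1,1),(0,0,-1)\}$ $(0\le j<l)$, $\{(1,0,0),(l,1,1),(0,0,-1)\}$, $\{(-1,0,0),(0,1,1),(0,0,-1)\}$; $\{(\pm1,0,0),(0,0,-1),(0,-1,-1)\}$. Let $x,z,w$ be the toric rational functions with exponents $(1,0,0),(0,-1,1),(0,1,0)$; $z$ and $w$ are morphisms $X\to\mathbb P^1$. Let $D\subset X$ be the union of $\{z=1\}$, $\{w=1\}$, $\{z=\infty\}$, $\{w=\infty\}$ and the toric divisors of the rays $(1,0,0)$ and $(-1,0,0)$. Let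 $\omega$ be a toric Kähler form on $X$ (invariant under the compact 3-torus), and let $\mu=\pi_{T^1}:X\to\mathbb R$ be a moment map of the circle action of the one-parameter subgroup $(1,0,0)$. Define $$\pi=(\log|z-1|,\ \log|w-1|,\ \mu):X\to[-\infty,\infty]^2\times\mathbb R .$$ Call $p\in X\setminus D$ regular if $d\pi_p$ has rank $3$. Then: 1. $\pi$ is continuous, its image is $B=[-\infty,\infty]^2\times I$ for a compact interval $I=\mu(X)$ of positive length, and $D$ is the preimage of the boundary of $B$. There is a finite set $S\subset\mathbb R$ such that all $p\in X\setminus D$ with $\mu(p)\notin S$ are regular. Every non-empty fibre of $\pi$ all of whose points are regular is homeomorphic to the torus $T^3$. 2. The form $d\log x\wedge d\log(z-1)\wedge d\log(w-1)$ extends from the open torus to a nowhere-vanishing holomorphic 3-form $\Omega$ on $X\setminus D$. 3. For all $c_1,c_2>0$ the 2-form $$d\mu\wedge d\theta+\frac{\sqrt{-1}}{c_1(1+|z|^2)^2}\,dz\wedge d\bar z+\frac{\sqrt{-1}}{c_2(1+|w|^2)^2}\,dw\wedge d\bar w,\qquad\theta=\arg x,$$ on the open torus $(\mathbb C^\times)^3\subset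 X$ is non-degenerate, and $\pi$ is special Lagrangian for it and $\Omega$: at each point of the open torus off $D$ the tangent space $\ker d\pi$ of the fibre has dimension $3$, and the 2-form and $\operatorname{Re}\Omega$ vanish on it. 4. Suppose that the Kähler form itself has this shape, in the sense that on the open torus $$\omega=d\mu\wedge\Theta+f\,\sqrt{-1}\,dz\wedge d\bar z+g\,\sqrt{-1}\,dw\wedge d\bar w$$ for some real 1-form $\Theta$ and real functions $f,g$. Then $\pi$ is a special Lagrangian fibration for $\omega$ and $\Omega$: at each regular point (on or off the open torus) $\ker d\pi$ has dimension $3$, and $\omega$ and $\operatorname{Re}\Omega$ vanish on it; in particular every fibre of $\pi$ consisting of regular points is a special Lagrangian 3-torus. -/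

import Mathlib

noncomputable section

open scoped Matrix Topology

namespace GenConifold

/-- The lattices `N = ℤ³` (supporting the fan) and `M = ℤ³` (supporting the moment polytope),
paired by the dot product. -/
abbrev Lat : Type := Fin 3 → ℤ

/-- The model space `ℂ³` of the affine toric charts. -/
abbrev C3 : Type := Fin 3 → ℂ

/-- The exponent vectors of the toric functions `x`, `z`, `w`
(the fourth one, `y`, is determined by `x * y = z ^ k * w ^ l`). -/
def nuX : Lat := ![1, 0, 0]
def nuZ : Lat := ![0, -1, 1]
def nuW : Lat := ![0, 1, 0]

/-! ### The trapezoid and its maximal triangulations -/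

/-- A lattice point of the plane as a real point. -/
def toPlane (p : ℤ × ℤ) : ℝ × ℝ := ((p.1 : ℝ), (p.2 : ℝ))

/-- The convex hull of a finite set of lattice points. -/
def hull (s : Finset (ℤ × ℤ)) : Set (ℝ × ℝ) := convexHull ℝ (toPlane '' (s : Set (ℤ × ℤ)))

/-- The trapezoid with vertices `(0,0), (0,1), (k,0), (l,1)`. -/
def trapezoid (k l : ℕ) : Set (ℝ × ℝ) :=
  hull {(0, 0), (0, 1), ((k : ℤ), 0), ((l : ℤ), 1)}

/-- A maximal triangulation of the trapezoid, i.e. a subdivision into standard lattice triangles: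
triangles are given by their vertex sets. -/
structure MaxTriangulation (k l : ℕ) where
  triangles : Finset (Finset (ℤ × ℤ))
  standard : ∀ s ∈ triangles, ∃ a b c : ℤ × ℤ, s = {a, b, c} ∧
    |(b.1 - a.1) * (c.2 - a.2) - (b.2 - a.2) * (c.1 - a.1)| = 1
  cover : ⋃ s ∈ triangles, hull s = trapezoid k l
  face : ∀ s ∈ triangles, ∀ s' ∈ triangles, hull s ∩ hull s' = hull (s ∩ s')

variable {k l : ℕ}

/-! ### The fan of the compactified resolution -/

/-- A point of the trapezoid placed at height one. -/
def liftPt (p : ℤ × ℤ) : Lat := ![p.1, p.2, 1]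

/-- The maximal cones, each given by the set of its three primitive ray generators:
the cones over the triangles, and the cones that contain at least one of the added rays
`(0,0,-1)` (where `z = ∞`), `(0,-1,-1)` (where `w = ∞`), `(1,0,0)` and `(-1,0,0)`. -/
def maxCones (T : MaxTriangulation k l) : Set (Set Lat) :=
  {c | (∃ s ∈ T.triangles, c = liftPt '' (s : Set (ℤ × ℤ)))
    ∨ c = {![1, 0, 0], ![(k : ℤ), 0, 1], ![(l : ℤ), 1, 1]}
    ∨ c = {![-1, 0, 0], ![0, 0, 1], ![0, 1, 1]}
    ∨ (∃ i : ℕ, i < k ∧ c = {![(i : ℤ), 0, 1], ![(i : ℤ) + 1, 0, 1], ![0, -1, -1]})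
    ∨ c = {![1, 0, 0], ![(k : ℤ), 0, 1], ![0, -1, -1]}
    ∨ c = {![-1, 0, 0], ![0, 0, 1], ![0, -1, -1]}
    ∨ (∃ j : ℕ, j < l ∧ c = {![(j : ℤ), 1, 1], ![(j : ℤ) + 1, 1, 1], ![0, 0, -1]})
    ∨ c = {![1, 0, 0], ![(l : ℤ), 1, 1], ![0, 0, -1]}
    ∨ c = {![-1, 0, 0], ![0, 1, 1], ![0, 0, -1]}
    ∨ c = {![1, 0, 0], ![0, 0, -1], ![0, -1, -1]}
    ∨ c = {![-1, 0, 0], ![0, 0, -1], ![0, -1, -1]}}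

/-! ### The toric threefold -/

/-- An affine chart `ℂ³` for every maximal cone with an ordering of its generators
(the rows of the matrix). -/
def Chart (T : MaxTriangulation k l) : Type :=
  {V : Matrix (Fin 3) (Fin 3) ℤ // (Set.range fun i => V i) ∈ maxCones T}

variable {T : MaxTriangulation k l}

/-- The character with exponent `m` in the chart `V`. It has its proper meaning where
no coordinate with negative exponent vanishes. -/
def mono (V : Chart T) (m : Lat) (t : C3) : ℂ := ∏ i, t i ^ (m ⬝ᵥ V.1 i)

/-- The generators of the cone whose torus orbit contains the point `t` of the chart `V`. -/
def stratum (p : Σ _ : Chart T, C3) : Set Lat := {ρ | ∃ i, p.1.1 i = ρ ∧ p.2 i = 0}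

/-- Two chart points are glued iff they lie on the same torus orbit, that of the cone `τ`,
and all characters with exponents in `τ^⊥` agree on them. -/
def glueSetoid (T : MaxTriangulation k l) : Setoid (Σ _ : Chart T, C3) where
  r p q := stratum p = stratum q ∧
    ∀ m : Lat, (∀ ρ ∈ stratum p, m ⬝ᵥ ρ = 0) → mono p.1 m p.2 = mono q.1 m q.2
  iseqv :=
    { refl := fun _ => ⟨rfl, fun _ _ => rfl⟩
      symm := fun h => ⟨h.1.symm, fun m hm => (h.2 m (fun ρ hρ => hm ρ (h.1 ▸ hρ))).symm⟩
      trans := fun h h' => ⟨h.1.trans h'.1, fun m hm =>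
        (h.2 m hm).trans (h'.2 m (fun ρ hρ => hm ρ (h.1.symm ▸ hρ)))⟩ }

/-- The compact toric threefold of the fan, as the charts `ℂ³` glued together. -/
def X (T : MaxTriangulation k l) : Type := Quotient (glueSetoid T)

/-- The analytic topology (each `ℂ³` open). -/
instance : TopologicalSpace (X T) :=
  inferInstanceAs (TopologicalSpace (Quotient (glueSetoid T)))

/-- The affine chart as a map to the threefold. -/
def pt (V : Chart T) (t : C3) : X T := Quotient.mk (glueSetoid T) ⟨V, t⟩

/-- The generators of the cone whose torus orbit contains the given point. -/
def orbitCone : X T → Set Lat := Quotient.lift stratum fun _ _ h => h.1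

open Classical in
/-- The character with exponent `m` as a function to `ℂ ∪ {∞} = ℙ¹`
(used for `z` and `w`, which have no indeterminacy). -/
def charP1Aux (m : Lat) (p : Σ _ : Chart T, C3) : OnePoint ℂ :=
  if ∃ ρ ∈ stratum p, m ⬝ᵥ ρ < 0 then OnePoint.infty else ((mono p.1 m p.2 : ℂ) : OnePoint ℂ)

theorem mono_eq_zero (m : Lat) (p : Σ _ : Chart T, C3)
    (h : ∃ ρ ∈ stratum p, 0 < m ⬝ᵥ ρ) : mono p.1 m p.2 = 0 := by
  obtain ⟨ρ, ⟨i, hi, hz⟩, hpos⟩ := h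
  refine Finset.prod_eq_zero (Finset.mem_univ i) ?_
  rw [hz, hi]
  exact zero_zpow _ hpos.ne'

theorem charP1Aux_congr (m : Lat) (p q : Σ _ : Chart T, C3) (h : (glueSetoid T).r p q) :
    charP1Aux m p = charP1Aux m q := by
  obtain ⟨h1, h2⟩ := h
  unfold charP1Aux
  rw [← h1]
  split_ifs with hneg
  · rfl
  · by_cases hpos : ∃ ρ ∈ stratum p, 0 < m ⬝ᵥ ρ
    · rw [mono_eq_zero m p hpos, mono_eq_zero m q (h1 ▸ hpos)]
    · push Not at hneg hpos
      rw [h2 m fun ρ hρ => le_antisymm (hpos ρ hρ) (hneg ρ hρ)]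

/-- The character with exponent `m` on the threefold, with values in `ℙ¹`. -/
def charP1 (m : Lat) : X T → OnePoint ℂ := Quotient.lift (charP1Aux m) (charP1Aux_congr m)

/-- The toric functions `z` and `w`. -/
def zFun : X T → OnePoint ℂ := charP1 nuZ
def wFun : X T → OnePoint ℂ := charP1 nuW

/-- The divisor `D`: the union of `{z = 1}`, `{w = 1}`, `{z = ∞}`, `{w = ∞}` and of the toric
divisors of the rays `(1,0,0)` and `(-1,0,0)`. -/
def divisorD (T : MaxTriangulation k l) : Set (X T) :=
  {p | zFun p = ((1 : ℂ) : OnePoint ℂ) ∨ wFun p = ((1 : ℂ) : OnePoint ℂ)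
    ∨ zFun p = OnePoint.infty ∨ wFun p = OnePoint.infty
    ∨ (![1, 0, 0] : Lat) ∈ orbitCone p ∨ (![-1, 0, 0] : Lat) ∈ orbitCone p}

/-! ### Toric Kähler forms and the moment map of the circle action -/

/-- The coordinate change from the chart `V` to the chart `V'`. -/
def chartChange (V V' : Chart T) (t : C3) : C3 := fun j => ∏ i, t i ^ ((V.1 * V'.1⁻¹) i j)

/-- The part of the chart `V` that lies in the chart `V'`. -/
def overlap (V V' : Chart T) : Set C3 := {t | ∀ i, (V.1 i ∉ Set.range fun j => V'.1 j) → t i ≠ 0}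

/-- A toric Kähler form: a smooth closed positive real (1,1)-form, invariant under the compact
torus, given in the charts. -/
structure ToricKahlerForm (T : MaxTriangulation k l) where
  form : Chart T → C3 → C3 [⋀^Fin 2]→L[ℝ] ℝ
  smooth : ∀ V, ContDiff ℝ ((⊤ : ℕ∞) : WithTop ℕ∞) (form V)
  glue : ∀ V V' : Chart T, ∀ t ∈ overlap V V',
    form V t = (form V' (chartChange V V' t)).compContinuousLinearMap
      (fderiv ℝ (chartChange V V') t)
  closed : ∀ V t, extDeriv (form V) t = 0
  type_one_one : ∀ V t (u v : C3),
    form V t ![Complex.I • u, Complex.I • v] = form V t ![u, v]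
  pos : ∀ V t (u : C3), u ≠ 0 → 0 < form V t ![u, Complex.I • u]
  invariant : ∀ V t (s : Fin 3 → Circle) (u v : C3),
    form V (fun i => s i * t i) ![fun i => s i * u i, fun i => s i * v i] = form V t ![u, v]

/-- The vector field, in the chart `V`, of the circle action of the one-parameter subgroup
`(1,0,0)`; the row vector `(1,0,0) V⁻¹` holds the coordinates of `(1,0,0)` in the basis of
generators. -/
def circleField (V : Chart T) (t : C3) : C3 :=
  fun i => Complex.I * (((![1, 0, 0] : Lat) ᵥ* V.1⁻¹) i : ℂ) * t i

/-- `μ` is a moment map for the circle action; the sign is that of `ω = dμ ∧ dθ + ⋯`. -/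
def IsMomentMap (ω : ToricKahlerForm T) (μ : X T → ℝ) : Prop :=
  ∀ (V : Chart T) (t : C3), DifferentiableAt ℝ (fun s => μ (pt V s)) t ∧
    ∀ u : C3, fderiv ℝ (fun s => μ (pt V s)) t u = ω.form V t ![u, circleField V t]

/-! ### The map `π` -/

/-- `log |ζ - 1|` as a map from `ℙ¹` to `[-∞, ∞]`. -/
def logDist (ζ : OnePoint ℂ) : EReal := ζ.elim (⊤ : EReal) (fun a : ℂ => ENNReal.log ‖a - 1‖ₑ)

/-- The map `π = (log |z - 1|, log |w - 1|, μ)`. -/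
def fibMap (μ : X T → ℝ) (p : X T) : EReal × EReal × ℝ :=
  (logDist (zFun p), logDist (wFun p), μ p)

/-- The map `π` off `D`, in the chart `V`, with real values. -/
def fibLoc (μ : X T → ℝ) (V : Chart T) (t : C3) : ℝ × ℝ × ℝ :=
  (Real.log ‖mono V nuZ t - 1‖, Real.log ‖mono V nuW t - 1‖, μ (pt V t))

/-- The differential of `π` in a chart. -/
def dFib (μ : X T → ℝ) (V : Chart T) (t : C3) : C3 →L[ℝ] ℝ × ℝ × ℝ := fderiv ℝ (fibLoc μ V) t

/-- A regular point of `π`: a point off `D` where the differential of `π` is onto. -/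
def IsRegularPt (μ : X T → ℝ) (p : X T) : Prop :=
  p ∉ divisorD T ∧ ∀ V t, pt V t = p → Function.Surjective (dFib μ V t)

/-! ### Differential forms on the open torus -/

/-- The chart coordinates of the open torus orbit. -/
def torusSet : Set C3 := {t | ∀ i, t i ≠ 0}

/-- The differential of a character in the chart `V`. -/
def dMono (V : Chart T) (m : Lat) (t : C3) : C3 →L[ℝ] ℂ := fderiv ℝ (mono V m) t

/-- The real 2-form `√-1 a ∧ ā` of a complex valued 1-form `a`. -/
def iWedgeBar (a : C3 →L[ℝ] ℂ) (u v : C3) : ℝ :=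
  (Complex.I * (a u * starRingEnd ℂ (a v) - a v * starRingEnd ℂ (a u))).re

/-- The differential of `μ` in the chart `V`. -/
def dMu (μ : X T → ℝ) (V : Chart T) (t : C3) : C3 →L[ℝ] ℝ := fderiv ℝ (fun s => μ (pt V s)) t

/-- The form `dμ ∧ dθ + √-1 dz ∧ dz̄ / (c₁ (1 + |z|²)²) + √-1 dw ∧ dw̄ / (c₂ (1 + |w|²)²)`
on the open torus, where `θ` is the argument of `x`. -/
def displayedForm (μ : X T → ℝ) (c₁ c₂ : ℝ) (V : Chart T) (t u v : C3) : ℝ :=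
  dMu μ V t u * (dMono V nuX t v / mono V nuX t).im
    - dMu μ V t v * (dMono V nuX t u / mono V nuX t).im
    + 1 / (c₁ * (1 + ‖mono V nuZ t‖ ^ 2) ^ 2) * iWedgeBar (dMono V nuZ t) u v
    + 1 / (c₂ * (1 + ‖mono V nuW t‖ ^ 2) ^ 2) * iWedgeBar (dMono V nuW t) u v

/-- `ω = dμ ∧ Θ + f √-1 dz ∧ dz̄ + g √-1 dw ∧ dw̄` on the open torus, for some real 1-form `Θ`
and real functions `f`, `g`. -/
def IsSplit (ω : ToricKahlerForm T) (μ : X T → ℝ) : Prop :=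
  ∀ (V : Chart T), ∀ t ∈ torusSet, ∃ (Θ : C3 →L[ℝ] ℝ) (f g : ℝ), ∀ u v : C3,
    ω.form V t ![u, v] = dMu μ V t u * Θ v - dMu μ V t v * Θ u
      + f * iWedgeBar (dMono V nuZ t) u v + g * iWedgeBar (dMono V nuW t) u v

/-- The three 1-forms `dlog x`, `dlog (z - 1)`, `dlog (w - 1)` on the open torus. -/
def logForms (V : Chart T) (t u : C3) : Fin 3 → ℂ :=
  ![dMono V nuX t u / mono V nuX t,
    dMono V nuZ t u / (mono V nuZ t - 1),
    dMono V nuW t u / (mono V nuW t - 1)]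

/-- `Ω` is the holomorphic 3-form on the complement of `D` that equals
`dlog x ∧ dlog (z - 1) ∧ dlog (w - 1)` on the open torus (this determines it there), and it
vanishes nowhere. -/
def IsVolumeForm (Ω : Chart T → C3 → C3 [⋀^Fin 3]→L[ℂ] ℂ) : Prop :=
  ∀ V : Chart T, DifferentiableOn ℂ (Ω V) {t | pt V t ∉ divisorD T} ∧
    (∀ t, pt V t ∉ divisorD T → Ω V t ≠ 0) ∧
    ∀ t ∈ torusSet, pt V t ∉ divisorD T → ∀ u : Fin 3 → C3,
      Ω V t u = Matrix.det (Matrix.of fun a b => logForms V t (u b) a)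

/-- The tangent space of the fibre of `π` through the given chart point, that is the kernel of
the differential of `π`, is special Lagrangian: it has real dimension three, and the 2-form and
the real part of the 3-form vanish on it. -/
def IsSpecialLagrangianAt (μ : X T → ℝ) (V : Chart T) (t : C3)
    (ω : C3 → C3 → ℝ) (Ω : C3 [⋀^Fin 3]→L[ℂ] ℂ) : Prop :=
  Module.finrank ℝ (LinearMap.ker (dFib μ V t).toLinearMap) = 3 ∧
  (∀ u v, dFib μ V t u = 0 → dFib μ V t v = 0 → ω u v = 0) ∧
  ∀ u : Fin 3 → C3, (∀ a, dFib μ V t (u a) = 0) → (Ω u).re = 0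

end GenConifold

end

/-! The map `(z, w)` from `X` to `ℙ¹ × ℙ¹` is invariant under the `ℂ^×`-action of the one-parameter
subgroup `(1,0,0)`, and each of its fibres is a finite chain of `ℂ^×`-orbits joined at fixed points
(`FibreChain`, `nonempty_chain`). Over a point with `z, w ≠ 0` there is one such orbit. Over `z = 0`
the orbits are indexed by the rays `(i,0,1)`, over `w = 0` by the rays `(j,1,1)`, and over `(0,0)`
by the edges of the triangulation joining the two rows. These edges form a monotone lattice path
(`nonempty_edgePath`), the only global fact about the triangulation that is needed.

If `R` is the radial field of the action, then `dμ(R) = ω(R, iR) > 0`, so `μ` increases strictly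
along each orbit, and by torus invariance it depends only on the modulus of the orbit coordinate
`ξ`. At the ends of an orbit it tends to its constant values on fixed loci (`val`). The levels at
the fixed points are therefore strictly ordered along the chain, every value between the extremes is
attained in every fibre of `(z, w)`, and the extremes are attained exactly on the divisors of
`±(1,0,0)` (`FibreChain.exists_mu_eq`, `mu_bounds`). This gives the image of `π` and the description
of `D`.

Off `D` a point is regular exactly when the circle does not fix it (`OffD.surjective_dFib`,
`exists_of_surjective_dFib`), and `μ` takes finitely many values on the fixed points. A regular
fibre of `π` thus meets the fibre over each admissible `(z, w)` in one circle `|ξ| = const`. The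
index of the orbit carrying this circle does not jump (`exists_index_A`, `exists_index_B`), so the
arguments of `z - 1`, `w - 1` and `ξ` are global coordinates on a 3-torus
(`nonempty_homeomorph_torus`).

In a chart, `Ω` is a unit times a monomial whose exponents vanish at the rays of height one, hence
it has no zeros or poles off `D`. On `ker dπ` the forms `dlog (z-1)` and `dlog (w-1)` are imaginary,
and `dμ = 0` makes `Re dlog x` a real combination of their imaginary parts, which kills `Re Ω`
(`re_det_eq_zero`). The 2-forms vanish because `dμ` does and because `dz` and `dw` take values in
real lines. At regular points off the open torus the kernels vary continuously and the torus is
dense, so the vanishing passes to the limit (`exists_continuousAt_ker`). -/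

noncomputable section

open scoped Matrix Topology

namespace GenConifold

variable {k l : ℕ} {T : MaxTriangulation k l}

/-! ### Generalized charts: unimodular matrices -/

/-- The character with exponent `m` in the coordinates given by the rows of a matrix. -/
def monoM (A : Matrix (Fin 3) (Fin 3) ℤ) (m : Lat) (t : C3) : ℂ := ∏ i, t i ^ (m ⬝ᵥ A i)

/-- The rows of `A` at which the coordinate vanishes. -/
def zeroRows (A : Matrix (Fin 3) (Fin 3) ℤ) (t : C3) : Set Lat := {ρ | ∃ i, A i = ρ ∧ t i = 0}

/-- Two points in generalized charts represent the same point of the toric variety. -/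
def Rep (A : Matrix (Fin 3) (Fin 3) ℤ) (s : C3) (B : Matrix (Fin 3) (Fin 3) ℤ) (t : C3) : Prop :=
  zeroRows A s = zeroRows B t ∧
    ∀ m : Lat, (∀ ρ ∈ zeroRows A s, m ⬝ᵥ ρ = 0) → monoM A m s = monoM B m t

/-- The monomial coordinate change. -/
def coordChange (A B : Matrix (Fin 3) (Fin 3) ℤ) (s : C3) : C3 :=
  fun j => ∏ i, s i ^ ((A * B⁻¹) i j)

theorem Rep.symm {A B : Matrix (Fin 3) (Fin 3) ℤ} {s t : C3} (h : Rep A s B t) : Rep B t A s :=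
  ⟨h.1.symm, fun m hm => (h.2 m (h.1 ▸ hm)).symm⟩

theorem Rep.trans {A B C : Matrix (Fin 3) (Fin 3) ℤ} {s t u : C3}
    (h : Rep A s B t) (h' : Rep B t C u) : Rep A s C u :=
  ⟨h.1.trans h'.1, fun m hm => (h.2 m hm).trans (h'.2 m (h.1 ▸ hm))⟩

theorem pt_eq_iff {V V' : Chart T} {t t' : C3} : pt V t = pt V' t' ↔ Rep V.1 t V'.1 t' :=
  Quotient.eq (r := glueSetoid T)

theorem orbitCone_pt (V : Chart T) (t : C3) : orbitCone (pt V t) = zeroRows V.1 t := rfl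

theorem mono_eq (V : Chart T) (m : Lat) (t : C3) : mono V m t = monoM V.1 m t := rfl

theorem exists_pt (p : X T) : ∃ V t, pt V t = p := by
  induction p using Quotient.inductionOn with
  | h p => exact ⟨p.1, p.2, rfl⟩

/-- A generator common to both matrices has a unit vector as coordinates in the basis of rows of
`B`. Vanishing coordinates thus enter a coordinate change only with exponents `0` and `1`. -/
theorem mul_inv_row {A B : Matrix (Fin 3) (Fin 3) ℤ} (hB : IsUnit B.det) {b j : Fin 3}
    (h : A b = B j) (i : Fin 3) : (A * B⁻¹) b i = if j = i then 1 else 0 := by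
  have h1 : (A * B⁻¹) b = (B * B⁻¹) j := by
    rw [Matrix.mul_apply_eq_vecMul, Matrix.mul_apply_eq_vecMul, h]
  rw [h1, Matrix.mul_nonsing_inv B hB, Matrix.one_apply]

theorem sum_mul_inv {A B : Matrix (Fin 3) (Fin 3) ℤ} (hB : IsUnit B.det) (m : Lat) (i : Fin 3) :
    ∑ j, (A * B⁻¹) i j * (m ⬝ᵥ B j) = m ⬝ᵥ A i := by
  have h1 : (A * B⁻¹) *ᵥ (B *ᵥ m) = A *ᵥ m := by
    rw [Matrix.mulVec_mulVec, Matrix.mul_assoc, Matrix.nonsing_inv_mul B hB, Matrix.mul_one]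
  have h2 := congrFun h1 i
  simp only [Matrix.mulVec, dotProduct] at h2 ⊢
  simpa [mul_comm] using h2

theorem coordChange_eq_zero_iff {A B : Matrix (Fin 3) (Fin 3) ℤ} (hB : IsUnit B.det) {s : C3}
    (h : zeroRows A s ⊆ Set.range fun i => B i) (j : Fin 3) :
    coordChange A B s j = 0 ↔ ∃ b, A b = B j ∧ s b = 0 := by
  constructor
  · intro h0
    obtain ⟨b, -, hb⟩ := Finset.prod_eq_zero_iff.1 h0
    have hsb : s b = 0 := by
      by_contra hne
      exact zpow_ne_zero _ hne hb
    obtain ⟨j', hj'⟩ := h ⟨b, rfl, hsb⟩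
    have hj' : A b = B j' := hj'.symm
    rw [mul_inv_row hB hj'] at hb
    split_ifs at hb with hjj
    · exact ⟨b, hjj ▸ hj', hsb⟩
    · simp at hb
  · rintro ⟨b, hb, hsb⟩
    refine Finset.prod_eq_zero (Finset.mem_univ b) ?_
    rw [mul_inv_row hB hb, hsb]
    simp

theorem zeroRows_coordChange {A B : Matrix (Fin 3) (Fin 3) ℤ} (hB : IsUnit B.det) {s : C3}
    (h : zeroRows A s ⊆ Set.range fun i => B i) :
    zeroRows B (coordChange A B s) = zeroRows A s := by
  ext ρ
  constructor
  · rintro ⟨j, rfl, hj⟩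
    obtain ⟨b, hb, hs⟩ := (coordChange_eq_zero_iff hB h j).1 hj
    exact ⟨b, hb, hs⟩
  · rintro ⟨b, rfl, hs⟩
    obtain ⟨j, hj⟩ := h ⟨b, rfl, hs⟩
    exact ⟨j, hj, (coordChange_eq_zero_iff hB h j).2 ⟨b, hj.symm, hs⟩⟩

/-- Nonzero coordinates obey the laws of exponents. A vanishing one occurs with total exponent `0`
on both sides, since `m` annihilates its ray. -/
theorem monoM_coordChange {A B : Matrix (Fin 3) (Fin 3) ℤ} (hB : IsUnit B.det) {s : C3}
    (h : zeroRows A s ⊆ Set.range fun i => B i) {m : Lat}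
    (hm : ∀ ρ ∈ zeroRows A s, m ⬝ᵥ ρ = 0) :
    monoM B m (coordChange A B s) = monoM A m s := by
  unfold monoM coordChange
  simp_rw [← Finset.prod_zpow, ← zpow_mul]
  rw [Finset.prod_comm]
  refine Finset.prod_congr rfl fun i _ => ?_
  by_cases hs : s i = 0
  · obtain ⟨j', hj'⟩ := h ⟨i, rfl, hs⟩
    have hj' : A i = B j' := hj'.symm
    have h0 : m ⬝ᵥ A i = 0 := hm _ ⟨i, rfl, hs⟩
    rw [h0]
    refine (Finset.prod_eq_one fun j _ => ?_).trans (zpow_zero _).symm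
    rw [mul_inv_row hB hj']
    split_ifs with hjj
    · rw [← hjj, ← hj', h0]; simp
    · simp
  · rw [← sum_mul_inv hB m i]
    simp only [Fin.prod_univ_three, Fin.sum_univ_three, zpow_add₀ hs]

/-- Neither matrix has to be a cone of the fan. This allows unimodular frames adapted to `(z, w)` to
serve as charts below. -/
theorem rep_coordChange {A B : Matrix (Fin 3) (Fin 3) ℤ} (hB : IsUnit B.det) {s : C3}
    (h : zeroRows A s ⊆ Set.range fun i => B i) : Rep A s B (coordChange A B s) :=
  ⟨(zeroRows_coordChange hB h).symm, fun _ hm => (monoM_coordChange hB h hm).symm⟩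

open Classical in
/-- The value in `ℙ¹` of a character at a point of a generalized chart. -/
def charM (m : Lat) (A : Matrix (Fin 3) (Fin 3) ℤ) (s : C3) : OnePoint ℂ :=
  if ∃ ρ ∈ zeroRows A s, m ⬝ᵥ ρ < 0 then OnePoint.infty else ((monoM A m s : ℂ) : OnePoint ℂ)

theorem charP1_pt (m : Lat) (V : Chart T) (t : C3) : charP1 m (pt V t) = charM m V.1 t := rfl

theorem monoM_eq_zero {m : Lat} {A : Matrix (Fin 3) (Fin 3) ℤ} {s : C3}
    (h : ∃ ρ ∈ zeroRows A s, 0 < m ⬝ᵥ ρ) : monoM A m s = 0 := by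
  obtain ⟨ρ, ⟨i, hi, hz⟩, hpos⟩ := h
  refine Finset.prod_eq_zero (Finset.mem_univ i) ?_
  rw [hz, hi]
  exact zero_zpow _ hpos.ne'

theorem Rep.charM_eq {A B : Matrix (Fin 3) (Fin 3) ℤ} {s t : C3} (h : Rep A s B t) (m : Lat) :
    charM m A s = charM m B t := by
  obtain ⟨h1, h2⟩ := h
  unfold charM
  rw [← h1]
  split_ifs with hneg
  · rfl
  · by_cases hpos : ∃ ρ ∈ zeroRows A s, 0 < m ⬝ᵥ ρ
    · rw [monoM_eq_zero hpos, monoM_eq_zero (h1 ▸ hpos)]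
    · push Not at hneg hpos
      rw [h2 m fun ρ hρ => le_antisymm (hpos ρ hρ) (hneg ρ hρ)]

/-! ### Rays -/

def rayX : Lat := ![1, 0, 0]
def rayA (i : ℤ) : Lat := ![i, 0, 1]
def rayB (j : ℤ) : Lat := ![j, 1, 1]
def rayZ : Lat := ![0, 0, -1]
def rayW : Lat := ![0, -1, -1]

@[simp] theorem nuX_dot (ρ : Lat) : nuX ⬝ᵥ ρ = ρ 0 := by
  simp [nuX, dotProduct, Fin.sum_univ_three]
@[simp] theorem nuZ_dot (ρ : Lat) : nuZ ⬝ᵥ ρ = ρ 2 - ρ 1 := by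
  simp [nuZ, dotProduct, Fin.sum_univ_three]; ring
@[simp] theorem nuW_dot (ρ : Lat) : nuW ⬝ᵥ ρ = ρ 1 := by
  simp [nuW, dotProduct, Fin.sum_univ_three]

theorem triple_range (a b c : Lat) :
    (Set.range fun i => (Matrix.of ![a, b, c]) i) = ({a, b, c} : Set Lat) := by
  ext ρ
  simp only [Set.mem_range, Fin.exists_fin_succ, Set.mem_insert_iff, Set.mem_singleton_iff]
  simp only [eq_comm (a := ρ)]
  simp
  exact Iff.rfl

/-- A chart knows its cone only as a set of rows; two orderings differ by a permutation, which
changes the determinant by a sign. -/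
theorem isUnit_det_of_range_eq {A V : Matrix (Fin 3) (Fin 3) ℤ} (hA : IsUnit A.det)
    (h : (Set.range fun i => V i) = Set.range fun i => A i) : IsUnit V.det := by
  have hinj : Function.Injective fun i => A i := by
    intro i j hij
    by_contra hne
    exact hA.ne_zero (Matrix.det_zero_of_row_eq hne hij)
  have h1 : ∀ i, ∃ j, A j = V i := fun i => by
    have : V i ∈ Set.range fun i => A i := h ▸ ⟨i, rfl⟩
    exact this
  choose σ hσ using h1
  have hsurj : Function.Surjective σ := by
    intro j
    have : A j ∈ Set.range fun i => V i := h ▸ ⟨j, rfl⟩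
    obtain ⟨i, hi⟩ := this
    exact ⟨i, hinj ((hσ i).trans hi)⟩
  let e : Equiv.Perm (Fin 3) := Equiv.ofBijective σ (Finite.surjective_iff_bijective.1 hsurj)
  have h2 : V = A.submatrix e id := by
    ext i j
    exact congrFun (hσ i).symm j
  rw [h2, Matrix.det_permute]
  refine IsUnit.mul ?_ hA
  rcases Int.units_eq_one_or (Equiv.Perm.sign e) with h | h <;> simp [h]

theorem isUnit_det_of_range {a b c : Lat} {V : Matrix (Fin 3) (Fin 3) ℤ}
    (h : (Set.range fun i => V i) = {a, b, c}) (hd : IsUnit (Matrix.of ![a, b, c]).det) :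
    IsUnit V.det :=
  isUnit_det_of_range_eq hd (h.trans (triple_range a b c).symm)

theorem liftPt_zero (i : ℤ) : liftPt (i, 0) = rayA i := rfl
theorem liftPt_one (i : ℤ) : liftPt (i, 1) = rayB i := rfl

/-- At height one, the determinant of three lifted vertices is the doubled oriented area of the
triangle, so a standard triangle gives a smooth cone. The remaining cones are computed directly. -/
theorem isUnit_det_chart (V : Chart T) : IsUnit V.1.det := by
  obtain ⟨V, hV⟩ := V
  change IsUnit V.det
  rcases hV with ⟨s, hs, hV⟩ | hV | hV | ⟨i, -, hV⟩ | hV | hV | ⟨j, -, hV⟩ | hV | hV | hV | hV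
  · obtain ⟨a, b, c, rfl, habc⟩ := T.standard s hs
    have : (Set.range fun i => V i) = {liftPt a, liftPt b, liftPt c} := by
      rw [hV]; simp [Set.image_insert_eq]
    refine isUnit_det_of_range this ?_
    rw [Int.isUnit_iff_abs_eq, ← habc]
    congr 1
    simp [Matrix.det_fin_three, liftPt]
    ring
  all_goals
    refine isUnit_det_of_range hV ?_
    rw [Int.isUnit_iff_abs_eq]
    simp [Matrix.det_fin_three]

end GenConifold

end

noncomputable section

open scoped Matrix Topology

namespace GenConifold

variable {k l : ℕ} {T : MaxTriangulation k l}

/-! ### Maximal triangulations of the trapezoid are lattice paths -/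

/-- Half-planes are convex, so vertices suffice. The planar geometry below separates points from
hulls by such half-planes. -/
theorem hull_subset_halfPlane {s : Finset (ℤ × ℤ)} {a b c : ℝ}
    (h : ∀ p ∈ s, a * (p.1 : ℝ) + b * (p.2 : ℝ) ≤ c) {q : ℝ × ℝ} (hq : q ∈ hull s) :
    a * q.1 + b * q.2 ≤ c := by
  have hc : Convex ℝ {q : ℝ × ℝ | a * q.1 + b * q.2 ≤ c} := by
    refine convex_halfSpace_le (f := fun q : ℝ × ℝ => a * q.1 + b * q.2) ?_ c
    exact ⟨fun x y => by simp; ring, fun r x => by simp; ring⟩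
  refine convexHull_min ?_ hc hq
  rintro _ ⟨p, hp, rfl⟩
  exact h p hp

theorem toPlane_mem_hull {s : Finset (ℤ × ℤ)} {p : ℤ × ℤ} (hp : p ∈ s) : toPlane p ∈ hull s :=
  subset_convexHull ℝ _ ⟨p, hp, rfl⟩

theorem segment_mem_hull {s : Finset (ℤ × ℤ)} {p q : ℝ × ℝ} (hp : p ∈ hull s) (hq : q ∈ hull s)
    {r : ℝ} (h0 : 0 ≤ r) (h1 : r ≤ 1) : (1 - r) • p + r • q ∈ hull s :=
  convex_convexHull ℝ _ hp hq (by linarith) h0 (by ring)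

theorem midpoint_mem_hull {s : Finset (ℤ × ℤ)} {i j : ℤ} (hi : (i, (0 : ℤ)) ∈ s)
    (hj : (j, (1 : ℤ)) ∈ s) : (((i + j : ℝ) / 2, 1 / 2) : ℝ × ℝ) ∈ hull s := by
  have := segment_mem_hull (toPlane_mem_hull hi) (toPlane_mem_hull hj)
    (r := 1 / 2) (by norm_num) (by norm_num)
  convert this using 1
  ext <;> simp [toPlane] <;> ring

theorem trapezoid_bounds {q : ℝ × ℝ} (hq : q ∈ trapezoid k l) :
    0 ≤ q.1 ∧ 0 ≤ q.2 ∧ q.2 ≤ 1 ∧ q.1 + (k - l) * q.2 ≤ k := by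
  refine ⟨?_, ?_, ?_, ?_⟩
  · have := hull_subset_halfPlane (a := -1) (b := 0) (c := 0) ?_ hq
    · linarith
    · intro p hp
      simp only [Finset.mem_insert, Finset.mem_singleton] at hp
      rcases hp with rfl | rfl | rfl | rfl <;> simp
  · have := hull_subset_halfPlane (a := 0) (b := -1) (c := 0) ?_ hq
    · linarith
    · intro p hp
      simp only [Finset.mem_insert, Finset.mem_singleton] at hp
      rcases hp with rfl | rfl | rfl | rfl <;> simp
  · have := hull_subset_halfPlane (a := 0) (b := 1) (c := 1) ?_ hq
    · linarith
    · intro p hp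
      simp only [Finset.mem_insert, Finset.mem_singleton] at hp
      rcases hp with rfl | rfl | rfl | rfl <;> simp
  · have := hull_subset_halfPlane (a := 1) (b := k - l) (c := k) ?_ hq
    · linarith
    · intro p hp
      simp only [Finset.mem_insert, Finset.mem_singleton] at hp
      rcases hp with rfl | rfl | rfl | rfl <;> simp

theorem mem_trapezoid_half {x : ℝ} (h0 : 0 ≤ x) (h1 : 2 * x ≤ k + l) :
    ((x, 1 / 2) : ℝ × ℝ) ∈ trapezoid k l := by
  have ha : (((0 : ℤ) + (0 : ℤ) : ℝ) / 2, (1 / 2 : ℝ)) ∈ trapezoid k l :=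
    midpoint_mem_hull (by simp) (by simp)
  have hb : ((((k : ℤ) : ℝ) + ((l : ℤ) : ℝ)) / 2, (1 / 2 : ℝ)) ∈ trapezoid k l :=
    midpoint_mem_hull (by simp) (by simp)
  rcases h0.eq_or_lt with rfl | hpos
  · simpa using ha
  · have hkl : (0 : ℝ) < k + l := by linarith
    have := segment_mem_hull ha hb (r := 2 * x / (k + l)) (by positivity)
      ((div_le_one hkl).2 h1)
    refine Eq.mp ?_ this
    congr 1
    ext
    · simp; field_simp
    · simp; ring

theorem triangle_vertex_bounds {s : Finset (ℤ × ℤ)} (hs : s ∈ T.triangles) {p : ℤ × ℤ}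
    (hp : p ∈ s) : 0 ≤ p.1 ∧ (p.2 = 0 ∧ p.1 ≤ k ∨ p.2 = 1 ∧ p.1 ≤ l) := by
  have h1 : toPlane p ∈ trapezoid k l := by
    rw [← T.cover]
    exact Set.mem_biUnion hs (toPlane_mem_hull hp)
  obtain ⟨h1, h2, h3, h4⟩ := trapezoid_bounds h1
  simp only [toPlane] at h1 h2 h3 h4
  have h1 : 0 ≤ p.1 := by exact_mod_cast h1
  have h2 : 0 ≤ p.2 := by exact_mod_cast h2
  have h3 : p.2 ≤ 1 := by exact_mod_cast h3
  refine ⟨h1, ?_⟩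
  have : p.2 = 0 ∨ p.2 = 1 := by omega
  rcases this with h | h
  · left
    refine ⟨h, ?_⟩
    rw [h] at h4
    have : (p.1 : ℝ) ≤ k := by simpa using h4
    exact_mod_cast this
  · right
    refine ⟨h, ?_⟩
    rw [h] at h4
    have : (p.1 : ℝ) ≤ l := by push_cast at h4; linarith
    exact_mod_cast this

/-- A step of a lattice path. -/
def IsStep (i j i' j' : ℤ) : Prop := (i' = i + 1 ∧ j' = j) ∨ (i' = i ∧ j' = j + 1)

/-- The quadrilateral spanned by two edges between the rows; a triangle if they are a step apart. -/
def stepTriangle (i j i' j' : ℤ) : Finset (ℤ × ℤ) := {(i, 0), (i', 0), (j, 1), (j', 1)}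

/-- Three vertices in one row have determinant zero. Otherwise exactly two share a row, and
determinant `±1` forces them to be neighbours. -/
theorem triangle_shape {s : Finset (ℤ × ℤ)} (hs : s ∈ T.triangles) :
    ∃ i j i' j', IsStep i j i' j' ∧ s = stepTriangle i j i' j' := by
  obtain ⟨⟨a1, a2⟩, ⟨b1, b2⟩, ⟨c1, c2⟩, rfl, hd⟩ := T.standard s hs
  have ha := (triangle_vertex_bounds hs (p := (a1, a2)) (by simp)).2
  have hb := (triangle_vertex_bounds hs (p := (b1, b2)) (by simp)).2
  have hc := (triangle_vertex_bounds hs (p := (c1, c2)) (by simp)).2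
  clear hs
  simp only at ha hb hc hd
  rw [abs_eq (by norm_num)] at hd
  rcases ha with ⟨rfl, -⟩ | ⟨rfl, -⟩ <;> rcases hb with ⟨rfl, -⟩ | ⟨rfl, -⟩ <;>
    rcases hc with ⟨rfl, -⟩ | ⟨rfl, -⟩ <;> simp only [mul_zero, sub_self, zero_sub, sub_zero,
      mul_one, mul_neg, zero_mul] at hd
  · simp at hd
  · rcases le_total a1 b1 with h | h
    · obtain rfl : b1 = a1 + 1 := by omega
      exact ⟨a1, c1, a1 + 1, c1, .inl ⟨rfl, rfl⟩, by ext; simp [stepTriangle]⟩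
    · obtain rfl : a1 = b1 + 1 := by omega
      exact ⟨b1, c1, b1 + 1, c1, .inl ⟨rfl, rfl⟩, by ext; simp [stepTriangle]; tauto⟩
  · rcases le_total a1 c1 with h | h
    · obtain rfl : c1 = a1 + 1 := by omega
      exact ⟨a1, b1, a1 + 1, b1, .inl ⟨rfl, rfl⟩, by ext; simp [stepTriangle]; tauto⟩
    · obtain rfl : a1 = c1 + 1 := by omega
      exact ⟨c1, b1, c1 + 1, b1, .inl ⟨rfl, rfl⟩, by ext; simp [stepTriangle]; tauto⟩
  · rcases le_total b1 c1 with h | h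
    · obtain rfl : c1 = b1 + 1 := by omega
      exact ⟨a1, b1, a1, b1 + 1, .inr ⟨rfl, rfl⟩, by ext; simp [stepTriangle]⟩
    · obtain rfl : b1 = c1 + 1 := by omega
      exact ⟨a1, c1, a1, c1 + 1, .inr ⟨rfl, rfl⟩, by ext; simp [stepTriangle]; tauto⟩
  · rcases le_total b1 c1 with h | h
    · obtain rfl : c1 = b1 + 1 := by omega
      exact ⟨b1, a1, b1 + 1, a1, .inl ⟨rfl, rfl⟩, by ext; simp [stepTriangle]; tauto⟩
    · obtain rfl : b1 = c1 + 1 := by omega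
      exact ⟨c1, a1, c1 + 1, a1, .inl ⟨rfl, rfl⟩, by ext; simp [stepTriangle]; tauto⟩
  · rcases le_total a1 c1 with h | h
    · obtain rfl : c1 = a1 + 1 := by omega
      exact ⟨b1, a1, b1, a1 + 1, .inr ⟨rfl, rfl⟩, by ext; simp [stepTriangle]; tauto⟩
    · obtain rfl : a1 = c1 + 1 := by omega
      exact ⟨b1, c1, b1, c1 + 1, .inr ⟨rfl, rfl⟩, by ext; simp [stepTriangle]; tauto⟩
  · rcases le_total a1 b1 with h | h
    · obtain rfl : b1 = a1 + 1 := by omega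
      exact ⟨c1, a1, c1, a1 + 1, .inr ⟨rfl, rfl⟩, by ext; simp [stepTriangle]; tauto⟩
    · obtain rfl : a1 = b1 + 1 := by omega
      exact ⟨c1, b1, c1, b1 + 1, .inr ⟨rfl, rfl⟩, by ext; simp [stepTriangle]; tauto⟩
  · simp at hd

/-- The edge from `(i, 0)` to `(j, 1)` is a face of the triangle whenever its midpoint lies in it. -/
theorem edge_mem_of_midpoint_mem {s s' : Finset (ℤ × ℤ)} (hs : s ∈ T.triangles)
    (hs' : s' ∈ T.triangles) {i j : ℤ} (hi : (i, (0 : ℤ)) ∈ s) (hj : (j, (1 : ℤ)) ∈ s)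
    (hq : (((i + j : ℝ) / 2, 1 / 2) : ℝ × ℝ) ∈ hull s') :
    (i, (0 : ℤ)) ∈ s' ∧ (j, (1 : ℤ)) ∈ s' := by
  have hu : (((i + j : ℝ) / 2, 1 / 2) : ℝ × ℝ) ∈ hull (s ∩ s') := by
    rw [← T.face s hs s' hs']
    exact ⟨midpoint_mem_hull hi hj, hq⟩
  have hrow : ∀ p ∈ s, p.2 = 0 ∨ p.2 = 1 := fun p hp =>
    (triangle_vertex_bounds hs hp).2.imp And.left And.left
  -- The edge is a side of the triangle `s`, so `s` lies to the right or to the left of it.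
  have side : (∀ p ∈ s, (p.2 = 0 → i ≤ p.1) ∧ (p.2 = 1 → j ≤ p.1)) ∨
      (∀ p ∈ s, (p.2 = 0 → p.1 ≤ i) ∧ (p.2 = 1 → p.1 ≤ j)) := by
    obtain ⟨a, b, a', b', hst, rfl⟩ := triangle_shape hs
    simp only [stepTriangle, Finset.mem_insert, Finset.mem_singleton, Prod.mk.injEq] at hi hj ⊢
    have hA : (i = a ∧ j = b) ∨ (i = a' ∧ j = b') := by unfold IsStep at hst; omega
    rcases hA with ⟨rfl, rfl⟩ | ⟨rfl, rfl⟩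
    · left
      rintro p (rfl | rfl | rfl | rfl) <;> unfold IsStep at hst <;> simp <;> omega
    · right
      rintro p (rfl | rfl | rfl | rfl) <;> unfold IsStep at hst <;> simp <;> omega
  rcases side with side | side
  · constructor
    · by_contra hn
      -- The boundary is the line through `(i+1, 0)` and `(j, 1)`. If `(i, 0)` is not common, all
      -- common vertices lie weakly to its right, but the midpoint lies strictly to its left. The
      -- other three cases tilt the edge in the same way.
      have := hull_subset_halfPlane (a := -1) (b := j - i - 1) (c := -i - 1) ?_ hu
      · simp only at this; linarith
      · rintro ⟨p, r⟩ hp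
        obtain ⟨hps, hps'⟩ := Finset.mem_inter.1 hp
        rcases hrow _ hps with hr | hr <;> simp only at hr <;> subst hr
        · have h1 := (side _ hps).1 rfl
          have h2 : p ≠ i := by rintro rfl; exact hn hps'
          have h3 : (i : ℝ) + 1 ≤ p := by simp only at h1; exact_mod_cast (by omega : i + 1 ≤ p)
          simp; linarith
        · have h1 := (side _ hps).2 rfl
          have h3 : (j : ℝ) ≤ p := by exact_mod_cast h1
          simp; linarith
    · by_contra hn
      have := hull_subset_halfPlane (a := -1) (b := j - i + 1) (c := -i) ?_ hu
      · simp only at this; linarith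
      · rintro ⟨p, r⟩ hp
        obtain ⟨hps, hps'⟩ := Finset.mem_inter.1 hp
        rcases hrow _ hps with hr | hr <;> simp only at hr <;> subst hr
        · have h1 := (side _ hps).1 rfl
          have h3 : (i : ℝ) ≤ p := by exact_mod_cast h1
          simp; linarith
        · have h1 := (side _ hps).2 rfl
          have h2 : p ≠ j := by rintro rfl; exact hn hps'
          have h3 : (j : ℝ) + 1 ≤ p := by simp only at h1; exact_mod_cast (by omega : j + 1 ≤ p)
          simp; linarith
  · constructor
    · by_contra hn
      have := hull_subset_halfPlane (a := 1) (b := i - j - 1) (c := i - 1) ?_ hu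
      · simp only at this; linarith
      · rintro ⟨p, r⟩ hp
        obtain ⟨hps, hps'⟩ := Finset.mem_inter.1 hp
        rcases hrow _ hps with hr | hr <;> simp only at hr <;> subst hr
        · have h1 := (side _ hps).1 rfl
          have h2 : p ≠ i := by rintro rfl; exact hn hps'
          have h3 : (p : ℝ) + 1 ≤ i := by simp only at h1; exact_mod_cast (by omega : p + 1 ≤ i)
          simp; linarith
        · have h1 := (side _ hps).2 rfl
          have h3 : (p : ℝ) ≤ j := by exact_mod_cast h1
          simp; linarith
    · by_contra hn
      have := hull_subset_halfPlane (a := 1) (b := i - j + 1) (c := i) ?_ hu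
      · simp only at this; linarith
      · rintro ⟨p, r⟩ hp
        obtain ⟨hps, hps'⟩ := Finset.mem_inter.1 hp
        rcases hrow _ hps with hr | hr <;> simp only at hr <;> subst hr
        · have h1 := (side _ hps).1 rfl
          have h3 : (p : ℝ) ≤ i := by exact_mod_cast h1
          simp; linarith
        · have h1 := (side _ hps).2 rfl
          have h2 : p ≠ j := by rintro rfl; exact hn hps'
          have h3 : (p : ℝ) + 1 ≤ j := by simp only at h1; exact_mod_cast (by omega : p + 1 ≤ j)
          simp; linarith

/-- Edges between the rows are determined by the sum of their abscissae. -/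
theorem edge_unique {s s' : Finset (ℤ × ℤ)} (hs : s ∈ T.triangles) (hs' : s' ∈ T.triangles)
    {i j i' j' : ℤ} (hi : (i, (0 : ℤ)) ∈ s) (hj : (j, (1 : ℤ)) ∈ s) (hi' : (i', (0 : ℤ)) ∈ s')
    (hj' : (j', (1 : ℤ)) ∈ s') (h : i + j = i' + j') : i = i' ∧ j = j' := by
  have hq : (((i + j : ℝ) / 2, 1 / 2) : ℝ × ℝ) ∈ hull s' := by
    have h2 : (i + j : ℝ) = i' + j' := by exact_mod_cast h
    rw [h2]
    exact midpoint_mem_hull hi' hj'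
  obtain ⟨h1, h2⟩ := edge_mem_of_midpoint_mem hs hs' hi hj hq
  obtain ⟨a, b, a', b', hst, rfl⟩ := triangle_shape hs'
  simp only [stepTriangle, Finset.mem_insert, Finset.mem_singleton, Prod.mk.injEq] at h1 h2 hi' hj'
  unfold IsStep at hst
  omega

/-- A triangle meets the line of height `1/2` in the segment from `(i+j)/2` to `(i+j+1)/2`. The test
point `(2n+1)/4` is the centre of the segment with `i + j = n`, so the triangle covering it has this
index. -/
theorem exists_triangle (T : MaxTriangulation k l) {n : ℕ} (hn : n < k + l) :
    ∃ i j i' j', IsStep i j i' j' ∧ i + j = n ∧ stepTriangle i j i' j' ∈ T.triangles := by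
  have hq : ((((2 * n + 1 : ℝ) / 4), 1 / 2) : ℝ × ℝ) ∈ trapezoid k l := by
    refine mem_trapezoid_half (by positivity) ?_
    have : (n : ℝ) + 1 ≤ k + l := by exact_mod_cast hn
    linarith
  rw [← T.cover] at hq
  simp only [Set.mem_iUnion] at hq
  obtain ⟨s, hs, hq⟩ := hq
  obtain ⟨i, j, i', j', hst, rfl⟩ := triangle_shape hs
  refine ⟨i, j, i', j', hst, ?_, hs⟩
  have h1 := hull_subset_halfPlane (a := -1) (b := j - i) (c := -i) ?_ hq
  · have h2 := hull_subset_halfPlane (a := 1) (b := i' - j') (c := i') ?_ hq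
    · simp only at h1 h2
      have h3 : (i' + j' : ℝ) = i + j + 1 := by
        have : i' + j' = i + j + 1 := by unfold IsStep at hst; omega
        exact_mod_cast this
      have h4 : (i + j : ℝ) < n + 1 := by linarith
      have h5 : (n : ℝ) < i + j + 1 := by linarith
      have h4 : (i + j : ℤ) < n + 1 := by exact_mod_cast h4
      have h5 : (n : ℤ) < i + j + 1 := by exact_mod_cast h5
      omega
    · intro p hp
      simp only [stepTriangle, Finset.mem_insert, Finset.mem_singleton] at hp
      rcases hst with ⟨rfl, rfl⟩ | ⟨rfl, rfl⟩ <;> rcases hp with rfl | rfl | rfl | rfl <;>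
        simp <;> linarith
  · intro p hp
    simp only [stepTriangle, Finset.mem_insert, Finset.mem_singleton] at hp
    rcases hst with ⟨rfl, rfl⟩ | ⟨rfl, rfl⟩ <;> rcases hp with rfl | rfl | rfl | rfl <;>
      simp <;> linarith

/-- The lattice path of the edges of a maximal triangulation that join the two rows. -/
structure EdgePath (T : MaxTriangulation k l) where
  i : ℕ → ℤ
  j : ℕ → ℤ
  add_eq : ∀ n ≤ k + l, i n + j n = n
  bounds : ∀ n ≤ k + l, 0 ≤ i n ∧ i n ≤ k ∧ 0 ≤ j n ∧ j n ≤ l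
  step : ∀ n < k + l, IsStep (i n) (j n) (i (n + 1)) (j (n + 1))
  mem : ∀ n < k + l, stepTriangle (i n) (j n) (i (n + 1)) (j (n + 1)) ∈ T.triangles
  eq_of_mem : ∀ s ∈ T.triangles, ∃ n < k + l,
    s = stepTriangle (i n) (j n) (i (n + 1)) (j (n + 1))

/-- For each sum `n` there is an edge with `i + j = n`, and by `edge_unique` only one. Hence the
right edge of one triangle is the left edge of the next, and the edges form a path. -/
theorem nonempty_edgePath (T : MaxTriangulation k l) (hk : 1 ≤ k) : Nonempty (EdgePath T) := by
  have hex : ∀ n : ℕ, ∃ e : ℤ × ℤ, n ≤ k + l →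
      e.1 + e.2 = n ∧ ∃ s ∈ T.triangles, (e.1, (0 : ℤ)) ∈ s ∧ (e.2, (1 : ℤ)) ∈ s := by
    intro n
    by_cases hn : n ≤ k + l
    · rcases hn.lt_or_eq with h | h
      · obtain ⟨i, j, i', j', -, hij, hs⟩ := exists_triangle T h
        exact ⟨(i, j), fun _ => ⟨hij, _, hs, by simp [stepTriangle], by simp [stepTriangle]⟩⟩
      -- The final edge is the left edge of no triangle, so it is taken as the right edge of the
      -- last one.
      · obtain ⟨i, j, i', j', hst, hij, hs⟩ := exists_triangle T (n := n - 1) (by omega)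
        refine ⟨(i', j'), fun _ => ⟨?_, _, hs, by simp [stepTriangle], by simp [stepTriangle]⟩⟩
        unfold IsStep at hst
        simp only
        omega
    · exact ⟨(0, 0), fun h => absurd h hn⟩
  choose e he using hex
  have bounds : ∀ n ≤ k + l, 0 ≤ (e n).1 ∧ (e n).1 ≤ k ∧ 0 ≤ (e n).2 ∧ (e n).2 ≤ l := by
    intro n hn
    obtain ⟨-, s, hs, h1, h2⟩ := he n hn
    have := triangle_vertex_bounds hs h1
    have := triangle_vertex_bounds hs h2
    simp at *
    omega
  have key : ∀ n < k + l, ∀ i j i' j', IsStep i j i' j' → i + j = n →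
      stepTriangle i j i' j' ∈ T.triangles →
      i = (e n).1 ∧ j = (e n).2 ∧ i' = (e (n + 1)).1 ∧ j' = (e (n + 1)).2 := by
    intro n hn i j i' j' hst hij hs
    obtain ⟨h1, s1, hs1, h2, h3⟩ := he n hn.le
    obtain ⟨h1', s1', hs1', h2', h3'⟩ := he (n + 1) hn
    obtain ⟨r1, r2⟩ := edge_unique hs hs1 (i := i) (j := j) (by simp [stepTriangle])
      (by simp [stepTriangle]) h2 h3 (by omega)
    obtain ⟨r3, r4⟩ := edge_unique hs hs1' (i := i') (j := j') (by simp [stepTriangle])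
      (by simp [stepTriangle]) h2' h3' (by unfold IsStep at hst; push_cast at h1'; omega)
    exact ⟨r1, r2, r3, r4⟩
  refine ⟨⟨fun n => (e n).1, fun n => (e n).2, fun n hn => (he n hn).1, bounds, ?_, ?_, ?_⟩⟩
  · intro n hn
    obtain ⟨i, j, i', j', hst, hij, hs⟩ := exists_triangle T hn
    obtain ⟨rfl, rfl, rfl, rfl⟩ := key n hn i j i' j' hst hij hs
    exact hst
  · intro n hn
    obtain ⟨i, j, i', j', hst, hij, hs⟩ := exists_triangle T hn
    obtain ⟨rfl, rfl, rfl, rfl⟩ := key n hn i j i' j' hst hij hs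
    exact hs
  · intro s hs
    obtain ⟨i, j, i', j', hst, rfl⟩ := triangle_shape hs
    have b1 := triangle_vertex_bounds hs (p := (i, 0)) (by simp [stepTriangle])
    have b2 := triangle_vertex_bounds hs (p := (j, 1)) (by simp [stepTriangle])
    have b3 := triangle_vertex_bounds hs (p := (i', 0)) (by simp [stepTriangle])
    have b4 := triangle_vertex_bounds hs (p := (j', 1)) (by simp [stepTriangle])
    simp only [zero_ne_one, false_and, or_false, true_and, one_ne_zero, false_or] at b1 b2 b3 b4
    have hij : i + j = ((i + j).toNat : ℕ) := by omega
    have hlt : (i + j).toNat < k + l := by unfold IsStep at hst; omega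
    obtain ⟨h1, h2, h3, h4⟩ := key _ hlt i j i' j' hst hij hs
    exact ⟨_, hlt, by simp only [← h1, ← h2, ← h3, ← h4]⟩

end GenConifold

end

noncomputable section

open scoped Matrix Topology

namespace GenConifold

variable {k l : ℕ} {T : MaxTriangulation k l}

/-! ### The cones of the fan -/

theorem rayA_inj {i i' : ℤ} : rayA i = rayA i' ↔ i = i' := by simp [rayA]
theorem rayB_inj {i i' : ℤ} : rayB i = rayB i' ↔ i = i' := by simp [rayB]
theorem rayA_ne_rayB {i j : ℤ} : rayA i ≠ rayB j := by simp [rayA, rayB]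
theorem rayA_ne_rayX {i : ℤ} : rayA i ≠ rayX := by simp [rayA, rayX]
theorem rayA_ne_neg_rayX {i : ℤ} : rayA i ≠ -rayX := by simp [rayA, rayX]
theorem rayA_ne_rayZ {i : ℤ} : rayA i ≠ rayZ := by simp [rayA, rayZ]
theorem rayA_ne_rayW {i : ℤ} : rayA i ≠ rayW := by simp [rayA, rayW]
theorem rayB_ne_rayX {i : ℤ} : rayB i ≠ rayX := by simp [rayB, rayX]
theorem rayB_ne_neg_rayX {i : ℤ} : rayB i ≠ -rayX := by simp [rayB, rayX]
theorem rayB_ne_rayZ {i : ℤ} : rayB i ≠ rayZ := by simp [rayB, rayZ]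
theorem rayB_ne_rayW {i : ℤ} : rayB i ≠ rayW := by simp [rayB, rayW]
theorem rayZ_ne_rayX : rayZ ≠ rayX := by simp [rayZ, rayX]
theorem rayZ_ne_neg_rayX : rayZ ≠ -rayX := by simp [rayZ, rayX]
theorem rayW_ne_rayX : rayW ≠ rayX := by simp [rayW, rayX]
theorem rayW_ne_neg_rayX : rayW ≠ -rayX := by simp [rayW, rayX]
theorem rayZ_ne_rayW : rayZ ≠ rayW := by simp [rayZ, rayW]
theorem rayX_ne_neg_rayX : rayX ≠ -rayX := by
  intro h; have := congrFun h 0; simp [rayX] at this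

/-- The rays of a chart. -/
def rays (V : Chart T) : Set Lat := Set.range fun i => V.1 i

theorem liftPt_stepTriangle (i j i' j' : ℤ) :
    liftPt '' (stepTriangle i j i' j' : Set (ℤ × ℤ)) = {rayA i, rayA i', rayB j, rayB j'} := by
  simp [stepTriangle, Set.image_insert_eq, liftPt_zero, liftPt_one]

theorem neg_rayX : -rayX = ![-1, 0, 0] := by
  ext a; fin_cases a <;> simp [rayX]

theorem rays_cases (P : EdgePath T) (V : Chart T) :
    (∃ n < k + l, rays V = {rayA (P.i n), rayA (P.i (n + 1)), rayB (P.j n), rayB (P.j (n + 1))})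
    ∨ rays V = {rayX, rayA k, rayB l} ∨ rays V = {-rayX, rayA 0, rayB 0}
    ∨ (∃ i : ℕ, i < k ∧ rays V = {rayA i, rayA (i + 1), rayW})
    ∨ rays V = {rayX, rayA k, rayW} ∨ rays V = {-rayX, rayA 0, rayW}
    ∨ (∃ j : ℕ, j < l ∧ rays V = {rayB j, rayB (j + 1), rayZ})
    ∨ rays V = {rayX, rayB l, rayZ} ∨ rays V = {-rayX, rayB 0, rayZ}
    ∨ rays V = {rayX, rayZ, rayW} ∨ rays V = {-rayX, rayZ, rayW} := by
  obtain ⟨V, hV⟩ := V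
  simp only [neg_rayX]
  rcases hV with ⟨s, hs, hV⟩ | hV
  · obtain ⟨n, hn, rfl⟩ := P.eq_of_mem s hs
    exact .inl ⟨n, hn, hV.trans (liftPt_stepTriangle _ _ _ _)⟩
  · exact .inr hV

theorem exists_chart_of_mem {a b c : Lat} (h : {a, b, c} ∈ maxCones T) :
    ∃ V : Chart T, rays V = {a, b, c} :=
  ⟨⟨Matrix.of ![a, b, c], by rw [triple_range]; exact h⟩, triple_range a b c⟩

theorem exists_chart_triangle (P : EdgePath T) {n : ℕ} (hn : n < k + l) :
    ∃ V : Chart T,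
      rays V = {rayA (P.i n), rayA (P.i (n + 1)), rayB (P.j n), rayB (P.j (n + 1))} := by
  have h := P.mem n hn
  have h' := (liftPt_stepTriangle (P.i n) (P.j n) (P.i (n + 1)) (P.j (n + 1))).symm
  rcases P.step n hn with ⟨h1, h2⟩ | ⟨h1, h2⟩
  · obtain ⟨V, hV⟩ := exists_chart_of_mem (T := T)
      (a := rayA (P.i n)) (b := rayA (P.i (n + 1))) (c := rayB (P.j n))
      (.inl ⟨_, h, by rw [← h', h2]; simp⟩)
    exact ⟨V, by rw [hV, h2]; simp⟩
  · obtain ⟨V, hV⟩ := exists_chart_of_mem (T := T)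
      (a := rayA (P.i n)) (b := rayB (P.j n)) (c := rayB (P.j (n + 1)))
      (.inl ⟨_, h, by rw [← h', h1]; simp⟩)
    exact ⟨V, by rw [hV, h1]; simp⟩

theorem exists_chart_XAB (T : MaxTriangulation k l) :
    ∃ V : Chart T, rays V = {rayX, rayA k, rayB l} :=
  exists_chart_of_mem (.inr (.inl rfl))
theorem exists_chart_negXAB (T : MaxTriangulation k l) :
    ∃ V : Chart T, rays V = {-rayX, rayA 0, rayB 0} :=
  exists_chart_of_mem (by rw [neg_rayX]; exact .inr (.inr (.inl rfl)))
theorem exists_chart_AAW (T : MaxTriangulation k l) {i : ℕ} (hi : i < k) :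
    ∃ V : Chart T, rays V = {rayA i, rayA (i + 1), rayW} :=
  exists_chart_of_mem (.inr (.inr (.inr (.inl ⟨i, hi, rfl⟩))))
theorem exists_chart_XAW (T : MaxTriangulation k l) :
    ∃ V : Chart T, rays V = {rayX, rayA k, rayW} :=
  exists_chart_of_mem (.inr (.inr (.inr (.inr (.inl rfl)))))
theorem exists_chart_negXAW (T : MaxTriangulation k l) :
    ∃ V : Chart T, rays V = {-rayX, rayA 0, rayW} :=
  exists_chart_of_mem (by rw [neg_rayX]; exact .inr (.inr (.inr (.inr (.inr (.inl rfl))))))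
theorem exists_chart_BBZ (T : MaxTriangulation k l) {j : ℕ} (hj : j < l) :
    ∃ V : Chart T, rays V = {rayB j, rayB (j + 1), rayZ} :=
  exists_chart_of_mem (.inr (.inr (.inr (.inr (.inr (.inr (.inl ⟨j, hj, rfl⟩)))))))
theorem exists_chart_XBZ (T : MaxTriangulation k l) :
    ∃ V : Chart T, rays V = {rayX, rayB l, rayZ} :=
  exists_chart_of_mem (.inr (.inr (.inr (.inr (.inr (.inr (.inr (.inl rfl))))))))
theorem exists_chart_negXBZ (T : MaxTriangulation k l) :
    ∃ V : Chart T, rays V = {-rayX, rayB 0, rayZ} :=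
  exists_chart_of_mem (by
    rw [neg_rayX]; exact .inr (.inr (.inr (.inr (.inr (.inr (.inr (.inr (.inl rfl)))))))))
theorem exists_chart_XZW (T : MaxTriangulation k l) :
    ∃ V : Chart T, rays V = {rayX, rayZ, rayW} :=
  exists_chart_of_mem (.inr (.inr (.inr (.inr (.inr (.inr (.inr (.inr (.inr (.inl rfl))))))))))
theorem exists_chart_negXZW (T : MaxTriangulation k l) :
    ∃ V : Chart T, rays V = {-rayX, rayZ, rayW} :=
  exists_chart_of_mem (by
    rw [neg_rayX]; exact .inr (.inr (.inr (.inr (.inr (.inr (.inr (.inr (.inr (.inr rfl)))))))))) 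

/-- The combinatorial properties of the set of rays of a maximal cone that are used below. -/
structure ConeFacts (P : EdgePath T) (σ : Set Lat) : Prop where
  cases : ∀ ρ ∈ σ, (∃ i, ρ = rayA i) ∨ (∃ j, ρ = rayB j) ∨ ρ = rayZ ∨ ρ = rayW ∨ ρ = rayX ∨
    ρ = -rayX
  bdA : ∀ i, rayA i ∈ σ → 0 ≤ i ∧ i ≤ k
  bdB : ∀ i, rayB i ∈ σ → 0 ≤ i ∧ i ≤ l
  adjA : ∀ i i', rayA i ∈ σ → rayA i' ∈ σ → i' ≤ i + 1
  adjB : ∀ i i', rayB i ∈ σ → rayB i' ∈ σ → i' ≤ i + 1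
  endA : ∀ i, rayX ∈ σ → rayA i ∈ σ → i = k
  endB : ∀ i, rayX ∈ σ → rayB i ∈ σ → i = l
  startA : ∀ i, -rayX ∈ σ → rayA i ∈ σ → i = 0
  startB : ∀ i, -rayX ∈ σ → rayB i ∈ σ → i = 0
  notX : rayX ∈ σ → -rayX ∉ σ
  notAZ : ∀ i, rayA i ∈ σ → rayZ ∉ σ
  notBW : ∀ i, rayB i ∈ σ → rayW ∉ σ
  edge : ∀ i j, rayA i ∈ σ → rayB j ∈ σ → ∃ n ≤ k + l, i = P.i n ∧ j = P.j n

theorem EdgePath.last (P : EdgePath T) : P.i (k + l) = k ∧ P.j (k + l) = l := by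
  have := P.add_eq (k + l) le_rfl
  have := P.bounds (k + l) le_rfl
  omega

theorem EdgePath.first (P : EdgePath T) : P.i 0 = 0 ∧ P.j 0 = 0 := by
  have := P.add_eq 0 (by omega)
  have := P.bounds 0 (by omega)
  omega

/-- Inspection of the list of cones. For `edge`, a cone with rays from both rows lies over a
triangle, whose two slanted edges are consecutive in the path, or is one of the two cones over the
slanted sides of the trapezoid, the first and last edges. -/
theorem coneFacts (P : EdgePath T) (V : Chart T) : ConeFacts P (rays V) := by
  obtain ⟨hk, hl⟩ := P.last
  obtain ⟨h0, h0'⟩ := P.first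
  rcases rays_cases P V with ⟨n, hn, hV⟩ | hV | hV | ⟨i, hi, hV⟩ | hV | hV | ⟨j, hj, hV⟩ | hV | hV |
    hV | hV
  · have b1 := P.bounds n hn.le
    have b2 := P.bounds (n + 1) hn
    have b3 := P.step n hn
    unfold IsStep at b3
    rw [hV]
    constructor <;> simp only [Set.mem_insert_iff, Set.mem_singleton_iff, rayA_inj, rayB_inj,
      rayA_ne_rayB, rayA_ne_rayB.symm, rayA_ne_rayX.symm, rayA_ne_neg_rayX.symm, rayA_ne_rayZ.symm,
      rayA_ne_rayW.symm, rayB_ne_rayX.symm, rayB_ne_neg_rayX.symm, rayB_ne_rayZ.symm,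
      rayB_ne_rayW.symm, false_or, or_false, not_false_eq_true, implies_true, false_implies]
    · rintro ρ (rfl | rfl | rfl | rfl) <;> simp [rayA_inj, rayB_inj]
    · omega
    · omega
    · omega
    · omega
    · intro i j hi hj
      rcases (by omega : (i = P.i n ∧ j = P.j n) ∨ (i = P.i (n + 1) ∧ j = P.j (n + 1))) with h | h
      · exact ⟨n, hn.le, h⟩
      · exact ⟨n + 1, hn, h⟩
  all_goals
    rw [hV]
    constructor <;> simp only [Set.mem_insert_iff, Set.mem_singleton_iff, rayA_inj, rayB_inj,
      rayA_ne_rayB, rayA_ne_rayB.symm, rayA_ne_rayX, rayA_ne_rayX.symm, rayA_ne_neg_rayX,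
      rayA_ne_neg_rayX.symm, rayA_ne_rayZ, rayA_ne_rayZ.symm,
      rayA_ne_rayW, rayA_ne_rayW.symm, rayB_ne_rayX, rayB_ne_rayX.symm, rayB_ne_neg_rayX,
      rayB_ne_neg_rayX.symm, rayB_ne_rayZ, rayB_ne_rayZ.symm, rayB_ne_rayW,
      rayB_ne_rayW.symm, rayZ_ne_rayX, rayZ_ne_rayX.symm, rayZ_ne_neg_rayX, rayZ_ne_neg_rayX.symm,
      rayW_ne_rayX, rayW_ne_rayX.symm, rayW_ne_neg_rayX, rayW_ne_neg_rayX.symm, rayZ_ne_rayW,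
      rayZ_ne_rayW.symm, rayX_ne_neg_rayX, rayX_ne_neg_rayX.symm,
      false_or, or_false, not_false_eq_true, implies_true, false_implies, or_true,
      forall_true_left, forall_eq]
    case cases =>
      rintro ρ (rfl | rfl | rfl) <;> simp [rayA_inj, rayB_inj]
    all_goals first
      | omega
      | exact ⟨k + l, le_rfl, hk.symm, hl.symm⟩
      | exact ⟨0, Nat.zero_le _, h0.symm, h0'.symm⟩
      | (intro i j hi hj; subst hi hj; exact ⟨k + l, le_rfl, hk.symm, hl.symm⟩)
      | (intro i j hi hj; subst hi hj; exact ⟨0, by omega, h0.symm, h0'.symm⟩)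

end GenConifold

end

noncomputable section

open scoped Matrix Topology

namespace GenConifold

variable {k l : ℕ} {T : MaxTriangulation k l}

/-! ### The chain of torus orbits in a fibre of `(z, w)` -/

/-- The points `0` and `∞` of `ℙ¹`. -/
abbrev zeroP : OnePoint ℂ := ((0 : ℂ) : OnePoint ℂ)
abbrev inftyP : OnePoint ℂ := OnePoint.infty

theorem zeroP_ne_inftyP : zeroP ≠ inftyP := OnePoint.coe_ne_infty 0

/-- The cone of the non-fixed orbit of index `(i, j)` over the point `(z, w)`. -/
def cone (i j : ℤ) (z w : OnePoint ℂ) : Set Lat :=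
  {ρ | (ρ = rayA i ∧ z = zeroP) ∨ (ρ = rayB j ∧ w = zeroP) ∨ (ρ = rayZ ∧ z = inftyP) ∨
    (ρ = rayW ∧ w = inftyP)}

section
variable {i j i' : ℤ} {z w : OnePoint ℂ}

@[simp] theorem rayA_mem_cone : rayA i' ∈ cone i j z w ↔ i' = i ∧ z = zeroP := by
  simp [cone, rayA_inj, rayA_ne_rayB, rayA_ne_rayZ, rayA_ne_rayW]
@[simp] theorem rayB_mem_cone : rayB i' ∈ cone i j z w ↔ i' = j ∧ w = zeroP := by
  simp [cone, rayB_inj, rayA_ne_rayB.symm, rayB_ne_rayZ, rayB_ne_rayW]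
@[simp] theorem rayZ_mem_cone : rayZ ∈ cone i j z w ↔ z = inftyP := by
  simp [cone, rayA_ne_rayZ.symm, rayB_ne_rayZ.symm, rayZ_ne_rayW]
@[simp] theorem rayW_mem_cone : rayW ∈ cone i j z w ↔ w = inftyP := by
  simp [cone, rayA_ne_rayW.symm, rayB_ne_rayW.symm, rayZ_ne_rayW.symm]
@[simp] theorem rayX_mem_cone : rayX ∉ cone i j z w := by
  simp [cone, rayA_ne_rayX.symm, rayB_ne_rayX.symm, rayZ_ne_rayX.symm, rayW_ne_rayX.symm]
@[simp] theorem neg_rayX_mem_cone : -rayX ∉ cone i j z w := by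
  simp [cone, rayA_ne_neg_rayX.symm, rayB_ne_neg_rayX.symm, rayZ_ne_neg_rayX.symm,
    rayW_ne_neg_rayX.symm]
end

/-- Being one of the possible rays of the fan. -/
def IsRay (ρ : Lat) : Prop :=
  (∃ i, ρ = rayA i) ∨ (∃ j, ρ = rayB j) ∨ ρ = rayZ ∨ ρ = rayW ∨ ρ = rayX ∨ ρ = -rayX

theorem isRay_of_mem_cone {i j : ℤ} {z w : OnePoint ℂ} {ρ : Lat} (h : ρ ∈ cone i j z w) :
    IsRay ρ := by
  rcases h with ⟨rfl, -⟩ | ⟨rfl, -⟩ | ⟨rfl, -⟩ | ⟨rfl, -⟩ <;> simp [IsRay, rayA_inj, rayB_inj]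

theorem rays_ext {σ τ : Set Lat} (hσ : ∀ ρ ∈ σ, IsRay ρ) (hτ : ∀ ρ ∈ τ, IsRay ρ)
    (hA : ∀ i, rayA i ∈ σ ↔ rayA i ∈ τ) (hB : ∀ i, rayB i ∈ σ ↔ rayB i ∈ τ)
    (hZ : rayZ ∈ σ ↔ rayZ ∈ τ) (hW : rayW ∈ σ ↔ rayW ∈ τ) (hX : rayX ∈ σ ↔ rayX ∈ τ)
    (hN : -rayX ∈ σ ↔ -rayX ∈ τ) : σ = τ := by
  have : ∀ ρ, IsRay ρ → (ρ ∈ σ ↔ ρ ∈ τ) := by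
    rintro ρ (⟨i, rfl⟩ | ⟨i, rfl⟩ | rfl | rfl | rfl | rfl)
    exacts [hA i, hB i, hZ, hW, hX, hN]
  ext ρ
  exact ⟨fun h => (this ρ (hσ ρ h)).1 h, fun h => (this ρ (hτ ρ h)).2 h⟩

/-- The cone `τ` may occur over the point `(z, w)`. -/
structure Compat (τ : Set Lat) (z w : OnePoint ℂ) : Prop where
  z_zero : z = zeroP ↔ ∃ i, rayA i ∈ τ
  w_zero : w = zeroP ↔ ∃ j, rayB j ∈ τ
  z_infty : z = inftyP ↔ rayZ ∈ τ
  w_infty : w = inftyP ↔ rayW ∈ τ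

/-- The sequence of orbits in the fibre over `(z, w)`. -/
structure FibreChain (T : MaxTriangulation k l) (z w : OnePoint ℂ) where
  L : ℕ
  i : ℕ → ℤ
  j : ℕ → ℤ
  first : ∃ V : Chart T, insert (-rayX) (cone (i 0) (j 0) z w) ⊆ rays V
  last : ∃ V : Chart T, insert rayX (cone (i L) (j L) z w) ⊆ rays V
  mid : ∀ n < L, ∃ V : Chart T, cone (i n) (j n) z w ∪ cone (i (n + 1)) (j (n + 1)) z w ⊆ rays V
  step : ∀ n < L, (z = zeroP ∧ i (n + 1) = i n + 1 ∧ j (n + 1) = j n) ∨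
    (w = zeroP ∧ i (n + 1) = i n ∧ j (n + 1) = j n + 1)
  exhaust : ∀ (V : Chart T) (τ : Set Lat), τ ⊆ rays V → Compat τ z w →
    (∃ n ≤ L, τ = cone (i n) (j n) z w) ∨
    (∃ n < L, τ = cone (i n) (j n) z w ∪ cone (i (n + 1)) (j (n + 1)) z w) ∨
    τ = insert (-rayX) (cone (i 0) (j 0) z w) ∨ τ = insert rayX (cone (i L) (j L) z w)

section
variable {P : EdgePath T} {σ τ : Set Lat} {z w : OnePoint ℂ}

/-- By `adjA` the indices differ by at most one; the witness is the smallest of them. -/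
theorem ConeFacts.exists_A (F : ConeFacts P σ) (hτ : τ ⊆ σ) (h : ∃ i, rayA i ∈ τ) :
    ∃ i, rayA i ∈ τ ∧ ((∀ i', rayA i' ∈ τ ↔ i' = i) ∨
      (rayA (i + 1) ∈ τ ∧ ∀ i', rayA i' ∈ τ ↔ i' = i ∨ i' = i + 1)) := by
  have adj := fun i i' (h : rayA i ∈ τ) (h' : rayA i' ∈ τ) => F.adjA i i' (hτ h) (hτ h')
  have key : ∃ i, rayA i ∈ τ ∧ rayA (i - 1) ∉ τ := by
    obtain ⟨i, hi⟩ := h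
    by_cases h1 : rayA (i - 1) ∈ τ
    · exact ⟨i - 1, h1, fun h2 => by have := adj _ _ h2 hi; omega⟩
    · exact ⟨i, hi, h1⟩
  obtain ⟨i, hi, hi'⟩ := key
  refine ⟨i, hi, ?_⟩
  have h2 : ∀ i', rayA i' ∈ τ → i' = i ∨ i' = i + 1 := by
    intro i' h'
    have h3 : i' ≠ i - 1 := by rintro rfl; exact hi' h'
    have := adj _ _ h' hi
    have := adj _ _ hi h'
    omega
  by_cases h1 : rayA (i + 1) ∈ τ
  · refine .inr ⟨h1, fun i' => ⟨h2 i', ?_⟩⟩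
    rintro (rfl | rfl) <;> assumption
  · refine .inl fun i' => ⟨fun h => ?_, by rintro rfl; exact hi⟩
    rcases h2 i' h with rfl | rfl
    · rfl
    · exact absurd h h1

theorem ConeFacts.exists_B (F : ConeFacts P σ) (hτ : τ ⊆ σ) (h : ∃ i, rayB i ∈ τ) :
    ∃ i, rayB i ∈ τ ∧ ((∀ i', rayB i' ∈ τ ↔ i' = i) ∨
      (rayB (i + 1) ∈ τ ∧ ∀ i', rayB i' ∈ τ ↔ i' = i ∨ i' = i + 1)) := by
  have adj := fun i i' (h : rayB i ∈ τ) (h' : rayB i' ∈ τ) => F.adjB i i' (hτ h) (hτ h')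
  have key : ∃ i, rayB i ∈ τ ∧ rayB (i - 1) ∉ τ := by
    obtain ⟨i, hi⟩ := h
    by_cases h1 : rayB (i - 1) ∈ τ
    · exact ⟨i - 1, h1, fun h2 => by have := adj _ _ h2 hi; omega⟩
    · exact ⟨i, hi, h1⟩
  obtain ⟨i, hi, hi'⟩ := key
  refine ⟨i, hi, ?_⟩
  have h2 : ∀ i', rayB i' ∈ τ → i' = i ∨ i' = i + 1 := by
    intro i' h'
    have h3 : i' ≠ i - 1 := by rintro rfl; exact hi' h'
    have := adj _ _ h' hi
    have := adj _ _ hi h'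
    omega
  by_cases h1 : rayB (i + 1) ∈ τ
  · refine .inr ⟨h1, fun i' => ⟨h2 i', ?_⟩⟩
    rintro (rfl | rfl) <;> assumption
  · refine .inl fun i' => ⟨fun h => ?_, by rintro rfl; exact hi⟩
    rcases h2 i' h with rfl | rfl
    · rfl
    · exact absurd h h1

/-- Over `(z, w)`, a cone is determined by the indices of its rays and its intersection with
`± rayX`. -/
theorem Compat.eq_of {I J : Set ℤ} (F : ConeFacts P σ) (hτ : τ ⊆ σ) (hc : Compat τ z w)
    {τ' : Set Lat} (hray : ∀ ρ ∈ τ', IsRay ρ)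
    (hA : ∀ i, rayA i ∈ τ ↔ i ∈ I) (hB : ∀ i, rayB i ∈ τ ↔ i ∈ J)
    (hA' : ∀ i, rayA i ∈ τ' ↔ i ∈ I) (hB' : ∀ i, rayB i ∈ τ' ↔ i ∈ J)
    (hZ : rayZ ∈ τ' ↔ z = inftyP) (hW : rayW ∈ τ' ↔ w = inftyP) (hX : rayX ∈ τ ↔ rayX ∈ τ')
    (hN : -rayX ∈ τ ↔ -rayX ∈ τ') : τ = τ' :=
  rays_ext (fun ρ h => F.cases ρ (hτ h)) hray (fun i => (hA i).trans (hA' i).symm)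
    (fun i => (hB i).trans (hB' i).symm) (hc.z_infty.symm.trans hZ.symm)
    (hc.w_infty.symm.trans hW.symm) hX hN

end

theorem mem_insert_simps (σ : Set Lat) :
    (∀ i, rayA i ∈ insert rayX σ ↔ rayA i ∈ σ) ∧ (∀ i, rayB i ∈ insert rayX σ ↔ rayB i ∈ σ) ∧
    (rayZ ∈ insert rayX σ ↔ rayZ ∈ σ) ∧ (rayW ∈ insert rayX σ ↔ rayW ∈ σ) ∧
    (∀ i, rayA i ∈ insert (-rayX) σ ↔ rayA i ∈ σ) ∧
    (∀ i, rayB i ∈ insert (-rayX) σ ↔ rayB i ∈ σ) ∧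
    (rayZ ∈ insert (-rayX) σ ↔ rayZ ∈ σ) ∧ (rayW ∈ insert (-rayX) σ ↔ rayW ∈ σ) ∧
    (rayX ∈ insert (-rayX) σ ↔ rayX ∈ σ) ∧ (-rayX ∈ insert rayX σ ↔ -rayX ∈ σ) := by
  simp [rayA_ne_rayX, rayB_ne_rayX, rayZ_ne_rayX, rayW_ne_rayX, rayA_ne_neg_rayX,
    rayB_ne_neg_rayX, rayZ_ne_neg_rayX, rayW_ne_neg_rayX, rayX_ne_neg_rayX, rayX_ne_neg_rayX.symm]

section
variable {i j i' j' : ℤ} {z w : OnePoint ℂ}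

theorem isRay_insert_cone {ρ : Lat} (h : ρ ∈ insert rayX (cone i j z w)) : IsRay ρ := by
  rcases h with rfl | h
  · simp [IsRay]
  · exact isRay_of_mem_cone h

theorem isRay_insert_neg_cone {ρ : Lat} (h : ρ ∈ insert (-rayX) (cone i j z w)) : IsRay ρ := by
  rcases h with rfl | h
  · simp [IsRay]
  · exact isRay_of_mem_cone h

theorem isRay_union_cone {ρ : Lat} (h : ρ ∈ cone i j z w ∪ cone i' j' z w) : IsRay ρ := by
  rcases h with h | h <;> exact isRay_of_mem_cone h

end

/-- The alternatives for a cone over `(z, w)` whose intersection with the two rows is given by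
single rays. -/
theorem Compat.single {P : EdgePath T} {σ τ : Set Lat} {z w : OnePoint ℂ} (F : ConeFacts P σ)
    (hτ : τ ⊆ σ) (hc : Compat τ z w) {i j : ℤ} (hA : ∀ i', rayA i' ∈ τ ↔ i' = i ∧ z = zeroP)
    (hB : ∀ i', rayB i' ∈ τ ↔ i' = j ∧ w = zeroP) :
    (rayX ∉ τ ∧ -rayX ∉ τ ∧ τ = cone i j z w) ∨
    (rayX ∈ τ ∧ τ = insert rayX (cone i j z w)) ∨
    (-rayX ∈ τ ∧ τ = insert (-rayX) (cone i j z w)) := by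
  obtain ⟨a1, a2, a3, a4, a5, a6, a7, a8, a9, a10⟩ := mem_insert_simps (cone i j z w)
  by_cases hX : rayX ∈ τ
  · have hN : -rayX ∉ τ := fun h => F.notX (hτ hX) (hτ h)
    refine .inr (.inl ⟨hX, hc.eq_of (I := {i' | i' = i ∧ z = zeroP}) (J := {i' | i' = j ∧ w = zeroP})
      F hτ (fun ρ => isRay_insert_cone) hA hB ?_ ?_ ?_ ?_ ?_ ?_⟩) <;> simp [*]
  · by_cases hN : -rayX ∈ τ
    · refine .inr (.inr ⟨hN, hc.eq_of (I := {i' | i' = i ∧ z = zeroP})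
        (J := {i' | i' = j ∧ w = zeroP})
        F hτ (fun ρ => isRay_insert_neg_cone) hA hB ?_ ?_ ?_ ?_ ?_ ?_⟩) <;> simp [*]
    · refine .inl ⟨hX, hN, hc.eq_of (I := {i' | i' = i ∧ z = zeroP})
        (J := {i' | i' = j ∧ w = zeroP})
        F hτ (fun ρ => isRay_of_mem_cone) hA hB ?_ ?_ ?_ ?_ ?_ ?_⟩ <;> simp [*]

/-- Next to `rayX` or `-rayX` only one index is allowed in a row, so two neighbouring rays exclude
both. What remains is the fixed point between two consecutive orbits. -/
theorem Compat.doubleA {P : EdgePath T} {σ τ : Set Lat} {z w : OnePoint ℂ} (F : ConeFacts P σ)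
    (hτ : τ ⊆ σ) (hc : Compat τ z w) {i j : ℤ} (hz : z = zeroP)
    (hA : ∀ i', rayA i' ∈ τ ↔ i' = i ∨ i' = i + 1)
    (hB : ∀ i', rayB i' ∈ τ ↔ i' = j ∧ w = zeroP) : τ = cone i j z w ∪ cone (i + 1) j z w := by
  have h1 := (hA i).2 (.inl rfl)
  have h2 := (hA (i + 1)).2 (.inr rfl)
  have hX : rayX ∉ τ := fun h => by
    have := F.endA _ (hτ h) (hτ h1); have := F.endA _ (hτ h) (hτ h2); omega
  have hN : -rayX ∉ τ := fun h => by
    have := F.startA _ (hτ h) (hτ h1); have := F.startA _ (hτ h) (hτ h2); omega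
  refine hc.eq_of (I := {i' | i' = i ∨ i' = i + 1}) (J := {i' | i' = j ∧ w = zeroP})
    F hτ (fun ρ => isRay_union_cone) hA hB ?_ ?_ ?_ ?_ ?_ ?_ <;> simp [*]

theorem Compat.doubleB {P : EdgePath T} {σ τ : Set Lat} {z w : OnePoint ℂ} (F : ConeFacts P σ)
    (hτ : τ ⊆ σ) (hc : Compat τ z w) {i j : ℤ} (hw : w = zeroP)
    (hA : ∀ i', rayA i' ∈ τ ↔ i' = i ∧ z = zeroP)
    (hB : ∀ i', rayB i' ∈ τ ↔ i' = j ∨ i' = j + 1) : τ = cone i j z w ∪ cone i (j + 1) z w := by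
  have h1 := (hB j).2 (.inl rfl)
  have h2 := (hB (j + 1)).2 (.inr rfl)
  have hX : rayX ∉ τ := fun h => by
    have := F.endB _ (hτ h) (hτ h1); have := F.endB _ (hτ h) (hτ h2); omega
  have hN : -rayX ∉ τ := fun h => by
    have := F.startB _ (hτ h) (hτ h1); have := F.startB _ (hτ h) (hτ h2); omega
  refine hc.eq_of (I := {i' | i' = i ∧ z = zeroP}) (J := {i' | i' = j ∨ i' = j + 1})
    F hτ (fun ρ => isRay_union_cone) hA hB ?_ ?_ ?_ ?_ ?_ ?_ <;> simp [*]

/-- The chain over a point with `z ≠ 0` and `w ≠ 0`. -/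
def chainGeneric (P : EdgePath T) {z w : OnePoint ℂ} (hz : z ≠ zeroP) (hw : w ≠ zeroP) :
    FibreChain T z w where
  L := 0
  i _ := 0
  j _ := 0
  first := by
    obtain ⟨V, hV⟩ := exists_chart_negXZW T
    refine ⟨V, ?_⟩
    rw [hV]
    rintro ρ (rfl | ⟨-, h⟩ | ⟨-, h⟩ | ⟨rfl, -⟩ | ⟨rfl, -⟩) <;> simp_all
  last := by
    obtain ⟨V, hV⟩ := exists_chart_XZW T
    refine ⟨V, ?_⟩
    rw [hV]
    rintro ρ (rfl | ⟨-, h⟩ | ⟨-, h⟩ | ⟨rfl, -⟩ | ⟨rfl, -⟩) <;> simp_all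
  mid n hn := absurd hn (Nat.not_lt_zero n)
  step n hn := absurd hn (Nat.not_lt_zero n)
  exhaust V τ hτ hc := by
    have hA : ∀ i', rayA i' ∈ τ ↔ i' = 0 ∧ z = zeroP := fun i' =>
      ⟨fun h => absurd (hc.z_zero.2 ⟨i', h⟩) hz, fun h => absurd h.2 hz⟩
    have hB : ∀ i', rayB i' ∈ τ ↔ i' = 0 ∧ w = zeroP := fun i' =>
      ⟨fun h => absurd (hc.w_zero.2 ⟨i', h⟩) hw, fun h => absurd h.2 hw⟩
    rcases hc.single (coneFacts P V) hτ hA hB with h | h | h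
    · exact .inl ⟨0, le_rfl, h.2.2⟩
    · exact .inr (.inr (.inr h.2))
    · exact .inr (.inr (.inl h.2))

/-- The chain over a point with `z = 0` and `w ≠ 0`. -/
def chainA (P : EdgePath T) {w : OnePoint ℂ} (hw : w ≠ zeroP) : FibreChain T zeroP w where
  L := k
  i n := n
  j _ := 0
  first := by
    obtain ⟨V, hV⟩ := exists_chart_negXAW T
    refine ⟨V, ?_⟩
    rw [hV]
    rintro ρ (rfl | ⟨rfl, -⟩ | ⟨-, h⟩ | ⟨rfl, h⟩ | ⟨rfl, -⟩) <;> simp_all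
  last := by
    obtain ⟨V, hV⟩ := exists_chart_XAW T
    refine ⟨V, ?_⟩
    rw [hV]
    rintro ρ (rfl | ⟨rfl, -⟩ | ⟨-, h⟩ | ⟨rfl, h⟩ | ⟨rfl, -⟩) <;> simp_all
  mid n hn := by
    obtain ⟨V, hV⟩ := exists_chart_AAW T hn
    refine ⟨V, ?_⟩
    rw [hV]
    rintro ρ ((⟨rfl, -⟩ | ⟨-, h⟩ | ⟨rfl, h⟩ | ⟨rfl, -⟩) | (⟨rfl, -⟩ | ⟨-, h⟩ | ⟨rfl, h⟩ | ⟨rfl, -⟩))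
      <;> simp_all
  step n _ := .inl ⟨rfl, by push_cast; rfl, rfl⟩
  exhaust V τ hτ hc := by
    have F := coneFacts P V
    have hB : ∀ i', rayB i' ∈ τ ↔ i' = 0 ∧ w = zeroP := fun i' =>
      ⟨fun h => absurd (hc.w_zero.2 ⟨i', h⟩) hw, fun h => absurd h.2 hw⟩
    obtain ⟨i, hi, hA | ⟨hi', hA⟩⟩ := F.exists_A hτ (hc.z_zero.1 rfl)
    · have hb := F.bdA i (hτ hi)
      rcases hc.single F hτ (i := i) (by simpa using hA) hB with h | h | h
      · refine .inl ⟨i.toNat, by omega, ?_⟩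
        rw [Int.toNat_of_nonneg hb.1]
        exact h.2.2
      · obtain rfl := F.endA i (hτ h.1) (hτ hi)
        exact .inr (.inr (.inr h.2))
      · obtain rfl := F.startA i (hτ h.1) (hτ hi)
        exact .inr (.inr (.inl h.2))
    · have hb := F.bdA i (hτ hi)
      have hb' := F.bdA _ (hτ hi')
      refine .inr (.inl ⟨i.toNat, by omega, ?_⟩)
      push_cast
      rw [Int.toNat_of_nonneg hb.1]
      exact hc.doubleA F hτ rfl hA hB

/-- The chain over a point with `z ≠ 0` and `w = 0`. -/
def chainB (P : EdgePath T) {z : OnePoint ℂ} (hz : z ≠ zeroP) : FibreChain T z zeroP where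
  L := l
  i _ := 0
  j n := n
  first := by
    obtain ⟨V, hV⟩ := exists_chart_negXBZ T
    refine ⟨V, ?_⟩
    rw [hV]
    rintro ρ (rfl | ⟨-, h⟩ | ⟨rfl, -⟩ | ⟨rfl, -⟩ | ⟨rfl, h⟩) <;> simp_all
  last := by
    obtain ⟨V, hV⟩ := exists_chart_XBZ T
    refine ⟨V, ?_⟩
    rw [hV]
    rintro ρ (rfl | ⟨-, h⟩ | ⟨rfl, -⟩ | ⟨rfl, -⟩ | ⟨rfl, h⟩) <;> simp_all
  mid n hn := by
    obtain ⟨V, hV⟩ := exists_chart_BBZ T hn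
    refine ⟨V, ?_⟩
    rw [hV]
    rintro ρ ((⟨-, h⟩ | ⟨rfl, -⟩ | ⟨rfl, -⟩ | ⟨rfl, h⟩) | (⟨-, h⟩ | ⟨rfl, -⟩ | ⟨rfl, -⟩ | ⟨rfl, h⟩))
      <;> simp_all
  step n _ := .inr ⟨rfl, rfl, by push_cast; rfl⟩
  exhaust V τ hτ hc := by
    have F := coneFacts P V
    have hA : ∀ i', rayA i' ∈ τ ↔ i' = 0 ∧ z = zeroP := fun i' =>
      ⟨fun h => absurd (hc.z_zero.2 ⟨i', h⟩) hz, fun h => absurd h.2 hz⟩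
    obtain ⟨i, hi, hB | ⟨hi', hB⟩⟩ := F.exists_B hτ (hc.w_zero.1 rfl)
    · have hb := F.bdB i (hτ hi)
      rcases hc.single F hτ (j := i) hA (by simpa using hB) with h | h | h
      · refine .inl ⟨i.toNat, by omega, ?_⟩
        rw [Int.toNat_of_nonneg hb.1]
        exact h.2.2
      · obtain rfl := F.endB i (hτ h.1) (hτ hi)
        exact .inr (.inr (.inr h.2))
      · obtain rfl := F.startB i (hτ h.1) (hτ hi)
        exact .inr (.inr (.inl h.2))
    · have hb := F.bdB i (hτ hi)
      have hb' := F.bdB _ (hτ hi')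
      refine .inr (.inl ⟨i.toNat, by omega, ?_⟩)
      push_cast
      rw [Int.toNat_of_nonneg hb.1]
      exact hc.doubleB F hτ rfl hA hB

/-- The chain over the point `(0, 0)`. -/
def chainAB (P : EdgePath T) : FibreChain T zeroP zeroP where
  L := k + l
  i := P.i
  j := P.j
  first := by
    obtain ⟨V, hV⟩ := exists_chart_negXAB T
    refine ⟨V, ?_⟩
    rw [hV, P.first.1, P.first.2]
    rintro ρ (rfl | ⟨rfl, -⟩ | ⟨rfl, -⟩ | ⟨-, h⟩ | ⟨-, h⟩) <;> simp_all
  last := by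
    obtain ⟨V, hV⟩ := exists_chart_XAB T
    refine ⟨V, ?_⟩
    rw [hV, P.last.1, P.last.2]
    rintro ρ (rfl | ⟨rfl, -⟩ | ⟨rfl, -⟩ | ⟨-, h⟩ | ⟨-, h⟩) <;> simp_all
  mid n hn := by
    obtain ⟨V, hV⟩ := exists_chart_triangle P hn
    refine ⟨V, ?_⟩
    rw [hV]
    rintro ρ ((⟨rfl, -⟩ | ⟨rfl, -⟩ | ⟨-, h⟩ | ⟨-, h⟩) | (⟨rfl, -⟩ | ⟨rfl, -⟩ | ⟨-, h⟩ | ⟨-, h⟩))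
      <;> simp_all
  step n hn := by simpa [IsStep] using P.step n hn
  exhaust V τ hτ hc := by
    have F := coneFacts P V
    have hedge := fun a b (ha : rayA a ∈ τ) (hb : rayB b ∈ τ) => F.edge a b (hτ ha) (hτ hb)
    obtain ⟨a, ha, hA⟩ := F.exists_A hτ (hc.z_zero.1 rfl)
    obtain ⟨b, hb, hB⟩ := F.exists_B hτ (hc.w_zero.1 rfl)
    obtain ⟨n, hn, rfl, rfl⟩ := hedge a b ha hb
    rcases hA with hA | ⟨ha', hA⟩
    · rcases hB with hB | ⟨hb', hB⟩
      · rcases hc.single F hτ (i := P.i n) (j := P.j n) (by simpa using hA) (by simpa using hB)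
          with h | h | h
        · exact .inl ⟨n, hn, h.2.2⟩
        · have h1 := F.endA _ (hτ h.1) (hτ ha)
          have h2 := F.endB _ (hτ h.1) (hτ hb)
          refine .inr (.inr (.inr ?_))
          rw [P.last.1, P.last.2, ← h1, ← h2]
          exact h.2
        · have h1 := F.startA _ (hτ h.1) (hτ ha)
          have h2 := F.startB _ (hτ h.1) (hτ hb)
          refine .inr (.inr (.inl ?_))
          rw [P.first.1, P.first.2, h.2, h1, h2]
      · obtain ⟨n', hn', h1, h2⟩ := hedge _ _ ha hb'
        have e1 := P.add_eq n hn
        have e2 := P.add_eq n' hn'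
        obtain rfl : n' = n + 1 := by omega
        refine .inr (.inl ⟨n, by omega, ?_⟩)
        rw [← h1, ← h2]
        exact hc.doubleB F hτ rfl (by simpa using hA) hB
    · obtain ⟨n', hn', h1, h2⟩ := hedge _ _ ha' hb
      have e1 := P.add_eq n hn
      have e2 := P.add_eq n' hn'
      obtain rfl : n' = n + 1 := by omega
      rcases hB with hB | ⟨hb', hB⟩
      · refine .inr (.inl ⟨n, by omega, ?_⟩)
        rw [← h1, ← h2]
        exact hc.doubleA F hτ rfl hA (by simpa using hB)
      -- Four rays would give two different edges with the same sum, the diagonals of a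
      -- parallelogram.
      · obtain ⟨n'', hn'', h1', h2'⟩ := hedge _ _ ha hb'
        have e3 := P.add_eq n'' hn''
        obtain rfl : n'' = n + 1 := by omega
        omega

theorem nonempty_chain (P : EdgePath T) (z w : OnePoint ℂ) : Nonempty (FibreChain T z w) := by
  by_cases hz : z = zeroP
  · subst hz
    by_cases hw : w = zeroP
    · subst hw
      exact ⟨chainAB P⟩
    · exact ⟨chainA P hw⟩
  · by_cases hw : w = zeroP
    · subst hw
      exact ⟨chainB P hz⟩
    · exact ⟨chainGeneric P hz hw⟩

end GenConifold

end

noncomputable section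

open scoped Matrix Topology

namespace GenConifold

variable {k l : ℕ} {T : MaxTriangulation k l}

/-! ### Points over `(z, w)` and their coordinates -/

@[simp] theorem nuZ_rayA (i : ℤ) : nuZ ⬝ᵥ rayA i = 1 := by rw [nuZ_dot]; rfl
@[simp] theorem nuZ_rayB (i : ℤ) : nuZ ⬝ᵥ rayB i = 0 := by rw [nuZ_dot]; rfl
@[simp] theorem nuZ_rayZ : nuZ ⬝ᵥ rayZ = -1 := by rw [nuZ_dot]; rfl
@[simp] theorem nuZ_rayW : nuZ ⬝ᵥ rayW = 0 := by rw [nuZ_dot]; rfl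
@[simp] theorem nuZ_rayX : nuZ ⬝ᵥ rayX = 0 := by rw [nuZ_dot]; rfl
@[simp] theorem nuW_rayA (i : ℤ) : nuW ⬝ᵥ rayA i = 0 := by rw [nuW_dot]; rfl
@[simp] theorem nuW_rayB (i : ℤ) : nuW ⬝ᵥ rayB i = 1 := by rw [nuW_dot]; rfl
@[simp] theorem nuW_rayZ : nuW ⬝ᵥ rayZ = 0 := by rw [nuW_dot]; rfl
@[simp] theorem nuW_rayW : nuW ⬝ᵥ rayW = -1 := by rw [nuW_dot]; rfl
@[simp] theorem nuW_rayX : nuW ⬝ᵥ rayX = 0 := by rw [nuW_dot]; rfl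

theorem IsRay.nuZ_pos {ρ : Lat} (h : IsRay ρ) : 0 < nuZ ⬝ᵥ ρ ↔ ∃ i, ρ = rayA i := by
  rcases h with ⟨i, rfl⟩ | ⟨i, rfl⟩ | rfl | rfl | rfl | rfl <;>
    simp [rayA_inj, rayA_ne_rayB.symm, rayA_ne_rayZ.symm, rayA_ne_rayW.symm, rayA_ne_rayX.symm,
      rayA_ne_neg_rayX.symm, dotProduct_neg, -nuZ_dot]

theorem IsRay.nuZ_neg {ρ : Lat} (h : IsRay ρ) : nuZ ⬝ᵥ ρ < 0 ↔ ρ = rayZ := by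
  rcases h with ⟨i, rfl⟩ | ⟨i, rfl⟩ | rfl | rfl | rfl | rfl <;>
    simp [rayB_ne_rayZ, rayA_ne_rayZ, rayZ_ne_rayW.symm, rayZ_ne_rayX.symm,
      rayZ_ne_neg_rayX.symm, dotProduct_neg, -nuZ_dot]

theorem IsRay.nuW_pos {ρ : Lat} (h : IsRay ρ) : 0 < nuW ⬝ᵥ ρ ↔ ∃ i, ρ = rayB i := by
  rcases h with ⟨i, rfl⟩ | ⟨i, rfl⟩ | rfl | rfl | rfl | rfl <;>
    simp [rayB_inj, rayA_ne_rayB, rayB_ne_rayZ.symm, rayB_ne_rayW.symm, rayB_ne_rayX.symm,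
      rayB_ne_neg_rayX.symm, dotProduct_neg, -nuW_dot]

theorem IsRay.nuW_neg {ρ : Lat} (h : IsRay ρ) : nuW ⬝ᵥ ρ < 0 ↔ ρ = rayW := by
  rcases h with ⟨i, rfl⟩ | ⟨i, rfl⟩ | rfl | rfl | rfl | rfl <;>
    simp [rayB_ne_rayW, rayA_ne_rayW, rayZ_ne_rayW, rayW_ne_rayX.symm,
      rayW_ne_neg_rayX.symm, dotProduct_neg, -nuW_dot]

theorem isRay_row (P : EdgePath T) (V : Chart T) (a : Fin 3) : IsRay (V.1 a) :=
  (coneFacts P V).cases _ ⟨a, rfl⟩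

theorem zeroRows_subset_rays (V : Chart T) (t : C3) : zeroRows V.1 t ⊆ rays V := by
  rintro ρ ⟨i, rfl, -⟩
  exact ⟨i, rfl⟩

theorem row_injective {A : Matrix (Fin 3) (Fin 3) ℤ} (hA : IsUnit A.det) {a b : Fin 3}
    (h : A a = A b) : a = b := by
  by_contra hne
  exact hA.ne_zero (Matrix.det_zero_of_row_eq hne h)

theorem mem_zeroRows {A : Matrix (Fin 3) (Fin 3) ℤ} (hA : IsUnit A.det) {t : C3} {a : Fin 3} :
    A a ∈ zeroRows A t ↔ t a = 0 := by
  constructor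
  · rintro ⟨b, hb, h⟩
    rwa [row_injective hA hb] at h
  · exact fun h => ⟨a, rfl, h⟩

theorem charM_eq_infty {m : Lat} {A : Matrix (Fin 3) (Fin 3) ℤ} {t : C3} :
    charM m A t = inftyP ↔ ∃ ρ ∈ zeroRows A t, m ⬝ᵥ ρ < 0 := by
  unfold charM
  split_ifs with h
  · simp [h]
  · simp [h]

theorem charM_eq_coe {m : Lat} {A : Matrix (Fin 3) (Fin 3) ℤ} {t : C3}
    (h : ∀ ρ ∈ zeroRows A t, 0 ≤ m ⬝ᵥ ρ) : charM m A t = ((monoM A m t : ℂ) : OnePoint ℂ) := by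
  unfold charM
  rw [if_neg]
  push Not
  exact h

/-- A vanishing product has a factor `t_i ^ e` with `t_i = 0` and `e ≠ 0`; a negative `e` would have
put the value at infinity. -/
theorem exists_of_charM_eq_zero {m : Lat} {A : Matrix (Fin 3) (Fin 3) ℤ} {t : C3}
    (h : charM m A t = zeroP) : ∃ ρ ∈ zeroRows A t, 0 < m ⬝ᵥ ρ := by
  have h1 : ∀ ρ ∈ zeroRows A t, 0 ≤ m ⬝ᵥ ρ := by
    by_contra h2
    push Not at h2
    exact zeroP_ne_inftyP (h.symm.trans (charM_eq_infty.2 h2))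
  rw [charM_eq_coe h1, OnePoint.coe_eq_coe] at h
  obtain ⟨i, -, hi⟩ := Finset.prod_eq_zero_iff.1 h
  have hti : t i = 0 := by
    by_contra hne
    exact zpow_ne_zero _ hne hi
  refine ⟨A i, ⟨i, rfl, hti⟩, lt_of_le_of_ne (h1 _ ⟨i, rfl, hti⟩) fun h0 => ?_⟩
  rw [← h0, zpow_zero] at hi
  exact one_ne_zero hi

/-- Among the rays, `nuZ` is positive exactly on the `rayA i` and negative exactly on `rayZ`, and no
cone contains both kinds. The same holds for `nuW`, the `rayB j` and `rayW`. -/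
theorem compat_of_charM (P : EdgePath T) (V : Chart T) (t : C3) :
    Compat (zeroRows V.1 t) (charM nuZ V.1 t) (charM nuW V.1 t) := by
  have F := coneFacts P V
  have hsub := zeroRows_subset_rays V t
  have hr : ∀ ρ ∈ zeroRows V.1 t, IsRay ρ := fun ρ h => F.cases ρ (hsub h)
  have hz : charM nuZ V.1 t = inftyP ↔ rayZ ∈ zeroRows V.1 t := by
    rw [charM_eq_infty]
    constructor
    · rintro ⟨ρ, h, h'⟩
      rwa [← (hr ρ h).nuZ_neg.1 h']
    · exact fun h => ⟨_, h, by simp [-nuZ_dot]⟩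
  have hw : charM nuW V.1 t = inftyP ↔ rayW ∈ zeroRows V.1 t := by
    rw [charM_eq_infty]
    constructor
    · rintro ⟨ρ, h, h'⟩
      rwa [← (hr ρ h).nuW_neg.1 h']
    · exact fun h => ⟨_, h, by simp [-nuW_dot]⟩
  refine ⟨⟨fun h => ?_, ?_⟩, ⟨fun h => ?_, ?_⟩, hz, hw⟩
  · obtain ⟨ρ, h1, h2⟩ := exists_of_charM_eq_zero h
    obtain ⟨i, rfl⟩ := (hr ρ h1).nuZ_pos.1 h2
    exact ⟨i, h1⟩
  · rintro ⟨i, hi⟩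
    rw [charM_eq_coe, monoM_eq_zero ⟨_, hi, by simp [-nuZ_dot]⟩]
    intro ρ hρ
    by_contra hneg
    obtain rfl := (hr ρ hρ).nuZ_neg.1 (not_le.1 hneg)
    exact F.notAZ i (hsub hi) (hsub hρ)
  · obtain ⟨ρ, h1, h2⟩ := exists_of_charM_eq_zero h
    obtain ⟨i, rfl⟩ := (hr ρ h1).nuW_pos.1 h2
    exact ⟨i, h1⟩
  · rintro ⟨i, hi⟩
    rw [charM_eq_coe, monoM_eq_zero ⟨_, hi, by simp [-nuW_dot]⟩]
    intro ρ hρ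
    by_contra hneg
    obtain rfl := (hr ρ hρ).nuW_neg.1 (not_le.1 hneg)
    exact F.notBW i (hsub hi) (hsub hρ)

theorem compat_orbitCone (P : EdgePath T) (p : X T) : Compat (orbitCone p) (zFun p) (wFun p) := by
  obtain ⟨V, t, rfl⟩ := exists_pt p
  exact compat_of_charM P V t

open Classical in
/-- The frame `rayX, rayA i, rayB j`, where `rayZ`, `rayW` replace the latter two over infinity. -/
def frame (i j : ℤ) (z w : OnePoint ℂ) : Matrix (Fin 3) (Fin 3) ℤ :=
  Matrix.of ![rayX, if z = inftyP then rayZ else rayA i, if w = inftyP then rayW else rayB j]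

section
variable {i j : ℤ} {z w : OnePoint ℂ}

theorem frame_zero : frame i j z w 0 = rayX := rfl
open Classical in
theorem frame_one : frame i j z w 1 = if z = inftyP then rayZ else rayA i := rfl
open Classical in
theorem frame_two : frame i j z w 2 = if w = inftyP then rayW else rayB j := rfl

end

/-- The affine coordinate of a point of `ℙ¹`, zero at infinity. -/
def coordP (z : OnePoint ℂ) : ℂ := z.elim 0 id

@[simp] theorem coordP_coe (z : ℂ) : coordP (z : OnePoint ℂ) = z := rfl
@[simp] theorem coordP_infty : coordP inftyP = 0 := rfl

theorem isUnit_det_frame (i j : ℤ) (z w : OnePoint ℂ) : IsUnit (frame i j z w).det := by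
  unfold frame
  split_ifs <;> rw [Int.isUnit_iff_abs_eq] <;>
    simp [Matrix.det_fin_three, rayX, rayA, rayB, rayZ, rayW]

theorem coordP_eq_zero {z : OnePoint ℂ} : coordP z = 0 ↔ z = zeroP ∨ z = inftyP := by
  induction z using OnePoint.rec with
  | infty => simp
  | coe z => simp

/-- The coordinate `coordP z` vanishes both at `0` and at `∞`; the frame decides whether this means
`rayA i` or `rayZ`. The default `0` of `coordP` at infinity is what makes this work. -/
theorem zeroRows_frame {i j : ℤ} {z w : OnePoint ℂ} {ξ : ℂ} (hξ : ξ ≠ 0) :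
    zeroRows (frame i j z w) ![ξ, coordP z, coordP w] = cone i j z w := by
  ext ρ
  simp only [zeroRows, cone, Set.mem_ofPred_eq, Fin.exists_fin_succ]
  by_cases hz : z = inftyP <;> by_cases hw : w = inftyP <;>
    simp [hz, hw, hξ, coordP_eq_zero, zeroP_ne_inftyP.symm, eq_comm (b := ρ), frame_one,
      frame_two, or_comm]

theorem charM_nuZ_frame {i j : ℤ} {z w : OnePoint ℂ} {ξ : ℂ} :
    charM nuZ (frame i j z w) ![ξ, coordP z, coordP w] = z := by
  induction z using OnePoint.rec with
  | infty =>
    rw [charM_eq_infty]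
    exact ⟨rayZ, ⟨1, by simp [frame_one], by simp⟩, by simp [-nuZ_dot]⟩
  | coe z =>
    rw [charM_eq_coe]
    · congr 1
      by_cases hw : w = inftyP <;>
        simp [monoM, Fin.prod_univ_three, frame_zero, frame_one, frame_two, hw, -nuZ_dot]
    · rintro _ ⟨a, rfl, -⟩
      fin_cases a <;> by_cases hw : w = inftyP <;>
        simp [frame_zero, frame_one, frame_two, hw, -nuZ_dot]

theorem charM_nuW_frame {i j : ℤ} {z w : OnePoint ℂ} {ξ : ℂ} :
    charM nuW (frame i j z w) ![ξ, coordP z, coordP w] = w := by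
  induction w using OnePoint.rec with
  | infty =>
    rw [charM_eq_infty]
    exact ⟨rayW, ⟨2, by simp [frame_two], by simp⟩, by simp [-nuW_dot]⟩
  | coe w =>
    rw [charM_eq_coe]
    · congr 1
      by_cases hw : z = inftyP <;>
        simp [monoM, Fin.prod_univ_three, frame_zero, frame_one, frame_two, hw, -nuW_dot]
    · rintro _ ⟨a, rfl, -⟩
      fin_cases a <;> by_cases hw : z = inftyP <;>
        simp [frame_zero, frame_one, frame_two, hw, -nuW_dot]

theorem cone_subset_frame (i j : ℤ) (z w : OnePoint ℂ) :
    cone i j z w ⊆ Set.range fun a => frame i j z w a := by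
  rw [← zeroRows_frame (ξ := 1) one_ne_zero]
  rintro ρ ⟨a, rfl, -⟩
  exact ⟨a, rfl⟩

/-- The point with frame coordinates `ξ, z, w` in the chart `V`. -/
def tube (V : Chart T) (i j : ℤ) (z w : OnePoint ℂ) (ξ : ℂ) : C3 :=
  coordChange (frame i j z w) V.1 ![ξ, coordP z, coordP w]

section
variable {V : Chart T} {i j : ℤ} {z w : OnePoint ℂ} {ξ : ℂ}

theorem rep_tube (hV : cone i j z w ⊆ rays V) (hξ : ξ ≠ 0) :
    Rep (frame i j z w) ![ξ, coordP z, coordP w] V.1 (tube V i j z w ξ) :=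
  rep_coordChange (isUnit_det_chart V) (by rw [zeroRows_frame hξ]; exact hV)

theorem pt_tube_eq {V' : Chart T} (hV : cone i j z w ⊆ rays V) (hV' : cone i j z w ⊆ rays V')
    (hξ : ξ ≠ 0) : pt V (tube V i j z w ξ) = pt V' (tube V' i j z w ξ) :=
  pt_eq_iff.2 ((rep_tube hV hξ).symm.trans (rep_tube hV' hξ))

theorem orbitCone_tube (hV : cone i j z w ⊆ rays V) (hξ : ξ ≠ 0) :
    zeroRows V.1 (tube V i j z w ξ) = cone i j z w :=
  (rep_tube hV hξ).1.symm.trans (zeroRows_frame hξ)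

theorem zFun_tube (hV : cone i j z w ⊆ rays V) (hξ : ξ ≠ 0) :
    zFun (pt V (tube V i j z w ξ)) = z :=
  ((rep_tube hV hξ).charM_eq nuZ).symm.trans charM_nuZ_frame

theorem wFun_tube (hV : cone i j z w ⊆ rays V) (hξ : ξ ≠ 0) :
    wFun (pt V (tube V i j z w ξ)) = w :=
  ((rep_tube hV hξ).charM_eq nuW).symm.trans charM_nuW_frame

end

/-- A non-fixed point is determined by `(z, w)`, its orbit and one more coordinate. -/
theorem exists_eq_tube {p : X T} {i j : ℤ} (hp : orbitCone p = cone i j (zFun p) (wFun p)) :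
    ∃ ξ ≠ 0, ∀ V : Chart T, cone i j (zFun p) (wFun p) ⊆ rays V →
      p = pt V (tube V i j (zFun p) (wFun p) ξ) := by
  obtain ⟨V₀, t, rfl⟩ := exists_pt p
  set z := zFun (pt V₀ t) with hz
  set w := wFun (pt V₀ t) with hw
  have hsub : zeroRows V₀.1 t ⊆ Set.range fun a => frame i j z w a := by
    rw [← orbitCone_pt, hp]
    exact cone_subset_frame i j z w
  have hdet := isUnit_det_frame i j z w
  have hrep := rep_coordChange hdet hsub
  set s := coordChange V₀.1 (frame i j z w) t with hs
  have hzero : ∀ a, s a = 0 ↔ frame i j z w a ∈ cone i j z w := by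
    intro a
    rw [← mem_zeroRows hdet, ← hrep.1, ← hp, orbitCone_pt]
  have h0 : s 0 ≠ 0 := by
    rw [Ne, hzero, frame_zero]
    exact rayX_mem_cone
  have hrow : ∀ ρ ∈ zeroRows (frame i j z w) s, ρ ∈ cone i j z w := by
    rintro _ ⟨a, rfl, ha⟩
    exact (hzero a).1 ha
  -- For finite `z` the character `nuZ` is dual to the second row of the frame, so it is the second
  -- coordinate. At infinity this coordinate vanishes because `rayZ` lies in the orbit cone.
  have h1 : s 1 = coordP z := by
    have hc : charM nuZ (frame i j z w) s = z := (hrep.charM_eq nuZ).symm.trans hz.symm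
    clear_value z
    induction z using OnePoint.rec with
    | infty => exact (hzero _).2 (by simp [frame_one])
    | coe z =>
      rw [charM_eq_coe, OnePoint.coe_eq_coe] at hc
      · rw [coordP_coe, ← hc]
        by_cases hw' : w = inftyP <;>
          simp [monoM, Fin.prod_univ_three, frame_zero, frame_one, frame_two, hw', -nuZ_dot]
      · intro ρ hρ
        rcases hrow ρ hρ with ⟨rfl, -⟩ | ⟨rfl, -⟩ | ⟨rfl, h⟩ | ⟨rfl, -⟩
        · simp [-nuZ_dot]
        · simp [-nuZ_dot]
        · exact absurd h (OnePoint.coe_ne_infty _)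
        · simp [-nuZ_dot]
  have h2 : s 2 = coordP w := by
    have hc : charM nuW (frame i j z w) s = w := (hrep.charM_eq nuW).symm.trans hw.symm
    clear_value w
    induction w using OnePoint.rec with
    | infty => exact (hzero _).2 (by simp [frame_two])
    | coe w =>
      rw [charM_eq_coe, OnePoint.coe_eq_coe] at hc
      · rw [coordP_coe, ← hc]
        by_cases hw' : z = inftyP <;>
          simp [monoM, Fin.prod_univ_three, frame_zero, frame_one, frame_two, hw', -nuW_dot]
      · intro ρ hρ
        rcases hrow ρ hρ with ⟨rfl, -⟩ | ⟨rfl, -⟩ | ⟨rfl, -⟩ | ⟨rfl, h⟩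
        · simp [-nuW_dot]
        · simp [-nuW_dot]
        · simp [-nuW_dot]
        · exact absurd h (OnePoint.coe_ne_infty _)
  have hs' : s = ![s 0, coordP z, coordP w] := by
    ext a; fin_cases a <;> simp [h1, h2]
  refine ⟨s 0, h0, fun V hV => pt_eq_iff.2 (hrep.trans ?_)⟩
  rw [hs']
  exact rep_tube hV h0

end GenConifold

end

noncomputable section

open scoped Matrix Topology

namespace GenConifold

variable {k l : ℕ} {T : MaxTriangulation k l}

/-! ### Weights of the circle action -/

/-- The coordinates of `rayX` in the basis of generators of a chart. -/
def wt (V : Chart T) : Lat := rayX ᵥ* V.1⁻¹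

theorem circleField_apply (V : Chart T) (t : C3) (a : Fin 3) :
    circleField V t a = Complex.I * (wt V a : ℂ) * t a := rfl

theorem wt_eq {V : Chart T} {c : Lat} (h : c ᵥ* V.1 = rayX) : wt V = c := by
  rw [wt, ← h, Matrix.vecMul_vecMul, Matrix.mul_nonsing_inv _ (isUnit_det_chart V),
    Matrix.vecMul_one]

theorem wt_vecMul (V : Chart T) : wt V ᵥ* V.1 = rayX := by
  rw [wt, Matrix.vecMul_vecMul, Matrix.nonsing_inv_mul _ (isUnit_det_chart V), Matrix.vecMul_one]

theorem sum_wt (V : Chart T) (m : Lat) : ∑ a, wt V a * (m ⬝ᵥ V.1 a) = m 0 := by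
  have h1 : (wt V ᵥ* V.1) ⬝ᵥ m = rayX ⬝ᵥ m := by rw [wt_vecMul]
  rw [← Matrix.dotProduct_mulVec] at h1
  simpa [dotProduct, Matrix.mulVec, rayX, Fin.sum_univ_three, mul_comm] using h1

theorem wt_eq_single {V : Chart T} {b : Fin 3} (h : rayX = V.1 b) : wt V = Pi.single b 1 :=
  wt_eq (by rw [Matrix.single_one_vecMul, h]; rfl)

theorem wt_eq_neg_single {V : Chart T} {b : Fin 3} (h : rayX = -V.1 b) :
    wt V = -Pi.single b 1 :=
  wt_eq (by rw [Matrix.neg_vecMul, Matrix.single_one_vecMul, h]; rfl)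

theorem wt_eq_sub {V : Chart T} {b c : Fin 3} (h : rayX = V.1 b - V.1 c) :
    wt V = Pi.single b 1 - Pi.single c 1 :=
  wt_eq (by rw [Matrix.sub_vecMul, Matrix.single_one_vecMul, Matrix.single_one_vecMul, h]; rfl)

theorem wt_ne_zero (V : Chart T) : ∃ a, wt V a ≠ 0 := by
  by_contra! h
  have := wt_vecMul V
  rw [show wt V = 0 from funext h, Matrix.zero_vecMul] at this
  simpa [rayX] using congrFun this 0

/-- The cone contains `rayX` in its span, in one of the ways that occur in the fan. -/
def Spans (τ : Set Lat) : Prop :=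
  ∃ ρ ∈ τ, ∃ α, (α = 0 ∨ α ∈ τ) ∧ (rayX = ρ - α ∨ rayX = α - ρ)

theorem Spans.mono {σ τ : Set Lat} (h : Spans σ) (hστ : σ ⊆ τ) : Spans τ := by
  obtain ⟨ρ, hρ, α, hα, h⟩ := h
  exact ⟨ρ, hστ hρ, α, hα.imp_right (@hστ α), h⟩

/-- Since the expansion of `rayX` in the rows is unique, all weights outside `τ` are zero.
Consequently the circle fixes the orbit of `τ` pointwise. -/
theorem Spans.mem {τ : Set Lat} (h : Spans τ) {V : Chart T} (hV : τ ⊆ rays V) {a : Fin 3}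
    (ha : wt V a ≠ 0) : V.1 a ∈ τ := by
  obtain ⟨ρ, hρ, α, hα, h⟩ := h
  obtain ⟨b, hb⟩ := hV hρ
  simp only at hb
  rcases hα with rfl | hα
  · rw [← hb, sub_zero, zero_sub] at h
    have hab : a = b := by
      by_contra hne
      rcases h with h | h
      · exact ha (by simp [wt_eq_single h, hne])
      · exact ha (by simp [wt_eq_neg_single h, hne])
    rw [hab, hb]
    exact hρ
  · obtain ⟨c, hc⟩ := hV hα
    simp only at hc
    rw [← hb, ← hc] at h
    by_contra hne
    have hab : a ≠ b := by rintro rfl; exact hne (hb ▸ hρ)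
    have hac : a ≠ c := by rintro rfl; exact hne (hc ▸ hα)
    rcases h with h | h
    · exact ha (by simp [wt_eq_sub h, hab, hac])
    · exact ha (by simp [wt_eq_sub h, hab, hac])

/-! ### The moment map along the circle action -/

section
variable {ω : ToricKahlerForm T} {μ : X T → ℝ}

theorem IsMomentMap.hasFDerivAt (hμ : IsMomentMap ω μ) (V : Chart T) (t : C3) :
    HasFDerivAt (fun s => μ (pt V s)) (dMu μ V t) t :=
  (hμ V t).1.hasFDerivAt

theorem IsMomentMap.dMu_apply (hμ : IsMomentMap ω μ) (V : Chart T) (t u : C3) :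
    dMu μ V t u = ω.form V t ![u, circleField V t] := (hμ V t).2 u

theorem IsMomentMap.continuous_chart (hμ : IsMomentMap ω μ) (V : Chart T) :
    Continuous fun s => μ (pt V s) :=
  continuous_iff_continuousAt.2 fun t => (hμ.hasFDerivAt V t).continuousAt

/-- The moment map is invariant under the compact torus. -/
theorem IsMomentMap.invariant (hμ : IsMomentMap ω μ) (V : Chart T) (u : Fin 3 → Circle) (t : C3) :
    μ (pt V fun a => u a * t a) = μ (pt V t) := by
  let Lu : C3 →L[ℝ] C3 := ContinuousLinearMap.pi fun a =>
    (ContinuousLinearMap.mul ℝ ℂ (u a)).comp (ContinuousLinearMap.proj a)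
  have hLu : ∀ t : C3, Lu t = fun a => u a * t a := fun t => rfl
  have hd : ∀ t, HasFDerivAt (fun s => μ (pt V (Lu s)) - μ (pt V s)) (0 : C3 →L[ℝ] ℝ) t := by
    intro t
    have h1 : HasFDerivAt (fun s => μ (pt V (Lu s))) ((dMu μ V (Lu t)).comp Lu) t :=
      HasFDerivAt.comp t (hμ.hasFDerivAt V (Lu t)) Lu.hasFDerivAt
    have h2 := h1.sub (hμ.hasFDerivAt V t)
    refine h2.congr_fderiv ?_
    ext v
    have h3 : circleField V (Lu t) = fun a => u a * circleField V t a := by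
      ext a; simp only [circleField_apply, hLu]; ring
    simp only [sub_apply, ContinuousLinearMap.comp_apply, hμ.dMu_apply, h3,
      zero_apply]
    rw [hLu, hLu, ω.invariant V t u v (circleField V t), sub_self]
  -- The difference is constant, and it vanishes at the origin, which rotations fix.
  have hconst := is_const_of_fderiv_eq_zero (𝕜 := ℝ)
    (f := fun s => μ (pt V (Lu s)) - μ (pt V s))
    (fun t => (hd t).differentiableAt) (fun t => (hd t).fderiv) t 0
  simp only [map_zero, sub_self] at hconst
  rw [hLu] at hconst
  linarith

/-- The radial vector field of the action. -/
def radialField (V : Chart T) (t : C3) : C3 := fun a => (wt V a : ℂ) * t a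

theorem circleField_eq (V : Chart T) (t : C3) :
    circleField V t = Complex.I • radialField V t := by
  ext a; simp [circleField_apply, radialField, mul_assoc]

/-- The circle field is `i` times the radial field, so the moment map equation turns the left side
into `ω(R, iR)`. -/
theorem IsMomentMap.dMu_radialField_pos (hμ : IsMomentMap ω μ) {V : Chart T} {t : C3}
    (h : radialField V t ≠ 0) : 0 < dMu μ V t (radialField V t) := by
  rw [hμ.dMu_apply, circleField_eq]
  exact ω.pos V t _ h

/-- The radial flow of the action. -/
def radial (V : Chart T) (s : ℝ) (t : C3) : C3 := fun a => (Real.exp (s * wt V a) : ℂ) * t a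

theorem hasDerivAt_radial (V : Chart T) (s : ℝ) (t : C3) :
    HasDerivAt (fun s => radial V s t) (radialField V (radial V s t)) s := by
  rw [hasDerivAt_pi]
  intro a
  have h1 : HasDerivAt (fun s : ℝ => Real.exp (s * wt V a)) (Real.exp (s * wt V a) * (wt V a)) s := by
    have := ((hasDerivAt_id s).mul_const (wt V a : ℝ)).exp
    simpa using this
  have h2 := (h1.ofReal_comp).mul_const (t a)
  refine h2.congr_deriv ?_
  simp only [radialField, radial]
  push_cast
  ring

theorem IsMomentMap.strictMono_radial (hμ : IsMomentMap ω μ) {V : Chart T} {t : C3}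
    (h : ∃ a, wt V a ≠ 0 ∧ t a ≠ 0) : StrictMono fun s => μ (pt V (radial V s t)) := by
  refine strictMono_of_deriv_pos fun s => ?_
  have h1 := (hμ.hasFDerivAt V (radial V s t)).comp_hasDerivAt s (hasDerivAt_radial V s t)
  rw [show (fun s => μ (pt V (radial V s t))) = (fun x => μ (pt V x)) ∘ fun s => radial V s t from rfl,
    h1.deriv]
  refine hμ.dMu_radialField_pos fun h0 => ?_
  obtain ⟨a, ha, hta⟩ := h
  have := congrFun h0 a
  simp [radialField, radial, ha, hta] at this

/-- The limit of the radial flow. -/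
def fixedPart (V : Chart T) (t : C3) : C3 := fun a => if wt V a = 0 then t a else 0

theorem tendsto_radial_atBot {V : Chart T} {t : C3} (h : ∀ a, wt V a < 0 → t a = 0) :
    Filter.Tendsto (fun s => radial V s t) Filter.atBot (𝓝 (fixedPart V t)) := by
  rw [tendsto_pi_nhds]
  intro a
  simp only [radial, fixedPart]
  rcases lt_trichotomy (wt V a) 0 with h1 | h1 | h1
  · simp [h a h1]
  · simp [h1]
  · rw [if_neg h1.ne']
    have h2 : Filter.Tendsto (fun s : ℝ => Real.exp (s * wt V a)) Filter.atBot (𝓝 0) :=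
      Real.tendsto_exp_atBot.comp
        (Filter.tendsto_id.atBot_mul_const (by exact_mod_cast h1))
    have h3 := (Complex.continuous_ofReal.tendsto 0).comp h2
    simpa using h3.mul_const (t a)

theorem tendsto_radial_atTop {V : Chart T} {t : C3} (h : ∀ a, 0 < wt V a → t a = 0) :
    Filter.Tendsto (fun s => radial V s t) Filter.atTop (𝓝 (fixedPart V t)) := by
  rw [tendsto_pi_nhds]
  intro a
  simp only [radial, fixedPart]
  rcases lt_trichotomy (wt V a) 0 with h1 | h1 | h1
  · rw [if_neg h1.ne]
    have h2 : Filter.Tendsto (fun s : ℝ => Real.exp (s * wt V a)) Filter.atTop (𝓝 0) :=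
      Real.tendsto_exp_atBot.comp
        (Filter.tendsto_id.atTop_mul_const_of_neg (by exact_mod_cast h1))
    have h3 := (Complex.continuous_ofReal.tendsto 0).comp h2
    simpa using h3.mul_const (t a)
  · simp [h1]
  · simp [h a h1]

/-- The moment map is constant on each linear fixed locus of a chart. -/
theorem IsMomentMap.eq_of_fixed (hμ : IsMomentMap ω μ) {V : Chart T} {t : C3}
    (h : ∀ a, wt V a ≠ 0 → t a = 0) : μ (pt V t) = μ (pt V 0) := by
  -- The whole line through `t` consists of fixed points, where the circle field and therefore `dμ`
  -- vanish.
  have hd : ∀ r : ℝ, HasDerivAt (fun r : ℝ => μ (pt V (r • t))) 0 r := by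
    intro r
    have h1 := (hμ.hasFDerivAt V (r • t)).comp_hasDerivAt r ((hasDerivAt_id r).smul_const t)
    refine h1.congr_deriv ?_
    have h2 : circleField V (r • t) = 0 := by
      ext a
      by_cases ha : wt V a = 0
      · simp [circleField_apply, ha]
      · simp [circleField_apply, h a ha]
    rw [hμ.dMu_apply, h2]
    exact (ω.form V (r • t)).map_coord_zero 1 rfl
  have := is_const_of_deriv_eq_zero (fun r => (hd r).differentiableAt) (fun r => (hd r).deriv) 1 0
  simpa using this

/-- The point with coordinates `0` on `τ` and `1` elsewhere lies on the orbit of `τ`, which both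
charts contain. -/
theorem rep_face {V V' : Chart T} {τ : Set Lat} (hV : τ ⊆ rays V) (hV' : τ ⊆ rays V') :
    ∃ t t' : C3, pt V t = pt V' t' ∧ (∀ a, V.1 a ∈ τ → t a = 0) ∧ ∀ a, V'.1 a ∈ τ → t' a = 0 := by
  classical
  have h1 : zeroRows V.1 (fun a => if V.1 a ∈ τ then 0 else 1) = τ := by
    ext ρ
    constructor
    · rintro ⟨a, rfl, ha⟩
      by_contra h
      simp [h] at ha
    · intro h
      obtain ⟨a, rfl⟩ := hV h
      exact ⟨a, rfl, if_pos h⟩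
  have hsub : zeroRows V.1 (fun a => if V.1 a ∈ τ then 0 else 1) ⊆ rays V' := by rw [h1]; exact hV'
  have hrep := rep_coordChange (isUnit_det_chart V') hsub
  refine ⟨_, _, pt_eq_iff.2 hrep, fun a ha => if_pos ha, fun a ha => ?_⟩
  rw [← mem_zeroRows (isUnit_det_chart V'), ← hrep.1, h1]
  exact ha

/-- A common point of the orbit of `τ` lies in the linear fixed locus of either chart, where `μ` has
its value at the origin. This makes `val` independent of the chosen chart. -/
theorem IsMomentMap.origin_eq (hμ : IsMomentMap ω μ) {V V' : Chart T} {τ : Set Lat} (hτ : Spans τ)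
    (hV : τ ⊆ rays V) (hV' : τ ⊆ rays V') : μ (pt V 0) = μ (pt V' 0) := by
  obtain ⟨t, t', h, ht, ht'⟩ := rep_face hV hV'
  rw [← hμ.eq_of_fixed (V := V) (t := t) fun a ha => ht a (hτ.mem hV ha),
    ← hμ.eq_of_fixed (V := V') (t := t') fun a ha => ht' a (hτ.mem hV' ha), h]

open Classical in
/-- The value of the moment map on the fixed locus of a cone. -/
def val (μ : X T → ℝ) (τ : Set Lat) : ℝ :=
  if h : ∃ V : Chart T, τ ⊆ rays V then μ (pt h.choose 0) else 0

theorem IsMomentMap.val_eq (hμ : IsMomentMap ω μ) {V : Chart T} {τ : Set Lat} (hτ : Spans τ)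
    (hV : τ ⊆ rays V) : val μ τ = μ (pt V 0) := by
  have h : ∃ V : Chart T, τ ⊆ rays V := ⟨V, hV⟩
  rw [val, dif_pos h]
  exact hμ.origin_eq hτ h.choose_spec hV

theorem IsMomentMap.val_mono (hμ : IsMomentMap ω μ) {V : Chart T} {σ τ : Set Lat} (hσ : Spans σ)
    (hστ : σ ⊆ τ) (hV : τ ⊆ rays V) : val μ σ = val μ τ :=
  (hμ.val_eq hσ (hστ.trans hV)).trans (hμ.val_eq (hσ.mono hστ) hV).symm

theorem IsMomentMap.eq_val (hμ : IsMomentMap ω μ) {p : X T} {τ : Set Lat} (hτ : Spans τ)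
    (hp : τ ⊆ orbitCone p) : μ p = val μ τ := by
  obtain ⟨V, t, rfl⟩ := exists_pt p
  have hV : τ ⊆ rays V := hp.trans (zeroRows_subset_rays V t)
  rw [hμ.val_eq hτ hV]
  refine hμ.eq_of_fixed fun a ha => ?_
  rw [← mem_zeroRows (isUnit_det_chart V)]
  exact hp (hτ.mem hV ha)

end

end GenConifold

end

noncomputable section

open scoped Matrix Topology

namespace GenConifold

variable {k l : ℕ} {T : MaxTriangulation k l}

/-! ### Continuity -/

theorem isQuotientMap_pt :
    Topology.IsQuotientMap fun q : Σ _ : Chart T, C3 => pt q.1 q.2 :=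
  isQuotientMap_quotient_mk' (s := glueSetoid T)

theorem continuous_pt (V : Chart T) : Continuous (pt V) :=
  isQuotientMap_pt.continuous.comp continuous_sigmaMk

theorem continuous_of_charts {Y : Type*} [TopologicalSpace Y] {f : X T → Y}
    (h : ∀ V, Continuous fun t => f (pt V t)) : Continuous f := by
  rw [isQuotientMap_pt.continuous_iff, continuous_sigma_iff]
  exact h

theorem isOpen_of_charts {U : Set (X T)} (h : ∀ V, IsOpen {t | pt V t ∈ U}) : IsOpen U := by
  rw [← isQuotientMap_pt.isOpen_preimage, isOpen_sigma_iff]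
  exact h

theorem continuousOn_of_charts {Y : Type*} [TopologicalSpace Y] {f : X T → Y} {U : Set (X T)}
    (hU : IsOpen U) (h : ∀ V, ContinuousOn (fun t => f (pt V t)) {t | pt V t ∈ U}) :
    ContinuousOn f U := by
  rw [isQuotientMap_pt.continuousOn_isOpen_iff hU]
  rintro ⟨V, t⟩ ht
  refine ContinuousAt.continuousWithinAt ?_
  rw [ContinuousAt, Sigma.nhds_mk, Filter.tendsto_map'_iff]
  have hop : IsOpen {t | pt V t ∈ U} := hU.preimage (continuous_pt V)
  exact (h V).continuousAt (hop.mem_nhds ht)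

theorem continuousAt_monoM {A : Matrix (Fin 3) (Fin 3) ℤ} {m : Lat} {t : C3}
    (h : ∀ a, t a ≠ 0 ∨ 0 ≤ m ⬝ᵥ A a) : ContinuousAt (monoM A m) t := by
  refine tendsto_finsetProd _ fun a _ => ?_
  exact (continuousAt_apply a t).zpow₀ _ (h a)

open Classical in
theorem continuous_invP :
    Continuous fun x : ℂ => if x = 0 then inftyP else ((x⁻¹ : ℂ) : OnePoint ℂ) := by
  rw [continuous_iff_continuousAt]
  intro x
  by_cases hx : x = 0
  · subst hx
    rw [ContinuousAt, if_pos rfl, ← nhdsNE_sup_pure, Filter.tendsto_sup]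
    refine ⟨?_, by rw [Filter.tendsto_pure_left]; exact fun s hs => by simpa using mem_of_mem_nhds hs⟩
    have h1 : Filter.Tendsto (fun x : ℂ => ((x⁻¹ : ℂ) : OnePoint ℂ)) (𝓝[≠] 0) (𝓝 inftyP) := by
      have h2 := Filter.tendsto_inv₀_nhdsNE_zero (α := ℂ)
      rw [Metric.cobounded_eq_cocompact, ← Filter.coclosedCompact_eq_cocompact] at h2
      exact OnePoint.tendsto_coe_infty.comp h2
    refine h1.congr' ?_
    filter_upwards [self_mem_nhdsWithin] with y hy
    rw [if_neg (by simpa using hy)]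
  · have h1 : ContinuousAt (fun x : ℂ => ((x⁻¹ : ℂ) : OnePoint ℂ)) x :=
      OnePoint.continuous_coe.continuousAt.comp (continuousAt_inv₀ hx)
    refine h1.congr ?_
    filter_upwards [isOpen_ne.mem_nhds hx] with y hy
    rw [if_neg hy]

/-- With exponents of one sign the character is a polynomial monomial or the reciprocal of one, and
inversion is continuous into `ℙ¹`. Mixed signs would allow indeterminacy. -/
theorem continuous_charM {A : Matrix (Fin 3) (Fin 3) ℤ} {m : Lat}
    (h : (∀ a, 0 ≤ m ⬝ᵥ A a) ∨ ∀ a, m ⬝ᵥ A a ≤ 0) : Continuous (charM m A) := by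
  classical
  rcases h with h | h
  · have h1 : charM m A = fun t => ((monoM A m t : ℂ) : OnePoint ℂ) := by
      ext1 t
      refine charM_eq_coe ?_
      rintro _ ⟨a, rfl, -⟩
      exact h a
    rw [h1]
    exact OnePoint.continuous_coe.comp
      (continuous_iff_continuousAt.2 fun t => continuousAt_monoM fun a => .inr (h a))
  · have hneg : ∀ a, -m ⬝ᵥ A a = -(m ⬝ᵥ A a) := fun a => neg_dotProduct _ _
    have h1 : charM m A = fun t => if monoM A (-m) t = 0 then inftyP
        else (((monoM A (-m) t)⁻¹ : ℂ) : OnePoint ℂ) := by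
      ext1 t
      have h2 : monoM A (-m) t = (monoM A m t)⁻¹ := by
        simp [monoM, zpow_neg]
      split_ifs with h0
      · rw [charM_eq_infty]
        obtain ⟨a, -, ha⟩ := Finset.prod_eq_zero_iff.1 h0
        have hta : t a = 0 := by
          by_contra hne
          exact zpow_ne_zero _ hne ha
        refine ⟨A a, ⟨a, rfl, hta⟩, lt_of_le_of_ne (h a) fun h3 => ?_⟩
        rw [hneg, h3] at ha
        simp at ha
      · rw [h2, inv_inv]
        refine charM_eq_coe ?_
        rintro _ ⟨a, rfl, ha⟩
        by_contra h3
        exact h0 (monoM_eq_zero ⟨A a, ⟨a, rfl, ha⟩, by rw [hneg]; omega⟩)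
    rw [h1]
    refine continuous_invP.comp (continuous_iff_continuousAt.2 fun t => continuousAt_monoM fun a => ?_)
    right
    rw [hneg]
    have := h a
    omega

/-- No cone contains both a `rayA i` and `rayZ`; this is why `z` is a morphism. -/
theorem nuZ_sign (P : EdgePath T) (V : Chart T) :
    (∀ a, 0 ≤ nuZ ⬝ᵥ V.1 a) ∨ ∀ a, nuZ ⬝ᵥ V.1 a ≤ 0 := by
  by_cases h : ∃ i, rayA i ∈ rays V
  · obtain ⟨i, hi⟩ := h
    refine .inl fun a => not_lt.1 fun hneg => ?_
    refine (coneFacts P V).notAZ i hi ?_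
    rw [← (isRay_row P V a).nuZ_neg.1 hneg]
    exact ⟨a, rfl⟩
  · refine .inr fun a => not_lt.1 fun hpos => h ?_
    obtain ⟨i, hi⟩ := (isRay_row P V a).nuZ_pos.1 hpos
    exact ⟨i, a, hi⟩

theorem nuW_sign (P : EdgePath T) (V : Chart T) :
    (∀ a, 0 ≤ nuW ⬝ᵥ V.1 a) ∨ ∀ a, nuW ⬝ᵥ V.1 a ≤ 0 := by
  by_cases h : ∃ i, rayB i ∈ rays V
  · obtain ⟨i, hi⟩ := h
    refine .inl fun a => not_lt.1 fun hneg => ?_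
    refine (coneFacts P V).notBW i hi ?_
    rw [← (isRay_row P V a).nuW_neg.1 hneg]
    exact ⟨a, rfl⟩
  · refine .inr fun a => not_lt.1 fun hpos => h ?_
    obtain ⟨i, hi⟩ := (isRay_row P V a).nuW_pos.1 hpos
    exact ⟨i, a, hi⟩

theorem continuous_zFun (P : EdgePath T) : Continuous (zFun (T := T)) :=
  continuous_of_charts fun V => continuous_charM (nuZ_sign P V)

theorem continuous_wFun (P : EdgePath T) : Continuous (wFun (T := T)) :=
  continuous_of_charts fun V => continuous_charM (nuW_sign P V)

theorem IsMomentMap.continuous {ω : ToricKahlerForm T} {μ : X T → ℝ} (hμ : IsMomentMap ω μ) :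
    Continuous μ :=
  continuous_of_charts hμ.continuous_chart

/-! ### The logarithmic distance to one -/

@[simp] theorem logDist_infty : logDist inftyP = ⊤ := rfl

theorem logDist_coe (a : ℂ) : logDist (a : OnePoint ℂ) = ENNReal.log ‖a - 1‖ₑ := rfl

@[simp] theorem logDist_one : logDist ((1 : ℂ) : OnePoint ℂ) = ⊥ := by
  rw [logDist_coe]; simp

theorem logDist_coe_of_ne {a : ℂ} (ha : a ≠ 1) :
    logDist (a : OnePoint ℂ) = (Real.log ‖a - 1‖ : ℝ) := by
  rw [logDist_coe, ENNReal.log_pos_real (by simpa [sub_eq_zero] using ha) (by simp)]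
  simp

theorem logDist_eq_coe_iff {ζ : OnePoint ℂ} {b : ℝ} :
    logDist ζ = (b : EReal) ↔ ∃ a : ℂ, ζ = (a : OnePoint ℂ) ∧ ‖a - 1‖ = Real.exp b := by
  induction ζ using OnePoint.rec with
  | infty =>
    have : ∀ a : ℂ, OnePoint.infty ≠ (a : OnePoint ℂ) := fun a => (OnePoint.coe_ne_infty a).symm
    simp [this]
  | coe a =>
    by_cases ha : a = 1
    · subst ha
      rw [logDist_one]
      refine ⟨fun h => absurd h (EReal.bot_ne_coe b), ?_⟩
      rintro ⟨a, h1, h2⟩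
      rw [OnePoint.coe_eq_coe] at h1
      rw [← h1] at h2
      simp at h2
      exact absurd h2 (Real.exp_pos b).ne
    · rw [logDist_coe_of_ne ha, EReal.coe_eq_coe_iff]
      have hpos : 0 < ‖a - 1‖ := norm_pos_iff.2 (sub_ne_zero.2 ha)
      constructor
      · intro h
        exact ⟨a, rfl, by rw [← h, Real.exp_log hpos]⟩
      · rintro ⟨a', h1, h2⟩
        rw [OnePoint.coe_eq_coe] at h1
        rw [h1, h2, Real.log_exp]

theorem logDist_surjective (e : EReal) : ∃ ζ, logDist ζ = e := by
  induction e using EReal.rec with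
  | bot => exact ⟨_, logDist_one⟩
  | top => exact ⟨_, logDist_infty⟩
  | coe b =>
    refine ⟨((1 + Real.exp b : ℂ) : OnePoint ℂ), logDist_eq_coe_iff.2 ⟨_, rfl, ?_⟩⟩
    rw [add_sub_cancel_left, Complex.norm_real, Real.norm_of_nonneg (Real.exp_pos b).le]

theorem exists_logDist_eq_coe_iff {ζ : OnePoint ℂ} :
    (∃ b : ℝ, logDist ζ = (b : EReal)) ↔ ζ ≠ ((1 : ℂ) : OnePoint ℂ) ∧ ζ ≠ inftyP := by
  constructor
  · rintro ⟨b, hb⟩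
    refine ⟨?_, ?_⟩ <;> rintro rfl
    · rw [logDist_one] at hb; exact EReal.bot_ne_coe b hb
    · rw [logDist_infty] at hb; exact EReal.coe_ne_top b hb.symm
  · induction ζ using OnePoint.rec with
    | infty => simp
    | coe a =>
      rintro ⟨h, -⟩
      exact ⟨_, logDist_coe_of_ne (by simpa using h)⟩

theorem continuous_logDist : Continuous logDist := by
  have h1 : Continuous fun a : ℂ => logDist (a : OnePoint ℂ) := by
    simp_rw [logDist_coe]
    exact ENNReal.continuous_log.comp (by fun_prop)
  rw [continuous_iff_continuousAt]
  intro ζ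
  induction ζ using OnePoint.rec with
  | infty =>
    rw [OnePoint.continuousAt_infty', Filter.coclosedCompact_eq_cocompact,
      ← Metric.cobounded_eq_cocompact]
    have h2 : Filter.Tendsto (fun a : ℂ => ‖a - 1‖ₑ) (Bornology.cobounded ℂ) (𝓝 ⊤) := by
      have h3 : Filter.Tendsto (fun a : ℂ => ‖a - 1‖) (Bornology.cobounded ℂ) Filter.atTop := by
        simp_rw [← dist_eq_norm]
        exact Metric.tendsto_dist_right_cobounded_atTop (1 : ℂ)
      have h4 := ENNReal.tendsto_ofReal_atTop.comp h3
      simpa [Function.comp_def, ofReal_norm] using h4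
    exact (ENNReal.continuous_log.tendsto ⊤).comp h2
  | coe a => exact OnePoint.continuousAt_coe.2 h1.continuousAt

theorem continuous_fibMap (P : EdgePath T) {ω : ToricKahlerForm T} {μ : X T → ℝ}
    (hμ : IsMomentMap ω μ) : Continuous (fibMap μ) :=
  (continuous_logDist.comp (continuous_zFun P)).prodMk
    ((continuous_logDist.comp (continuous_wFun P)).prodMk hμ.continuous)

end GenConifold

end

noncomputable section

open scoped Matrix Topology

namespace GenConifold

variable {k l : ℕ} {T : MaxTriangulation k l}

/-! ### The moment map along the fibres of `(z, w)` -/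

section
variable {V : Chart T} {i j : ℤ} {z w : OnePoint ℂ}

theorem frame_mul_inv_zero (V : Chart T) (a : Fin 3) : (frame i j z w * V.1⁻¹) 0 a = wt V a := by
  rw [Matrix.mul_apply_eq_vecMul, frame_zero, wt]

/-- The first row of the frame is `rayX`, so scaling `ξ` is the action of the one-parameter
subgroup. -/
theorem tube_mul (V : Chart T) (c ξ : ℂ) :
    tube V i j z w (c * ξ) = fun a => c ^ wt V a * tube V i j z w ξ a := by
  ext a
  simp only [tube, coordChange, Fin.prod_univ_three, frame_mul_inv_zero]
  simp [mul_zpow, mul_assoc]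

theorem tube_exp_mul (V : Chart T) (s : ℝ) (ξ : ℂ) :
    tube V i j z w (Real.exp s * ξ) = radial V s (tube V i j z w ξ) := by
  rw [tube_mul]
  ext a
  simp only [radial]
  congr 1
  rw [Real.exp_mul, Real.rpow_intCast]
  push_cast
  rfl

/-- Otherwise `rayX` would be a combination of the rays of `cone i j z w`, although the frame
completes these by `rayX` to part of a basis. The dual vector `m`, equal to `1` on `rayX` and `0` on
the other rows of the frame, gives the contradiction. -/
theorem exists_wt_ne_zero (hV : cone i j z w ⊆ rays V) {ξ : ℂ} (hξ : ξ ≠ 0) :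
    ∃ a, wt V a ≠ 0 ∧ tube V i j z w ξ a ≠ 0 := by
  by_contra! h
  let m : Lat := fun b => (frame i j z w)⁻¹ b 0
  have hm : ∀ b, m ⬝ᵥ frame i j z w b = if b = 0 then 1 else 0 := by
    intro b
    have h1 : (frame i j z w * (frame i j z w)⁻¹) b 0 = if b = 0 then 1 else 0 := by
      rw [Matrix.mul_nonsing_inv _ (isUnit_det_frame i j z w), Matrix.one_apply]
    rw [← h1, dotProduct_comm]
    rfl
  have h2 := sum_wt V m
  have h3 : m 0 = 1 := by
    have := hm 0
    rw [frame_zero] at this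
    simpa [rayX, dotProduct, Fin.sum_univ_three] using this
  rw [h3] at h2
  refine zero_ne_one ((Finset.sum_eq_zero fun a _ => ?_).symm.trans h2)
  by_cases ha : wt V a = 0
  · rw [ha, zero_mul]
  · have h4 : V.1 a ∈ cone i j z w := by
      rw [← orbitCone_tube hV hξ, mem_zeroRows (isUnit_det_chart V)]
      exact h a ha
    obtain ⟨b, hb⟩ := cone_subset_frame i j z w h4
    simp only at hb
    have hb0 : b ≠ 0 := by
      rintro rfl
      rw [frame_zero] at hb
      rw [← hb] at h4
      exact rayX_mem_cone h4
    rw [← hb, hm, if_neg hb0, mul_zero]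

variable {ω : ToricKahlerForm T} {μ : X T → ℝ}

theorem mu_tube_circle (hμ : IsMomentMap ω μ) (u : Circle) (ξ : ℂ) :
    μ (pt V (tube V i j z w (u * ξ))) = μ (pt V (tube V i j z w ξ)) := by
  have h := hμ.invariant V (fun a => u ^ wt V a) (tube V i j z w ξ)
  simpa [tube_mul] using h

theorem mu_tube_eq_exp (hμ : IsMomentMap ω μ) {ξ : ℂ} (hξ : ξ ≠ 0) :
    μ (pt V (tube V i j z w ξ)) =
      μ (pt V (tube V i j z w (Real.exp (Real.log ‖ξ‖)))) := by
  have hn : (‖ξ‖ : ℂ) ≠ 0 := by simpa using hξ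
  let u : Circle := ⟨ξ / ‖ξ‖, by simp [Submonoid.unitSphere, hξ]⟩
  have hu : (u : ℂ) * ‖ξ‖ = ξ := div_mul_cancel₀ ξ hn
  rw [Real.exp_log (norm_pos_iff.2 hξ)]
  conv_lhs => rw [← hu]
  exact mu_tube_circle hμ u _

theorem strictMono_tube (hμ : IsMomentMap ω μ) (hV : cone i j z w ⊆ rays V) :
    StrictMono fun s : ℝ => μ (pt V (tube V i j z w (Real.exp s))) := by
  have h := hμ.strictMono_radial (exists_wt_ne_zero hV one_ne_zero)
  simpa only [← tube_exp_mul, mul_one] using h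

theorem continuous_tube (V : Chart T) :
    Continuous fun s : ℝ => tube V i j z w (Real.exp s) := by
  have h : ∀ s : ℝ, tube V i j z w (Real.exp s) = radial V s (tube V i j z w 1) := fun s => by
    rw [← tube_exp_mul, mul_one]
  simp only [h]
  exact continuous_iff_continuousAt.2 fun s => (hasDerivAt_radial V s _).continuousAt

/-- The limit point has all coordinates of `κ` zero: they were zero before, or their weight is
nonzero and `fixedPart` removes them. So `μ` has the value `val μ κ` there, while `z` and `w`,
constant along the flow, keep their values by continuity. -/
theorem exists_limit (P : EdgePath T) (hμ : IsMomentMap ω μ) (hV : cone i j z w ⊆ rays V)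
    {κ : Set Lat} (hκ : Spans κ) {f : Filter ℝ} [f.NeBot]
    (hf : Filter.Tendsto (fun s => radial V s (tube V i j z w 1)) f
      (𝓝 (fixedPart V (tube V i j z w 1))))
    (hκV : κ ⊆ rays V) (hκ' : ∀ a, V.1 a ∈ κ → V.1 a ∈ cone i j z w ∨ wt V a ≠ 0) :
    Filter.Tendsto (fun s => μ (pt V (tube V i j z w (Real.exp s)))) f (𝓝 (val μ κ)) ∧
      ∃ q, zFun q = z ∧ wFun q = w ∧ μ q = val μ κ := by
  simp only [← tube_exp_mul, mul_one] at hf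
  set q := pt V (fixedPart V (tube V i j z w 1)) with hq
  have hlim : Filter.Tendsto (fun s => pt V (tube V i j z w (Real.exp s))) f (𝓝 q) :=
    ((continuous_pt V).tendsto _).comp hf
  have hne : ∀ s : ℝ, (Real.exp s : ℂ) ≠ 0 := fun s => by
    exact_mod_cast (Real.exp_pos s).ne'
  have hμq : μ q = val μ κ := by
    refine hμ.eq_val hκ fun ρ hρ => ?_
    obtain ⟨a, rfl⟩ := hκV hρ
    simp only at hρ ⊢
    rw [hq, orbitCone_pt, mem_zeroRows (isUnit_det_chart V), fixedPart]
    split_ifs with h0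
    · rcases hκ' a hρ with h | h
      · rwa [← mem_zeroRows (isUnit_det_chart V), orbitCone_tube hV one_ne_zero]
      · exact absurd h0 h
    · rfl
  refine ⟨hμq ▸ (hμ.continuous.tendsto q).comp hlim, q, ?_, ?_, hμq⟩
  · refine tendsto_nhds_unique (((continuous_zFun P).tendsto q).comp hlim) ?_
    refine tendsto_const_nhds.congr fun s => ?_
    exact (zFun_tube hV (hne s)).symm
  · refine tendsto_nhds_unique (((continuous_wFun P).tendsto q).comp hlim) ?_
    refine tendsto_const_nhds.congr fun s => ?_
    exact (wFun_tube hV (hne s)).symm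

/-- The only negative weight can sit at `α`, whose coordinate is already zero. Hence nothing escapes
as `s → -∞`, and the coordinate of `ρ`, of positive weight, tends to zero. -/
theorem tendsto_tube_atBot (P : EdgePath T) (hμ : IsMomentMap ω μ) {ρ α : Lat}
    (hV : insert ρ (cone i j z w) ⊆ rays V) (hα : α = 0 ∨ α ∈ cone i j z w)
    (h : rayX = ρ - α) :
    Filter.Tendsto (fun s : ℝ => μ (pt V (tube V i j z w (Real.exp s)))) Filter.atBot
      (𝓝 (val μ (insert ρ (cone i j z w)))) ∧
      ∃ q, zFun q = z ∧ wFun q = w ∧ μ q = val μ (insert ρ (cone i j z w)) := by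
  have hV' : cone i j z w ⊆ rays V := (Set.subset_insert _ _).trans hV
  obtain ⟨b, hb⟩ := hV (Set.mem_insert _ _)
  simp only at hb
  have hzero : ∀ a, V.1 a ∈ cone i j z w → tube V i j z w 1 a = 0 := fun a ha => by
    rwa [← mem_zeroRows (isUnit_det_chart V), orbitCone_tube hV' one_ne_zero]
  refine exists_limit P hμ hV' ⟨ρ, Set.mem_insert _ _, α, hα.imp_right (Set.mem_insert_of_mem _),
    .inl h⟩ (tendsto_radial_atBot fun a ha => ?_) hV fun a ha => ?_
  · rcases hα with rfl | hα
    · rw [← hb, sub_zero] at h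
      rw [wt_eq_single h, Pi.single_apply] at ha
      split_ifs at ha <;> omega
    · obtain ⟨c, hc⟩ := hV' hα
      simp only at hc
      rw [← hb, ← hc] at h
      rw [wt_eq_sub h, Pi.sub_apply, Pi.single_apply, Pi.single_apply] at ha
      have hac : a = c := by split_ifs at ha <;> first | assumption | omega
      exact hzero a (hac ▸ hc ▸ hα)
  · rcases ha with ha | ha
    · rw [← hb] at ha
      have hab := row_injective (isUnit_det_chart V) ha
      subst hab
      by_cases hin : V.1 a ∈ cone i j z w
      · exact .inl hin
      · right
        rcases hα with rfl | hα
        · rw [← hb, sub_zero] at h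
          simp [wt_eq_single h]
        · obtain ⟨c, hc⟩ := hV' hα
          simp only at hc
          have hac : a ≠ c := by rintro rfl; exact hin (hc ▸ hα)
          rw [← hb, ← hc] at h
          simp [wt_eq_sub h, hac]
    · exact .inl ha

theorem tendsto_tube_atTop (P : EdgePath T) (hμ : IsMomentMap ω μ) {ρ α : Lat}
    (hV : insert ρ (cone i j z w) ⊆ rays V) (hα : α = 0 ∨ α ∈ cone i j z w)
    (h : rayX = α - ρ) :
    Filter.Tendsto (fun s : ℝ => μ (pt V (tube V i j z w (Real.exp s)))) Filter.atTop
      (𝓝 (val μ (insert ρ (cone i j z w)))) ∧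
      ∃ q, zFun q = z ∧ wFun q = w ∧ μ q = val μ (insert ρ (cone i j z w)) := by
  have hV' : cone i j z w ⊆ rays V := (Set.subset_insert _ _).trans hV
  obtain ⟨b, hb⟩ := hV (Set.mem_insert _ _)
  simp only at hb
  have hzero : ∀ a, V.1 a ∈ cone i j z w → tube V i j z w 1 a = 0 := fun a ha => by
    rwa [← mem_zeroRows (isUnit_det_chart V), orbitCone_tube hV' one_ne_zero]
  refine exists_limit P hμ hV' ⟨ρ, Set.mem_insert _ _, α, hα.imp_right (Set.mem_insert_of_mem _),
    .inr h⟩ (tendsto_radial_atTop fun a ha => ?_) hV fun a ha => ?_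
  · rcases hα with rfl | hα
    · rw [← hb, zero_sub] at h
      rw [wt_eq_neg_single h, Pi.neg_apply, Pi.single_apply] at ha
      split_ifs at ha <;> omega
    · obtain ⟨c, hc⟩ := hV' hα
      simp only at hc
      rw [← hb, ← hc] at h
      rw [wt_eq_sub h, Pi.sub_apply, Pi.single_apply, Pi.single_apply] at ha
      have hac : a = c := by split_ifs at ha <;> first | assumption | omega
      exact hzero a (hac ▸ hc ▸ hα)
  · rcases ha with ha | ha
    · rw [← hb] at ha
      have hab := row_injective (isUnit_det_chart V) ha
      subst hab
      by_cases hin : V.1 a ∈ cone i j z w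
      · exact .inl hin
      · right
        rcases hα with rfl | hα
        · rw [← hb, zero_sub] at h
          simp [wt_eq_neg_single h]
        · obtain ⟨c, hc⟩ := hV' hα
          simp only at hc
          have hac : a ≠ c := by rintro rfl; exact hin (hc ▸ hα)
          rw [← hb, ← hc] at h
          simp [wt_eq_sub h, hac]
    · exact .inl ha

end

theorem rayA_succ_sub (i : ℤ) : rayX = rayA (i + 1) - rayA i := by
  ext a; fin_cases a <;> simp [rayX, rayA]
theorem rayB_succ_sub (i : ℤ) : rayX = rayB (i + 1) - rayB i := by
  ext a; fin_cases a <;> simp [rayX, rayB]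

theorem spans_rayX : Spans {rayX} := ⟨rayX, rfl, 0, .inl rfl, .inl (sub_zero _).symm⟩
theorem spans_neg_rayX : Spans {-rayX} := ⟨-rayX, rfl, 0, .inl rfl, .inr (by simp)⟩

/-! ### Levels of the moment map along a chain of orbits. -/

namespace FibreChain

variable {z w : OnePoint ℂ} (C : FibreChain T z w)

/-- The cone of the `n`-th non-fixed orbit. -/
def orbit (n : ℕ) : Set Lat := cone (C.i n) (C.j n) z w

/-- The values of the moment map at the fixed points of the fibre. -/
def level (μ : X T → ℝ) : ℕ → ℝ
  | 0 => val μ {-rayX}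
  | n + 1 => if n < C.L then val μ (C.orbit n ∪ C.orbit (n + 1)) else val μ {rayX}

/-- Consecutive orbits differ by exchanging `α` for its neighbour `ρ = α + rayX` in one row. The
fixed point between them has both rays in its cone. -/
theorem step_eq {n : ℕ} (hn : n < C.L) : ∃ ρ α, α ∈ C.orbit n ∧ ρ ∈ C.orbit (n + 1) ∧
    rayX = ρ - α ∧ insert ρ (C.orbit n) = C.orbit n ∪ C.orbit (n + 1) ∧
    insert α (C.orbit (n + 1)) = C.orbit n ∪ C.orbit (n + 1) := by
  rcases C.step n hn with ⟨rfl, h2, h3⟩ | ⟨rfl, h2, h3⟩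
  · refine ⟨rayA (C.i n + 1), rayA (C.i n), by simp [orbit], by simp [orbit, h2],
      rayA_succ_sub _, ?_, ?_⟩
    · ext ρ; simp only [orbit, cone, h2, h3]; simp; tauto
    · ext ρ; simp only [orbit, cone, h2, h3]; simp; tauto
  · refine ⟨rayB (C.j n + 1), rayB (C.j n), by simp [orbit], by simp [orbit, h3],
      rayB_succ_sub _, ?_, ?_⟩
    · ext ρ; simp only [orbit, cone, h2, h3]; simp; tauto
    · ext ρ; simp only [orbit, cone, h2, h3]; simp; tauto

theorem spans_step {n : ℕ} (hn : n < C.L) : Spans (C.orbit n ∪ C.orbit (n + 1)) := by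
  obtain ⟨ρ, α, h1, h2, h3, -⟩ := C.step_eq hn
  exact ⟨ρ, .inr h2, α, .inr (.inl h1), .inl h3⟩

variable {ω : ToricKahlerForm T} {μ : X T → ℝ}

/-- Letting `ξ → 0` moves towards `rayX`, that is to the next fixed point of the chain, or to the
divisor of `rayX` after the last orbit. Hence levels decrease as the index grows. -/
theorem tendsto_atBot (P : EdgePath T) (hμ : IsMomentMap ω μ) {n : ℕ} (hn : n ≤ C.L)
    {V : Chart T} (hV : C.orbit n ⊆ rays V) :
    Filter.Tendsto (fun s : ℝ => μ (pt V (tube V (C.i n) (C.j n) z w (Real.exp s)))) Filter.atBot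
      (𝓝 (C.level μ (n + 1))) ∧
      ∃ q, zFun q = z ∧ wFun q = w ∧ μ q = C.level μ (n + 1) := by
  have hne : ∀ s : ℝ, (Real.exp s : ℂ) ≠ 0 := fun s => by exact_mod_cast (Real.exp_pos s).ne'
  rcases hn.lt_or_eq with h | rfl
  · obtain ⟨ρ, α, h1, -, h2, h3, -⟩ := C.step_eq h
    obtain ⟨V', hV'⟩ := C.mid n h
    change C.orbit n ∪ C.orbit (n + 1) ⊆ rays V' at hV'
    have hV'' := Set.subset_union_left.trans hV'
    rw [← h3] at hV'
    have := tendsto_tube_atBot P hμ hV' (.inr h1) h2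
    simp only [level, if_pos h, ← h3]
    simp only [pt_tube_eq hV hV'' (hne _)]
    exact this
  · obtain ⟨V', hV'⟩ := C.last
    have := tendsto_tube_atBot P hμ hV' (.inl rfl) (sub_zero _).symm
    have hV'' := (Set.subset_insert _ _).trans hV'
    have hval : val μ {rayX} = val μ (insert rayX (cone (C.i C.L) (C.j C.L) z w)) :=
      hμ.val_mono spans_rayX (by simp) hV'
    simp only [level, lt_irrefl, if_false, hval]
    simp only [pt_tube_eq hV hV'' (hne _)]
    exact this

theorem tendsto_atTop (P : EdgePath T) (hμ : IsMomentMap ω μ) {n : ℕ} (hn : n ≤ C.L)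
    {V : Chart T} (hV : C.orbit n ⊆ rays V) :
    Filter.Tendsto (fun s : ℝ => μ (pt V (tube V (C.i n) (C.j n) z w (Real.exp s)))) Filter.atTop
      (𝓝 (C.level μ n)) ∧
      ∃ q, zFun q = z ∧ wFun q = w ∧ μ q = C.level μ n := by
  have hne : ∀ s : ℝ, (Real.exp s : ℂ) ≠ 0 := fun s => by exact_mod_cast (Real.exp_pos s).ne'
  cases n with
  | zero =>
    obtain ⟨V', hV'⟩ := C.first
    have := tendsto_tube_atTop P hμ hV' (.inl rfl) (by simp)
    have hV'' := (Set.subset_insert _ _).trans hV'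
    have hval : val μ {-rayX} = val μ (insert (-rayX) (cone (C.i 0) (C.j 0) z w)) :=
      hμ.val_mono spans_neg_rayX (by simp) hV'
    simp only [level, hval]
    simp only [pt_tube_eq hV hV'' (hne _)]
    exact this
  | succ n =>
    have h : n < C.L := hn
    obtain ⟨ρ, α, -, h1, h2, -, h3⟩ := C.step_eq h
    obtain ⟨V', hV'⟩ := C.mid n h
    change C.orbit n ∪ C.orbit (n + 1) ⊆ rays V' at hV'
    have hV'' := Set.subset_union_right.trans hV'
    rw [← h3] at hV'
    have := tendsto_tube_atTop P hμ hV' (.inr h1) h2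
    simp only [level, if_pos h, ← h3]
    simp only [pt_tube_eq hV hV'' (hne _)]
    exact this

theorem exists_chart {n : ℕ} (hn : n ≤ C.L) : ∃ V : Chart T, C.orbit n ⊆ rays V := by
  rcases hn.lt_or_eq with h | rfl
  · obtain ⟨V, hV⟩ := C.mid n h
    exact ⟨V, Set.subset_union_left.trans hV⟩
  · obtain ⟨V, hV⟩ := C.last
    exact ⟨V, (Set.subset_insert _ _).trans hV⟩

theorem tube_mem_Ioo (P : EdgePath T) (hμ : IsMomentMap ω μ) {n : ℕ} (hn : n ≤ C.L)
    {V : Chart T} (hV : C.orbit n ⊆ rays V) {ξ : ℂ} (hξ : ξ ≠ 0) :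
    μ (pt V (tube V (C.i n) (C.j n) z w ξ)) ∈ Set.Ioo (C.level μ (n + 1)) (C.level μ n) := by
  have hm := strictMono_tube hμ hV
  rw [mu_tube_eq_exp hμ hξ]
  constructor
  · exact (hm.monotone.le_of_tendsto (C.tendsto_atBot P hμ hn hV).1 (Real.log ‖ξ‖ - 1)).trans_lt
      (hm (by linarith))
  · exact (hm (by linarith : Real.log ‖ξ‖ < Real.log ‖ξ‖ + 1)).trans_le
      (hm.monotone.ge_of_tendsto (C.tendsto_atTop P hμ hn hV).1 _)

theorem level_succ_lt (P : EdgePath T) (hμ : IsMomentMap ω μ) {n : ℕ} (hn : n ≤ C.L) :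
    C.level μ (n + 1) < C.level μ n := by
  obtain ⟨V, hV⟩ := C.exists_chart hn
  have := C.tube_mem_Ioo P hμ hn hV one_ne_zero
  exact this.1.trans this.2

theorem level_last : C.level μ (C.L + 1) = val μ {rayX} := by simp [level]

theorem level_zero : C.level μ 0 = val μ {-rayX} := rfl

theorem level_anti (P : EdgePath T) (hμ : IsMomentMap ω μ) {m n : ℕ} (hmn : m ≤ n)
    (hn : n ≤ C.L + 1) : C.level μ n ≤ C.level μ m := by
  induction n, hmn using Nat.le_induction with
  | base => exact le_rfl
  | succ n hmn ih => exact (C.level_succ_lt P hμ (by omega)).le.trans (ih (by omega))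

theorem exists_tube_eq (P : EdgePath T) (hμ : IsMomentMap ω μ) {n : ℕ} (hn : n ≤ C.L)
    {V : Chart T} (hV : C.orbit n ⊆ rays V) {b : ℝ}
    (hb : b ∈ Set.Ioo (C.level μ (n + 1)) (C.level μ n)) :
    ∃ s : ℝ, μ (pt V (tube V (C.i n) (C.j n) z w (Real.exp s))) = b := by
  have h1 := ((C.tendsto_atBot P hμ hn hV).1.eventually_le_const hb.1).exists
  have h2 := ((C.tendsto_atTop P hμ hn hV).1.eventually_const_le hb.2).exists
  exact mem_range_of_exists_le_of_exists_ge
    ((hμ.continuous_chart V).comp (continuous_tube V)) h1 h2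

/-- Every value between the extreme ones is attained in the fibre. -/
theorem exists_mu_eq (C : FibreChain T z w) (P : EdgePath T) (hμ : IsMomentMap ω μ) {b : ℝ}
    (hb : b ∈ Set.Icc (val μ {rayX}) (val μ {-rayX})) :
    ∃ p, zFun p = z ∧ wFun p = w ∧ μ p = b := by
  -- The search runs from the last orbit back to the first until `b` lies between consecutive
  -- levels. Inside the interval the intermediate value theorem applies; a level itself is attained
  -- at the limit point.
  have key : ∀ n ≤ C.L, C.level μ (n + 1) ≤ b → ∃ p, zFun p = z ∧ wFun p = w ∧ μ p = b := by
    intro n hn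
    induction n with
    | zero =>
      intro h
      obtain ⟨V, hV⟩ := C.exists_chart hn
      rcases h.eq_or_lt with h | h
      · exact h ▸ (C.tendsto_atBot P hμ hn hV).2
      · rcases hb.2.eq_or_lt with h' | h'
        · rw [← C.level_zero] at h'
          exact h'.symm ▸ (C.tendsto_atTop P hμ hn hV).2
        · obtain ⟨s, hs⟩ := C.exists_tube_eq P hμ hn hV ⟨h, h'⟩
          have hne : (Real.exp s : ℂ) ≠ 0 := by exact_mod_cast (Real.exp_pos s).ne'
          exact ⟨_, zFun_tube hV hne, wFun_tube hV hne, hs⟩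
    | succ n ih =>
      intro h
      obtain ⟨V, hV⟩ := C.exists_chart hn
      rcases le_or_gt (C.level μ (n + 1)) b with h' | h'
      · exact ih (by omega) h'
      · rcases h.eq_or_lt with h | h
        · exact h ▸ (C.tendsto_atBot P hμ hn hV).2
        · obtain ⟨s, hs⟩ := C.exists_tube_eq P hμ hn hV ⟨h, h'⟩
          have hne : (Real.exp s : ℂ) ≠ 0 := by exact_mod_cast (Real.exp_pos s).ne'
          exact ⟨_, zFun_tube hV hne, wFun_tube hV hne, hs⟩
  exact key C.L le_rfl (C.level_last.trans_le hb.1)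

end FibreChain

/-- The position of a point in the chain of its fibre. -/
theorem FibreChain.cases (P : EdgePath T) {ω : ToricKahlerForm T} {μ : X T → ℝ}
    (hμ : IsMomentMap ω μ) {p : X T} {z w : OnePoint ℂ} (hz : zFun p = z) (hw : wFun p = w)
    (C : FibreChain T z w) :
    (∃ n ≤ C.L, orbitCone p = C.orbit n ∧
      μ p ∈ Set.Ioo (C.level μ (n + 1)) (C.level μ n)) ∨
    (∃ n < C.L, orbitCone p = C.orbit n ∪ C.orbit (n + 1) ∧ μ p = C.level μ (n + 1)) ∨
    (orbitCone p = insert (-rayX) (C.orbit 0) ∧ μ p = val μ {-rayX}) ∨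
    (orbitCone p = insert rayX (C.orbit C.L) ∧ μ p = val μ {rayX}) := by
  subst hz hw
  obtain ⟨V, t, hpt⟩ := exists_pt p
  have hsub : orbitCone p ⊆ rays V := by
    rw [← hpt]
    exact zeroRows_subset_rays V t
  rcases C.exhaust V (orbitCone p) hsub (compat_orbitCone P p) with ⟨n, hn, h⟩ | ⟨n, hn, h⟩ | h | h
  · left
    refine ⟨n, hn, h, ?_⟩
    obtain ⟨ξ, hξ, hp⟩ := exists_eq_tube h
    have hV : C.orbit n ⊆ rays V := by rw [orbit, ← h]; exact hsub
    rw [congrArg μ (hp V hV)]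
    exact C.tube_mem_Ioo P hμ hn hV hξ
  · refine .inr (.inl ⟨n, hn, h, ?_⟩)
    rw [level, if_pos hn]
    exact hμ.eq_val (C.spans_step hn) h.ge
  · refine .inr (.inr (.inl ⟨h, hμ.eq_val spans_neg_rayX ?_⟩))
    rw [h]; simp
  · refine .inr (.inr (.inr ⟨h, hμ.eq_val spans_rayX ?_⟩))
    rw [h]; simp

/-! ### The extremes of the moment map, the image of `π` and the divisor `D`. -/

section
variable {ω : ToricKahlerForm T} {μ : X T → ℝ}

/-- The levels of a chain decrease strictly from `val μ {-rayX}` to `val μ {rayX}`, and both ends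
are common to all chains. A point with extreme value must therefore be an end of its chain, which
its orbit cone shows. -/
theorem mu_bounds (P : EdgePath T) (hμ : IsMomentMap ω μ) (p : X T) :
    val μ {rayX} ≤ μ p ∧ μ p ≤ val μ {-rayX} ∧ (μ p = val μ {rayX} ↔ rayX ∈ orbitCone p) ∧
      (μ p = val μ {-rayX} ↔ -rayX ∈ orbitCone p) := by
  obtain ⟨C⟩ := nonempty_chain P (zFun p) (wFun p)
  have hL : ∀ n ≤ C.L + 1, val μ {rayX} ≤ C.level μ n := fun n hn =>
    C.level_last.symm.trans_le (C.level_anti P hμ hn le_rfl)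
  have h0 : ∀ n ≤ C.L + 1, C.level μ n ≤ val μ {-rayX} := fun n hn =>
    C.level_anti P hμ (Nat.zero_le n) hn
  have hlt : val μ {rayX} < val μ {-rayX} :=
    (hL 1 (by omega)).trans_lt (C.level_succ_lt P hμ (Nat.zero_le _))
  rcases FibreChain.cases P hμ rfl rfl C with ⟨n, hn, h, h'⟩ | ⟨n, hn, h, h'⟩ | ⟨h, h'⟩ | ⟨h, h'⟩
  · have h1 := hL (n + 1) (by omega)
    have h2 := h0 n (by omega)
    have h3 := h1.trans_lt h'.1
    have h4 := h'.2.trans_le h2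
    refine ⟨h3.le, h4.le, ?_, ?_⟩
    · simp [h, FibreChain.orbit, h3.ne']
    · simp [h, FibreChain.orbit, h4.ne]
  · have h1 := hL (n + 2) (by omega)
    have h2 := h0 n (by omega)
    have h3 := h1.trans_lt (C.level_succ_lt P hμ (n := n + 1) hn)
    have h4 := (C.level_succ_lt P hμ (n := n) hn.le).trans_le h2
    rw [h']
    refine ⟨h3.le, h4.le, ?_, ?_⟩
    · simp [h, FibreChain.orbit, h3.ne']
    · simp [h, FibreChain.orbit, h4.ne]
  · rw [h', h]
    refine ⟨hlt.le, le_rfl, ?_, by simp⟩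
    simp [hlt.ne', rayX_ne_neg_rayX, FibreChain.orbit]
  · rw [h', h]
    refine ⟨le_rfl, hlt.le, by simp, ?_⟩
    simp [hlt.ne, rayX_ne_neg_rayX.symm, FibreChain.orbit]

theorem val_rayX_lt (P : EdgePath T) (hμ : IsMomentMap ω μ) :
    val μ {rayX} < val μ {-rayX} := by
  obtain ⟨C⟩ := nonempty_chain P zeroP zeroP
  exact (C.level_last.symm.trans_le (C.level_anti P hμ (by omega) le_rfl)).trans_lt
    (C.level_succ_lt P hμ (Nat.zero_le _))

theorem range_fibMap (P : EdgePath T) (hμ : IsMomentMap ω μ) :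
    Set.range (fibMap μ) = Set.univ ×ˢ Set.univ ×ˢ Set.Icc (val μ {rayX}) (val μ {-rayX}) := by
  ext ⟨e₁, e₂, b⟩
  simp only [Set.mem_range, Set.mem_prod, Set.mem_univ, true_and]
  constructor
  · rintro ⟨p, hp⟩
    have hb : μ p = b := congrArg (fun x => x.2.2) hp
    have := mu_bounds P hμ p
    rw [hb] at this
    exact ⟨this.1, this.2.1⟩
  · intro hb
    obtain ⟨z, rfl⟩ := logDist_surjective e₁
    obtain ⟨w, rfl⟩ := logDist_surjective e₂
    obtain ⟨C⟩ := nonempty_chain P z w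
    obtain ⟨p, rfl, rfl, rfl⟩ := C.exists_mu_eq P hμ hb
    exact ⟨p, rfl⟩

theorem mem_divisorD_iff {p : X T} : p ∈ divisorD T ↔
    zFun p = ((1 : ℂ) : OnePoint ℂ) ∨ wFun p = ((1 : ℂ) : OnePoint ℂ)
    ∨ zFun p = inftyP ∨ wFun p = inftyP ∨ rayX ∈ orbitCone p ∨ -rayX ∈ orbitCone p := by
  rw [neg_rayX]; rfl

theorem mem_divisorD_iff_fibMap (P : EdgePath T) (hμ : IsMomentMap ω μ) (p : X T) :
    p ∈ divisorD T ↔ ¬ ∃ b₁ b₂ : ℝ, ∃ b₃ ∈ Set.Ioo (val μ {rayX}) (val μ {-rayX}),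
      fibMap μ p = ((b₁ : EReal), (b₂ : EReal), b₃) := by
  obtain ⟨h1, h2, h3, h4⟩ := mu_bounds P hμ p
  rw [mem_divisorD_iff, ← h3, ← h4]
  have key : (∃ b₁ b₂ : ℝ, ∃ b₃ ∈ Set.Ioo (val μ {rayX}) (val μ {-rayX}),
      fibMap μ p = ((b₁ : EReal), (b₂ : EReal), b₃)) ↔
      (∃ b₁ : ℝ, logDist (zFun p) = b₁) ∧ (∃ b₂ : ℝ, logDist (wFun p) = b₂) ∧
        μ p ∈ Set.Ioo (val μ {rayX}) (val μ {-rayX}) := by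
    simp only [fibMap, Prod.mk.injEq]
    constructor
    · rintro ⟨b₁, b₂, b₃, hb, h1, h2, rfl⟩
      exact ⟨⟨b₁, h1⟩, ⟨b₂, h2⟩, hb⟩
    · rintro ⟨⟨b₁, h1⟩, ⟨b₂, h2⟩, hb⟩
      exact ⟨b₁, b₂, _, hb, h1, h2, rfl⟩
  rw [key, exists_logDist_eq_coe_iff, exists_logDist_eq_coe_iff, Set.mem_Ioo, h1.lt_iff_ne',
    h2.lt_iff_ne]
  simp only [ne_eq, not_and_or, not_not]
  clear key h1 h2 h3 h4
  generalize (zFun p = ((1 : ℂ) : OnePoint ℂ)) = a₁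
  generalize (wFun p = ((1 : ℂ) : OnePoint ℂ)) = a₂
  generalize (zFun p = inftyP) = a₃
  generalize (wFun p = inftyP) = a₄
  generalize (μ p = val μ {rayX}) = a₅
  generalize (μ p = val μ {-rayX}) = a₆
  tauto

end

end GenConifold

end

noncomputable section

open scoped Matrix Topology

namespace GenConifold

variable {k l : ℕ} {T : MaxTriangulation k l}

/-! ### Differentials and regular points -/

/-- The character `m` is holomorphic at the point `t`. -/
def HolAt (A : Matrix (Fin 3) (Fin 3) ℤ) (m : Lat) (t : C3) : Prop :=
  ∀ a, t a ≠ 0 ∨ 0 ≤ m ⬝ᵥ A a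

theorem HolAt.differentiableAt {A : Matrix (Fin 3) (Fin 3) ℤ} {m : Lat} {t : C3}
    (h : HolAt A m t) : DifferentiableAt ℂ (monoM A m) t := by
  have : monoM A m = fun t => ∏ a, t a ^ (m ⬝ᵥ A a) := rfl
  rw [this]
  simp only [Fin.prod_univ_three]
  have h1 : ∀ a, DifferentiableAt ℂ (fun t : C3 => t a ^ (m ⬝ᵥ A a)) t := fun a =>
    DifferentiableAt.zpow (differentiableAt_apply a t) (h a)
  exact ((h1 0).mul (h1 1)).mul (h1 2)

theorem HolAt.hasFDerivAt {V : Chart T} {m : Lat} {t : C3} (h : HolAt V.1 m t) :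
    HasFDerivAt (𝕜 := ℝ) (mono V m) (dMono V m t) t :=
  (h.differentiableAt.restrictScalars ℝ).hasFDerivAt

theorem HolAt.dMono_apply {V : Chart T} {m : Lat} {t : C3} (h : HolAt V.1 m t) (u : C3) :
    dMono V m t u = ∑ a, (∏ b ∈ Finset.univ.erase a, t b ^ (m ⬝ᵥ V.1 b)) *
      ((m ⬝ᵥ V.1 a : ℤ) * t a ^ (m ⬝ᵥ V.1 a - 1) * u a) := by
  have h1 : ∀ a, HasFDerivAt (𝕜 := ℂ) (fun t : C3 => t a ^ (m ⬝ᵥ V.1 a))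
      ((((m ⬝ᵥ V.1 a : ℤ) : ℂ) * t a ^ (m ⬝ᵥ V.1 a - 1)) •
        (ContinuousLinearMap.proj a : C3 →L[ℂ] ℂ)) t := fun a => by
    have h2 : HasFDerivAt (𝕜 := ℂ) (fun t : C3 => t a) (ContinuousLinearMap.proj a : C3 →L[ℂ] ℂ) t :=
      (ContinuousLinearMap.proj (R := ℂ) (φ := fun _ : Fin 3 => ℂ) a).hasFDerivAt
    exact (hasDerivAt_zpow (m ⬝ᵥ V.1 a) (t a) (h a)).comp_hasFDerivAt t h2
  have h2 := HasFDerivAt.finsetProd (u := Finset.univ) fun a _ => h1 a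
  have h3 : dMono V m t = _ := (h2.restrictScalars ℝ).fderiv
  rw [h3]
  simp [mul_assoc]

/-- Euler's identity for characters. -/
theorem HolAt.dMono_scale {V : Chart T} {m : Lat} {t : C3} (h : HolAt V.1 m t) (c : C3) :
    dMono V m t (fun a => c a * t a) = (∑ a, c a * (m ⬝ᵥ V.1 a : ℤ)) * mono V m t := by
  rw [h.dMono_apply, Finset.sum_mul]
  refine Finset.sum_congr rfl fun a _ => ?_
  have h1 : mono V m t = (∏ b ∈ Finset.univ.erase a, t b ^ (m ⬝ᵥ V.1 b)) * t a ^ (m ⬝ᵥ V.1 a) :=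
    (Finset.prod_erase_mul _ _ (Finset.mem_univ a)).symm
  rw [h1]
  by_cases ha : t a = 0
  · by_cases he : m ⬝ᵥ V.1 a = 0
    · simp [he]
    · simp [ha, zero_zpow _ he]
  · rw [zpow_sub_one₀ ha]
    field_simp

theorem sum_vecMul_inv (V : Chart T) (v m : Lat) :
    ∑ a, (v ᵥ* V.1⁻¹) a * (m ⬝ᵥ V.1 a) = m ⬝ᵥ v := by
  have h0 : (v ᵥ* V.1⁻¹) ᵥ* V.1 = v := by
    rw [Matrix.vecMul_vecMul, Matrix.nonsing_inv_mul _ (isUnit_det_chart V), Matrix.vecMul_one]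
  have h1 : ((v ᵥ* V.1⁻¹) ᵥ* V.1) ⬝ᵥ m = v ⬝ᵥ m := by rw [h0]
  rw [← Matrix.dotProduct_mulVec, dotProduct_comm v] at h1
  rw [← h1]
  simp only [dotProduct, Matrix.mulVec]
  simp [mul_comm]

/-- The vector is the velocity of the one-parameter subgroup `v`, scaled by `c`, and the character
`m` has weight `m ⬝ᵥ v` under it. -/
theorem HolAt.dMono_lattice {V : Chart T} {m : Lat} {t : C3} (h : HolAt V.1 m t) (v : Lat)
    (c : ℂ) : dMono V m t (fun a => c * ((v ᵥ* V.1⁻¹) a : ℤ) * t a) =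
      c * (m ⬝ᵥ v : ℤ) * mono V m t := by
  rw [h.dMono_scale, ← sum_vecMul_inv V v m]
  push_cast
  rw [Finset.mul_sum]
  simp [mul_assoc]

theorem HolAt.dMono_radialField {V : Chart T} {m : Lat} {t : C3} (h : HolAt V.1 m t)
    (hm : m 0 = 0) : dMono V m t (radialField V t) = 0 := by
  have h1 := h.dMono_scale (fun a => (wt V a : ℂ))
  have h2 : (∑ a, (wt V a : ℂ) * (m ⬝ᵥ V.1 a : ℤ)) = 0 := by
    have := sum_wt V m
    rw [hm] at this
    exact_mod_cast this
  rw [h2, zero_mul] at h1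
  exact h1

/-- Written as half the logarithm of the squared norm, the function has differential `Re (df / (f -
1))`. -/
theorem hasFDerivAt_log_norm {f : C3 → ℂ} {f' : C3 →L[ℝ] ℂ} {t : C3} (h : HasFDerivAt f f' t)
    (hne : f t ≠ 1) :
    HasFDerivAt (fun s => Real.log ‖f s - 1‖) (Complex.reCLM.comp ((f t - 1)⁻¹ • f')) t := by
  have hne' : f t - 1 ≠ 0 := sub_ne_zero.2 hne
  have hn : ‖f t - 1‖ ^ 2 ≠ 0 := by simpa using hne'
  have h1 := ((h.sub_const 1).norm_sq.log hn).const_mul (1 / 2)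
  have h2 : (fun s => Real.log ‖f s - 1‖) = fun s => 1 / 2 * Real.log (‖f s - 1‖ ^ 2) := by
    ext s
    rw [Real.log_pow]
    push_cast
    ring
  rw [h2]
  refine h1.congr_fderiv ?_
  ext u
  simp only [smul_apply, ContinuousLinearMap.comp_apply, innerSL_apply_apply,
    Complex.inner, Complex.reCLM_apply, smul_eq_mul, Complex.inv_def, ← Complex.normSq_eq_norm_sq]
  have hn' : Complex.normSq (f t - 1) ≠ 0 := by simpa using hne'
  simp [Complex.mul_re]
  field_simp

/-- The chart coordinates of the points off `D`. -/
structure OffD (V : Chart T) (t : C3) : Prop where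
  rows : ∀ a, t a = 0 → (∃ i, V.1 a = rayA i) ∨ ∃ j, V.1 a = rayB j
  z_ne : mono V nuZ t ≠ 1
  w_ne : mono V nuW t ≠ 1

theorem holAt_of_rows {V : Chart T} {t : C3}
    (h : ∀ a, t a = 0 → (∃ i, V.1 a = rayA i) ∨ ∃ j, V.1 a = rayB j) :
    HolAt V.1 nuZ t ∧ HolAt V.1 nuW t := by
  constructor <;> intro a <;> by_cases ha : t a = 0
  · right
    rcases h a ha with ⟨i, hi⟩ | ⟨i, hi⟩ <;> simp [hi, -nuZ_dot]
  · exact .inl ha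
  · right
    rcases h a ha with ⟨i, hi⟩ | ⟨i, hi⟩ <;> simp [hi, -nuW_dot]
  · exact .inl ha

theorem OffD.holZ {V : Chart T} {t : C3} (h : OffD V t) : HolAt V.1 nuZ t := (holAt_of_rows h.rows).1
theorem OffD.holW {V : Chart T} {t : C3} (h : OffD V t) : HolAt V.1 nuW t := (holAt_of_rows h.rows).2

theorem HolAt.charM_eq {A : Matrix (Fin 3) (Fin 3) ℤ} {m : Lat} {t : C3} (h : HolAt A m t) :
    charM m A t = ((monoM A m t : ℂ) : OnePoint ℂ) := by
  refine charM_eq_coe ?_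
  rintro _ ⟨a, rfl, ha⟩
  exact (h a).resolve_left (not_not.2 ha)

/-- Off `D` only coordinates of rays in the two rows can vanish. There `nuZ` and `nuW` are
nonnegative, so `z` and `w` are holomorphic functions of `t`. -/
theorem notMem_divisorD_iff (P : EdgePath T) {V : Chart T} {t : C3} :
    pt V t ∉ divisorD T ↔ OffD V t := by
  have hc := compat_orbitCone P (pt V t)
  rw [mem_divisorD_iff, hc.z_infty, hc.w_infty, orbitCone_pt]
  simp only [not_or]
  constructor
  · rintro ⟨h1, h2, h3, h4, h5, h6⟩
    have hrows : ∀ a, t a = 0 → (∃ i, V.1 a = rayA i) ∨ ∃ j, V.1 a = rayB j := by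
      intro a ha
      have hmem : V.1 a ∈ zeroRows V.1 t := ⟨a, rfl, ha⟩
      rcases isRay_row P V a with h | h | h | h | h | h
      · exact .inl h
      · exact .inr h
      · exact absurd (h ▸ hmem) h3
      · exact absurd (h ▸ hmem) h4
      · exact absurd (h ▸ hmem) h5
      · exact absurd (h ▸ hmem) h6
    refine ⟨hrows, ?_, ?_⟩
    · rintro h
      refine h1 ((holAt_of_rows hrows).1.charM_eq.trans ?_)
      rw [← mono_eq, h]
    · rintro h
      refine h2 ((holAt_of_rows hrows).2.charM_eq.trans ?_)
      rw [← mono_eq, h]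
  · intro h
    have hray : ∀ ρ ∈ zeroRows V.1 t, (∃ i, ρ = rayA i) ∨ ∃ j, ρ = rayB j := by
      rintro _ ⟨a, rfl, ha⟩
      exact h.rows a ha
    refine ⟨?_, ?_, fun h' => ?_, fun h' => ?_, fun h' => ?_, fun h' => ?_⟩
    · intro h'
      have := h.holZ.charM_eq.symm.trans h'
      rw [OnePoint.coe_eq_coe] at this
      exact h.z_ne this
    · intro h'
      have := h.holW.charM_eq.symm.trans h'
      rw [OnePoint.coe_eq_coe] at this
      exact h.w_ne this
    · rcases hray _ h' with ⟨i, h⟩ | ⟨i, h⟩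
      exacts [rayA_ne_rayZ h.symm, rayB_ne_rayZ h.symm]
    · rcases hray _ h' with ⟨i, h⟩ | ⟨i, h⟩
      exacts [rayA_ne_rayW h.symm, rayB_ne_rayW h.symm]
    · rcases hray _ h' with ⟨i, h⟩ | ⟨i, h⟩
      exacts [rayA_ne_rayX h.symm, rayB_ne_rayX h.symm]
    · rcases hray _ h' with ⟨i, h⟩ | ⟨i, h⟩
      exacts [rayA_ne_neg_rayX h.symm, rayB_ne_neg_rayX h.symm]

/-! ### The rank of `dπ` off `D`. -/

section
variable {ω : ToricKahlerForm T} {μ : X T → ℝ} {V : Chart T} {t : C3}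

theorem OffD.dFib_apply (h : OffD V t) (hμ : IsMomentMap ω μ) (u : C3) :
    dFib μ V t u = ((dMono V nuZ t u / (mono V nuZ t - 1)).re,
      (dMono V nuW t u / (mono V nuW t - 1)).re, dMu μ V t u) := by
  have h1 := (hasFDerivAt_log_norm h.holZ.hasFDerivAt h.z_ne).prodMk
    ((hasFDerivAt_log_norm h.holW.hasFDerivAt h.w_ne).prodMk (hμ.hasFDerivAt V t))
  have h2 : dFib μ V t = _ := h1.fderiv
  rw [h2]
  simp [div_eq_inv_mul]

theorem dMono_single {m : Lat} (h : HolAt V.1 m t) (a : Fin 3) (c : ℂ) :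
    dMono V m t (Pi.single a c) = (∏ b ∈ Finset.univ.erase a, t b ^ (m ⬝ᵥ V.1 b)) *
      ((m ⬝ᵥ V.1 a : ℤ) * t a ^ (m ⬝ᵥ V.1 a - 1) * c) := by
  rw [h.dMono_apply, Finset.sum_eq_single a]
  · simp
  · intro b _ hb
    simp [hb]
  · simp

/-- If `z = 0`, exactly one `rayA` coordinate vanishes: two of them would span `rayX` and make the
point fixed. This coordinate occurs in `z` to the first power and not at all in `w`, so it can be
varied. If `z ≠ 0`, a torus direction suffices. -/
theorem OffD.exists_dZ (h : OffD V t) (hfix : ∃ a, wt V a ≠ 0 ∧ t a ≠ 0)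
    (hadj : ∀ a b, ∀ i j, V.1 a = rayA i → V.1 b = rayA j → a ≠ b → t a = 0 → t b = 0 →
      Spans {V.1 a, V.1 b}) (c : ℂ) :
    ∃ u, dMono V nuZ t u = c ∧ dMono V nuW t u = 0 := by
  by_cases hz : mono V nuZ t = 0
  · obtain ⟨r, -, hr⟩ := Finset.prod_eq_zero_iff.1 hz
    have htr : t r = 0 := by
      by_contra hne
      exact zpow_ne_zero _ hne hr
    obtain ⟨i, hi⟩ : ∃ i, V.1 r = rayA i := by
      rcases h.rows r htr with h1 | ⟨j, hj⟩
      · exact h1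
      · rw [hj, nuZ_rayB, zpow_zero] at hr
        exact absurd hr one_ne_zero
    have hprod : (∏ b ∈ Finset.univ.erase r, t b ^ (nuZ ⬝ᵥ V.1 b)) ≠ 0 := by
      refine Finset.prod_ne_zero_iff.2 fun b hb => ?_
      have hbr : b ≠ r := Finset.ne_of_mem_erase hb
      by_cases htb : t b = 0
      · rcases h.rows b htb with ⟨j, hj⟩ | ⟨j, hj⟩
        · obtain ⟨a, ha, hta⟩ := hfix
          have h1 := hadj r b i j hi hj hbr.symm htr htb
          have hsub : ({V.1 r, V.1 b} : Set Lat) ⊆ rays V := by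
            rintro _ (rfl | rfl)
            exacts [⟨r, rfl⟩, ⟨b, rfl⟩]
          rcases h1.mem hsub ha with h2 | h2
          · rw [row_injective (isUnit_det_chart V) h2] at hta
            exact absurd htr hta
          · rw [row_injective (isUnit_det_chart V) h2] at hta
            exact absurd htb hta
        · rw [hj, nuZ_rayB, zpow_zero]
          exact one_ne_zero
      · exact zpow_ne_zero _ htb
    refine ⟨Pi.single r (c / ∏ b ∈ Finset.univ.erase r, t b ^ (nuZ ⬝ᵥ V.1 b)), ?_, ?_⟩
    · rw [dMono_single h.holZ, hi, nuZ_rayA]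
      simp only [Int.cast_one, sub_self, zpow_zero, one_mul]
      exact mul_div_cancel₀ c hprod
    · rw [dMono_single h.holW, hi, nuW_rayA]
      simp
  -- The vector `(0,0,1)` pairs to `1` with `nuZ` and to `0` with `nuW`.
  · refine ⟨_, (h.holZ.dMono_lattice ![0, 0, 1] (c / mono V nuZ t)).trans ?_,
      (h.holW.dMono_lattice ![0, 0, 1] (c / mono V nuZ t)).trans ?_⟩
    · rw [nuZ_dot]; simp [hz]
    · rw [nuW_dot]; simp

theorem OffD.exists_dW (h : OffD V t) (hfix : ∃ a, wt V a ≠ 0 ∧ t a ≠ 0)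
    (hadj : ∀ a b, ∀ i j, V.1 a = rayB i → V.1 b = rayB j → a ≠ b → t a = 0 → t b = 0 →
      Spans {V.1 a, V.1 b}) (c : ℂ) :
    ∃ u, dMono V nuZ t u = 0 ∧ dMono V nuW t u = c := by
  by_cases hw : mono V nuW t = 0
  · obtain ⟨r, -, hr⟩ := Finset.prod_eq_zero_iff.1 hw
    have htr : t r = 0 := by
      by_contra hne
      exact zpow_ne_zero _ hne hr
    obtain ⟨i, hi⟩ : ∃ i, V.1 r = rayB i := by
      rcases h.rows r htr with ⟨j, hj⟩ | h1
      · rw [hj, nuW_rayA, zpow_zero] at hr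
        exact absurd hr one_ne_zero
      · exact h1
    have hprod : (∏ b ∈ Finset.univ.erase r, t b ^ (nuW ⬝ᵥ V.1 b)) ≠ 0 := by
      refine Finset.prod_ne_zero_iff.2 fun b hb => ?_
      have hbr : b ≠ r := Finset.ne_of_mem_erase hb
      by_cases htb : t b = 0
      · rcases h.rows b htb with ⟨j, hj⟩ | ⟨j, hj⟩
        · rw [hj, nuW_rayA, zpow_zero]
          exact one_ne_zero
        · obtain ⟨a, ha, hta⟩ := hfix
          have h1 := hadj r b i j hi hj hbr.symm htr htb
          have hsub : ({V.1 r, V.1 b} : Set Lat) ⊆ rays V := by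
            rintro _ (rfl | rfl)
            exacts [⟨r, rfl⟩, ⟨b, rfl⟩]
          rcases h1.mem hsub ha with h2 | h2
          · rw [row_injective (isUnit_det_chart V) h2] at hta
            exact absurd htr hta
          · rw [row_injective (isUnit_det_chart V) h2] at hta
            exact absurd htb hta
      · exact zpow_ne_zero _ htb
    refine ⟨Pi.single r (c / ∏ b ∈ Finset.univ.erase r, t b ^ (nuW ⬝ᵥ V.1 b)), ?_, ?_⟩
    · rw [dMono_single h.holZ, hi, nuZ_rayB]
      simp
    · rw [dMono_single h.holW, hi, nuW_rayB]
      simp only [Int.cast_one, sub_self, zpow_zero, one_mul]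
      exact mul_div_cancel₀ c hprod
  -- The vector `(0,1,1)` pairs to `0` with `nuZ` and to `1` with `nuW`.
  · refine ⟨_, (h.holZ.dMono_lattice ![0, 1, 1] (c / mono V nuW t)).trans ?_,
      (h.holW.dMono_lattice ![0, 1, 1] (c / mono V nuW t)).trans ?_⟩
    · rw [nuZ_dot]; simp
    · rw [nuW_dot]; simp [hw]

theorem spans_pair_A (P : EdgePath T) (V : Chart T) {a b : Fin 3} {i j : ℤ} (hi : V.1 a = rayA i)
    (hj : V.1 b = rayA j) (hab : a ≠ b) : Spans {V.1 a, V.1 b} := by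
  have F := coneFacts P V
  have hi' : rayA i ∈ rays V := ⟨a, hi⟩
  have hj' : rayA j ∈ rays V := ⟨b, hj⟩
  have hij : i ≠ j := by
    rintro rfl
    exact hab (row_injective (isUnit_det_chart V) (hi.trans hj.symm))
  rw [hi, hj]
  have := F.adjA _ _ hi' hj'
  have := F.adjA _ _ hj' hi'
  rcases (by omega : j = i + 1 ∨ i = j + 1) with rfl | rfl
  · exact ⟨rayA (i + 1), by simp, rayA i, by simp, .inl (rayA_succ_sub i)⟩
  · exact ⟨rayA (j + 1), by simp, rayA j, by simp, .inl (rayA_succ_sub j)⟩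

theorem spans_pair_B (P : EdgePath T) (V : Chart T) {a b : Fin 3} {i j : ℤ} (hi : V.1 a = rayB i)
    (hj : V.1 b = rayB j) (hab : a ≠ b) : Spans {V.1 a, V.1 b} := by
  have F := coneFacts P V
  have hi' : rayB i ∈ rays V := ⟨a, hi⟩
  have hj' : rayB j ∈ rays V := ⟨b, hj⟩
  have hij : i ≠ j := by
    rintro rfl
    exact hab (row_injective (isUnit_det_chart V) (hi.trans hj.symm))
  rw [hi, hj]
  have := F.adjB _ _ hi' hj'
  have := F.adjB _ _ hj' hi'
  rcases (by omega : j = i + 1 ∨ i = j + 1) with rfl | rfl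
  · exact ⟨rayB (i + 1), by simp, rayB i, by simp, .inl (rayB_succ_sub i)⟩
  · exact ⟨rayB (j + 1), by simp, rayB j, by simp, .inl (rayB_succ_sub j)⟩

/-- Points off `D` that are not fixed by the circle action are regular. -/
theorem OffD.surjective_dFib (P : EdgePath T) (hμ : IsMomentMap ω μ) (h : OffD V t)
    (hfix : ∃ a, wt V a ≠ 0 ∧ t a ≠ 0) : Function.Surjective (dFib μ V t) := by
  rintro ⟨x, y, s⟩
  have hz := sub_ne_zero.2 h.z_ne
  have hw := sub_ne_zero.2 h.w_ne
  obtain ⟨u₁, h1, h2⟩ := h.exists_dZ hfix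
    (fun a b i j hi hj hab _ _ => spans_pair_A P V hi hj hab) (x * (mono V nuZ t - 1))
  obtain ⟨u₂, h3, h4⟩ := h.exists_dW hfix
    (fun a b i j hi hj hab _ _ => spans_pair_B P V hi hj hab) (y * (mono V nuW t - 1))
  have hR : radialField V t ≠ 0 := by
    obtain ⟨a, ha, hta⟩ := hfix
    intro h0
    have := congrFun h0 a
    simp [radialField, ha, hta] at this
  have hpos := hμ.dMu_radialField_pos hR
  have h5 := h.holZ.dMono_radialField (m := nuZ) rfl
  have h6 := h.holW.dMono_radialField (m := nuW) rfl
  -- The radial field annihilates `dz` and `dw` but not `dμ`, so it corrects the third component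
  -- alone.
  refine ⟨u₁ + u₂ + ((s - dMu μ V t u₁ - dMu μ V t u₂) / dMu μ V t (radialField V t)) •
    radialField V t, ?_⟩
  rw [h.dFib_apply hμ]
  simp only [map_add, map_smul, h1, h2, h3, h4, h5, h6, add_zero, zero_add, smul_zero,
    mul_div_cancel_right₀ _ hz, mul_div_cancel_right₀ _ hw, Complex.ofReal_re, smul_eq_mul]
  rw [div_mul_cancel₀ _ hpos.ne']
  congr 2
  ring

/-- At a fixed point the circle field vanishes, hence so does `dμ`, and the third component of `dπ`
is not onto. -/
theorem exists_of_surjective_dFib (hμ : IsMomentMap ω μ) (h : OffD V t)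
    (hs : Function.Surjective (dFib μ V t)) : ∃ a, wt V a ≠ 0 ∧ t a ≠ 0 := by
  by_contra! hfix
  obtain ⟨u, hu⟩ := hs (0, 0, 1)
  rw [h.dFib_apply hμ] at hu
  have h1 : dMu μ V t u = 1 := congrArg (fun x => x.2.2) hu
  have h2 : circleField V t = 0 := by
    ext a
    by_cases ha : wt V a = 0
    · simp [circleField_apply, ha]
    · simp [circleField_apply, hfix a ha]
  rw [hμ.dMu_apply, h2] at h1
  have h3 : ω.form V t ![u, 0] = 0 := (ω.form V t).map_coord_zero 1 rfl
  rw [h3] at h1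
  exact zero_ne_one h1

theorem finite_chart (P : EdgePath T) : Finite (Chart T) := by
  let R : Set Lat := rayA '' Set.Icc 0 k ∪ rayB '' Set.Icc 0 l ∪ {rayZ, rayW, rayX, -rayX}
  have hR : R.Finite :=
    (((Set.finite_Icc _ _).image _).union ((Set.finite_Icc _ _).image _)).union (Set.toFinite _)
  have h1 : (Set.pi Set.univ fun _ : Fin 3 => R).Finite := Set.Finite.pi fun _ => hR
  refine Set.Finite.subset (s := Set.pi Set.univ fun _ : Fin 3 => R) h1 (fun V hV a _ => ?_)
  have F := coneFacts P ⟨V, hV⟩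
  have hmem : V a ∈ rays (T := T) ⟨V, hV⟩ := ⟨a, rfl⟩
  rcases F.cases _ hmem with ⟨i, h⟩ | ⟨i, h⟩ | h | h | h | h <;> rw [h] at hmem ⊢
  · exact .inl (.inl ⟨i, F.bdA i hmem, rfl⟩)
  · exact .inl (.inr ⟨i, F.bdB i hmem, rfl⟩)
  all_goals exact .inr (by simp)

/-- A point off `D` that is not regular is fixed by the circle, so `μ` takes there its value at the
origin of the chart; there are finitely many charts. -/
theorem exists_critical_values (P : EdgePath T) (hμ : IsMomentMap ω μ) :
    ∃ S : Set ℝ, S.Finite ∧ ∀ p, p ∉ divisorD T → μ p ∉ S → IsRegularPt μ p := by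
  have := finite_chart P
  refine ⟨Set.range fun V : Chart T => μ (pt V 0), Set.finite_range _, fun p hp hS => ⟨hp, ?_⟩⟩
  rintro V t rfl
  refine ((notMem_divisorD_iff P).1 hp).surjective_dFib P hμ ?_
  by_contra! hfix
  exact hS ⟨V, (hμ.eq_of_fixed hfix).symm⟩

end

end GenConifold

end

noncomputable section

open scoped Matrix Topology

namespace GenConifold

variable {k l : ℕ} {T : MaxTriangulation k l}

/-! ### Regular fibres are tori -/

/-- If `z = 0`, then `rayA i` is a generator of `V`, so `z` enters with exponents `0` and `1` and
remains continuous at zero; likewise `w` with `rayB j`. -/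
theorem continuousAt_tube {V : Chart T} {i j : ℤ} {z w ξ : ℂ}
    (hV : cone i j (z : OnePoint ℂ) (w : OnePoint ℂ) ⊆ rays V) (hξ : ξ ≠ 0) :
    ContinuousAt (fun x : ℂ × ℂ × ℂ =>
      tube V i j (x.1 : OnePoint ℂ) (x.2.1 : OnePoint ℂ) x.2.2) (z, w, ξ) := by
  have hdet := isUnit_det_chart V
  have hf : ∀ z' w' : ℂ, frame i j (z' : OnePoint ℂ) (w' : OnePoint ℂ) =
      Matrix.of ![rayX, rayA i, rayB j] := fun z' w' => by simp [frame]
  rw [ContinuousAt, tendsto_pi_nhds]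
  intro a
  simp only [tube, coordChange, hf, Fin.prod_univ_three, coordP_coe, Matrix.cons_val]
  have h1 : z ≠ 0 ∨ 0 ≤ (Matrix.of ![rayX, rayA i, rayB j] * V.1⁻¹) 1 a := by
    by_cases hz : z = 0
    · right
      subst hz
      obtain ⟨b, hb⟩ := hV (show rayA i ∈ _ by simp)
      rw [mul_inv_row hdet (show Matrix.of ![rayX, rayA i, rayB j] 1 = V.1 b from hb.symm)]
      split_ifs <;> simp
    · exact .inl hz
  have h2 : w ≠ 0 ∨ 0 ≤ (Matrix.of ![rayX, rayA i, rayB j] * V.1⁻¹) 2 a := by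
    by_cases hw : w = 0
    · right
      subst hw
      obtain ⟨b, hb⟩ := hV (show rayB j ∈ _ by simp)
      rw [mul_inv_row hdet (show Matrix.of ![rayX, rayA i, rayB j] 2 = V.1 b from hb.symm)]
      split_ifs <;> simp
    · exact .inl hw
  have c0 : ContinuousAt (fun x : ℂ × ℂ × ℂ => x.2.2) (z, w, ξ) := by fun_prop
  have c1 : ContinuousAt (fun x : ℂ × ℂ × ℂ => x.1) (z, w, ξ) := by fun_prop
  have c2 : ContinuousAt (fun x : ℂ × ℂ × ℂ => x.2.1) (z, w, ξ) := by fun_prop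
  exact ((c0.zpow₀ _ (.inl hξ)).mul (c1.zpow₀ _ h1)).mul (c2.zpow₀ _ h2)

theorem cone_subset_cone {i j : ℤ} {z w z' w' : ℂ} (hz : z' = 0 → z = 0) (hw : w' = 0 → w = 0) :
    cone i j (z' : OnePoint ℂ) (w' : OnePoint ℂ) ⊆ cone i j (z : OnePoint ℂ) (w : OnePoint ℂ) := by
  rintro ρ (⟨rfl, h⟩ | ⟨rfl, h⟩ | ⟨rfl, h⟩ | ⟨rfl, h⟩)
  · simp at h; simp [hz h]
  · simp at h; simp [hw h]
  · exact absurd h (OnePoint.coe_ne_infty _)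
  · exact absurd h (OnePoint.coe_ne_infty _)

/-- Nonvanishing is an open condition, so cones only shrink nearby, and a chart adapted to the base
point stays adapted. -/
theorem eventually_cone_subset {Y : Type*} [TopologicalSpace Y] {f g : Y → ℂ} {y₀ : Y}
    (hf : ContinuousAt f y₀) (hg : ContinuousAt g y₀) (i j : ℤ) :
    ∀ᶠ y in 𝓝 y₀, cone i j (f y : OnePoint ℂ) (g y : OnePoint ℂ) ⊆
      cone i j (f y₀ : OnePoint ℂ) (g y₀ : OnePoint ℂ) := by
  have key : ∀ {f : Y → ℂ}, ContinuousAt f y₀ → ∀ᶠ y in 𝓝 y₀, f y = 0 → f y₀ = 0 := by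
    intro f hf
    by_cases h : f y₀ = 0
    · exact Filter.Eventually.of_forall fun _ _ => h
    · filter_upwards [hf.eventually_ne h] with y hy h0
      exact absurd h0 hy
  filter_upwards [key hf, key hg] with y h1 h2
  exact cone_subset_cone h1 h2

/-- The exponent of the character that is a coordinate on the orbits of index `(i, j)`. -/
def nuXi (i j : ℤ) : Lat := ![1, i - j, -i]

theorem nuXi_dot (i j : ℤ) (ρ : Lat) : nuXi i j ⬝ᵥ ρ = ρ 0 + (i - j) * ρ 1 - i * ρ 2 := by
  simp [nuXi, dotProduct, Fin.sum_univ_three]; ring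

theorem nuXi_rayX (i j : ℤ) : nuXi i j ⬝ᵥ rayX = 1 := by rw [nuXi_dot]; simp [rayX]
theorem nuXi_rayA (i j : ℤ) : nuXi i j ⬝ᵥ rayA i = 0 := by rw [nuXi_dot]; simp [rayA]
theorem nuXi_rayB (i j : ℤ) : nuXi i j ⬝ᵥ rayB j = 0 := by rw [nuXi_dot]; simp [rayB]

theorem charP1_nuXi_tube {V : Chart T} {i j : ℤ} {z w ξ : ℂ}
    (hV : cone i j (z : OnePoint ℂ) (w : OnePoint ℂ) ⊆ rays V) (hξ : ξ ≠ 0) :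
    charP1 (nuXi i j) (pt V (tube V i j (z : OnePoint ℂ) (w : OnePoint ℂ) ξ)) = (ξ : OnePoint ℂ) := by
  rw [charP1_pt, ← (rep_tube hV hξ).charM_eq, charM_eq_coe]
  · congr 1
    simp [monoM, Fin.prod_univ_three, frame_zero, frame_one, frame_two, nuXi_rayX, nuXi_rayA,
      nuXi_rayB]
  · rw [zeroRows_frame hξ]
    rintro ρ (⟨rfl, -⟩ | ⟨rfl, -⟩ | ⟨rfl, h⟩ | ⟨rfl, h⟩)
    · rw [nuXi_rayA]
    · rw [nuXi_rayB]
    · exact absurd h (OnePoint.coe_ne_infty _)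
    · exact absurd h (OnePoint.coe_ne_infty _)

theorem isOpen_orbitCone_subset (τ : Set Lat) : IsOpen {p : X T | orbitCone p ⊆ τ} := by
  refine isOpen_of_charts fun V => ?_
  have h : {t | pt V t ∈ {p : X T | orbitCone p ⊆ τ}} =
      ⋂ a : Fin 3, {t | V.1 a ∉ τ → t a ≠ 0} := by
    ext t
    simp only [Set.mem_ofPred_eq, Set.mem_iInter, orbitCone_pt]
    constructor
    · intro h a ha h0
      exact ha (h ⟨a, rfl, h0⟩)
    · rintro h _ ⟨a, rfl, h0⟩
      by_contra ha
      exact h a ha h0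
  rw [h]
  refine isOpen_iInter_of_finite fun a => ?_
  by_cases ha : V.1 a ∈ τ
  · simp [ha]
  · simpa [ha] using isOpen_ne.preimage (continuous_apply a)

theorem continuousOn_charP1 {m : Lat} {τ : Set Lat} (h : ∀ ρ ∈ τ, m ⬝ᵥ ρ = 0) :
    ContinuousOn (charP1 (T := T) m) {p | orbitCone p ⊆ τ} := by
  refine continuousOn_of_charts (isOpen_orbitCone_subset τ) fun V => ?_
  have h1 : ∀ t, pt V t ∈ {p : X T | orbitCone p ⊆ τ} → HolAt V.1 m t := by
    intro t ht a
    by_cases ha : t a = 0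
    · exact .inr (h _ (ht ⟨a, rfl, ha⟩)).ge
    · exact .inl ha
  have h2 : ContinuousOn (fun t => ((monoM V.1 m t : ℂ) : OnePoint ℂ))
      {t | pt V t ∈ {p : X T | orbitCone p ⊆ τ}} := fun t ht =>
    (OnePoint.continuous_coe.continuousAt.comp (continuousAt_monoM (h1 t ht))).continuousWithinAt
  exact h2.congr fun t ht => (h1 t ht).charM_eq

theorem continuousAt_coordP (z : ℂ) : ContinuousAt coordP (z : OnePoint ℂ) :=
  OnePoint.continuousAt_coe.2 continuousAt_id

section
variable {ω : ToricKahlerForm T} {μ : X T → ℝ}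

/-- With fixed indices `(i, j)` the frame coordinates `(z, w, ξ)` are global on `F`. The conditions
put `z` and `w` on circles about `1`, and strict monotonicity of `μ` in `|ξ|` determines `|ξ|`,
leaving three phases. The hypothesis `hcone` is where regularity enters. -/
theorem nonempty_homeomorph_torus (P : EdgePath T) (hμ : IsMomentMap ω μ) {r₁ r₂ b : ℝ}
    (hr₁ : 0 < r₁) (hr₂ : 0 < r₂) {i j : ℤ} {F : Set (X T)}
    (hF : ∀ p, p ∈ F ↔ ∃ z w : ℂ, zFun p = (z : OnePoint ℂ) ∧ wFun p = (w : OnePoint ℂ) ∧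
      ‖z - 1‖ = r₁ ∧ ‖w - 1‖ = r₂ ∧ μ p = b)
    (hcone : ∀ p ∈ F, orbitCone p = cone i j (zFun p) (wFun p))
    (hex : ∀ z w : ℂ, ‖z - 1‖ = r₁ → ‖w - 1‖ = r₂ →
      ∃ p, zFun p = (z : OnePoint ℂ) ∧ wFun p = (w : OnePoint ℂ) ∧ μ p = b) :
    Nonempty (F ≃ₜ (Fin 3 → Circle)) := by
  have hr₁' : (r₁ : ℂ) ≠ 0 := by exact_mod_cast hr₁.ne'
  have hr₂' : (r₂ : ℂ) ≠ 0 := by exact_mod_cast hr₂.ne'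
  have hne : ∀ s : ℝ, (Real.exp s : ℂ) ≠ 0 := fun s => by exact_mod_cast (Real.exp_pos s).ne'
  let Z : (Fin 3 → Circle) → ℂ := fun u => 1 + r₁ * u 0
  let W : (Fin 3 → Circle) → ℂ := fun u => 1 + r₂ * u 1
  have hZc : Continuous Z := by fun_prop
  have hWc : Continuous W := by fun_prop
  have hZ : ∀ u, ‖Z u - 1‖ = r₁ := fun u => by
    simp only [Z, add_sub_cancel_left, norm_mul, Circle.norm_coe, mul_one, Complex.norm_real,
      Real.norm_eq_abs, abs_of_pos hr₁]
  have hW : ∀ u, ‖W u - 1‖ = r₂ := fun u => by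
    simp only [W, add_sub_cancel_left, norm_mul, Circle.norm_coe, mul_one, Complex.norm_real,
      Real.norm_eq_abs, abs_of_pos hr₂]
  have hex' : ∀ u, ∃ (V : Chart T) (s : ℝ), cone i j (Z u : OnePoint ℂ) (W u : OnePoint ℂ) ⊆ rays V ∧
      μ (pt V (tube V i j (Z u : OnePoint ℂ) (W u : OnePoint ℂ) (Real.exp s))) = b := by
    intro u
    obtain ⟨p, hz, hw, hb⟩ := hex (Z u) (W u) (hZ u) (hW u)
    have hpF : p ∈ F := (hF p).2 ⟨_, _, hz, hw, hZ u, hW u, hb⟩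
    have hc := hcone p hpF
    obtain ⟨ξ, hξ, hp⟩ := exists_eq_tube hc
    obtain ⟨V, t, hpt⟩ := exists_pt p
    have hV : cone i j (zFun p) (wFun p) ⊆ rays V := by
      rw [← hc, ← hpt]; exact zeroRows_subset_rays V t
    have h1 := hp V hV
    rw [hz, hw] at hV h1
    refine ⟨V, Real.log ‖ξ‖, hV, ?_⟩
    rw [← mu_tube_eq_exp hμ hξ, ← h1, hb]
  choose V s hV hs using hex'
  -- the level set depends continuously on the base point
  have hsc : Continuous s := by
    rw [continuous_iff_continuousAt]
    intro u₀
    -- The charts `V u` are chosen without any continuity. Near `u₀` they can all be replaced by `V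
    -- u₀` without changing the point of `X`.
    have hev : ∀ᶠ u in 𝓝 u₀, ∀ s', pt (V u) (tube (V u) i j (Z u : OnePoint ℂ) (W u) (Real.exp s')) =
        pt (V u₀) (tube (V u₀) i j (Z u : OnePoint ℂ) (W u) (Real.exp s')) := by
      filter_upwards [eventually_cone_subset hZc.continuousAt hWc.continuousAt i j] with u hu s'
      exact pt_tube_eq (hV u) (hu.trans (hV u₀)) (hne s')
    have hcts : ∀ a : ℝ, Filter.Tendsto
        (fun u => μ (pt (V u) (tube (V u) i j (Z u : OnePoint ℂ) (W u) (Real.exp a)))) (𝓝 u₀)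
        (𝓝 (μ (pt (V u₀) (tube (V u₀) i j (Z u₀ : OnePoint ℂ) (W u₀) (Real.exp a))))) := by
      intro a
      have h1 : Filter.Tendsto (fun u => (Z u, W u, (Real.exp a : ℂ))) (𝓝 u₀)
          (𝓝 (Z u₀, W u₀, (Real.exp a : ℂ))) :=
        (hZc.prodMk (hWc.prodMk continuous_const)).tendsto u₀
      have h2 := ((hμ.continuous_chart (V u₀)).tendsto _).comp
        ((continuousAt_tube (hV u₀) (hne a)).tendsto.comp h1)
      refine h2.congr' ?_
      filter_upwards [hev] with u hu
      simp only [Function.comp, hu a]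
    refine tendsto_order.2 ⟨fun a ha => ?_, fun a ha => ?_⟩
    · have h1 := strictMono_tube hμ (hV u₀) ha
      simp only [hs u₀] at h1
      filter_upwards [(hcts a).eventually_lt_const h1] with u hu
      have h2 := hs u
      exact (strictMono_tube hμ (hV u)).lt_iff_lt.1 (hu.trans_eq h2.symm)
    · have h1 := strictMono_tube hμ (hV u₀) ha
      simp only [hs u₀] at h1
      filter_upwards [(hcts a).eventually_const_lt h1] with u hu
      have h2 := hs u
      exact (strictMono_tube hμ (hV u)).lt_iff_lt.1 (h2.trans_lt hu)
  let Ξ : (Fin 3 → Circle) → ℂ := fun u => u 2 * Real.exp (s u)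
  have hΞc : Continuous Ξ := by fun_prop
  have hΞ : ∀ u, Ξ u ≠ 0 := fun u => mul_ne_zero (u 2).coe_ne_zero (hne _)
  let Ψ : (Fin 3 → Circle) → X T := fun u => pt (V u) (tube (V u) i j (Z u : OnePoint ℂ) (W u) (Ξ u))
  have hΨc : Continuous Ψ := by
    rw [continuous_iff_continuousAt]
    intro u₀
    have h1 : Filter.Tendsto (fun u => (Z u, W u, Ξ u)) (𝓝 u₀) (𝓝 (Z u₀, W u₀, Ξ u₀)) :=
      (hZc.prodMk (hWc.prodMk hΞc)).tendsto u₀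
    have h2 := ((continuous_pt (V u₀)).tendsto _).comp
      ((continuousAt_tube (hV u₀) (hΞ u₀)).tendsto.comp h1)
    refine h2.congr' ?_
    filter_upwards [eventually_cone_subset hZc.continuousAt hWc.continuousAt i j] with u hu
    exact (pt_tube_eq (hV u) (hu.trans (hV u₀)) (hΞ u)).symm
  have hΨz : ∀ u, zFun (Ψ u) = (Z u : OnePoint ℂ) := fun u => zFun_tube (hV u) (hΞ u)
  have hΨw : ∀ u, wFun (Ψ u) = (W u : OnePoint ℂ) := fun u => wFun_tube (hV u) (hΞ u)
  have hΨξ : ∀ u, charP1 (nuXi i j) (Ψ u) = (Ξ u : OnePoint ℂ) := fun u =>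
    charP1_nuXi_tube (hV u) (hΞ u)
  have hΨF : ∀ u, Ψ u ∈ F := fun u => by
    refine (hF _).2 ⟨_, _, hΨz u, hΨw u, hZ u, hW u, ?_⟩
    rw [← hs u]
    exact mu_tube_circle hμ (u 2) _
  -- every point of the fibre is of the form `Ψ u`
  have hsurj : ∀ p ∈ F, ∃ u, Ψ u = p := by
    intro p hp
    obtain ⟨z, w, hz, hw, hz1, hw1, hb⟩ := (hF p).1 hp
    obtain ⟨ξ, hξ, hpt⟩ := exists_eq_tube (hcone p hp)
    have hn : (‖ξ‖ : ℂ) ≠ 0 := by simpa using hξ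
    have e1 : ‖(z - 1) / r₁‖ = 1 := by rw [norm_div, hz1]; simp [abs_of_pos hr₁, hr₁.ne']
    have e2 : ‖(w - 1) / r₂‖ = 1 := by rw [norm_div, hw1]; simp [abs_of_pos hr₂, hr₂.ne']
    have e3 : ‖ξ / ‖ξ‖‖ = 1 := by rw [norm_div]; simp [hξ]
    let u : Fin 3 → Circle := ![⟨_, mem_sphere_zero_iff_norm.2 e1⟩,
      ⟨_, mem_sphere_zero_iff_norm.2 e2⟩, ⟨_, mem_sphere_zero_iff_norm.2 e3⟩]
    have hu0 : ((u 0 : Circle) : ℂ) = (z - 1) / r₁ := rfl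
    have hu1 : ((u 1 : Circle) : ℂ) = (w - 1) / r₂ := rfl
    have hu2 : ((u 2 : Circle) : ℂ) = ξ / ‖ξ‖ := rfl
    have hzu : Z u = z := by simp only [Z, hu0]; field_simp; ring
    have hwu : W u = w := by simp only [W, hu1]; field_simp; ring
    have hVu := hV u
    have hsu := hs u
    rw [hzu, hwu] at hVu hsu
    rw [hz, hw] at hpt
    have h1 := hpt (V u) hVu
    have h2 : Real.log ‖ξ‖ = s u := by
      refine (strictMono_tube hμ hVu).injective ?_
      simp only [hsu]
      rw [← mu_tube_eq_exp hμ hξ, ← h1, hb]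
    have h3 : Ξ u = ξ := by
      simp only [Ξ, hu2, ← h2]
      rw [Real.exp_log (norm_pos_iff.2 hξ)]
      field_simp
    refine ⟨u, ?_⟩
    simp only [Ψ, hzu, hwu, h3]
    exact h1.symm
  -- the inverse
  have hcz : ∀ p : F, ∃ z : ℂ, zFun p.1 = (z : OnePoint ℂ) ∧ ‖z - 1‖ = r₁ := fun p => by
    obtain ⟨z, w, h1, -, h2, -⟩ := (hF p.1).1 p.2
    exact ⟨z, h1, h2⟩
  have hcw : ∀ p : F, ∃ w : ℂ, wFun p.1 = (w : OnePoint ℂ) ∧ ‖w - 1‖ = r₂ := fun p => by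
    obtain ⟨z, w, -, h1, -, h2, -⟩ := (hF p.1).1 p.2
    exact ⟨w, h1, h2⟩
  have hcξ : ∀ p : F, ∃ ξ : ℂ, charP1 (nuXi i j) p.1 = (ξ : OnePoint ℂ) ∧ ξ ≠ 0 := fun p => by
    obtain ⟨u, hu⟩ := hsurj p.1 p.2
    exact ⟨Ξ u, hu ▸ hΨξ u, hΞ u⟩
  have c1 : Continuous fun p : F => coordP (zFun p.1) := by
    rw [continuous_iff_continuousAt]
    intro p
    obtain ⟨z, hz, -⟩ := hcz p
    have h2 := continuousAt_coordP z
    rw [← hz] at h2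
    exact h2.comp (f := fun p : F => zFun p.1)
      ((continuous_zFun P).comp continuous_subtype_val).continuousAt
  have c2 : Continuous fun p : F => coordP (wFun p.1) := by
    rw [continuous_iff_continuousAt]
    intro p
    obtain ⟨w, hw, -⟩ := hcw p
    have h2 := continuousAt_coordP w
    rw [← hw] at h2
    exact h2.comp (f := fun p : F => wFun p.1)
      ((continuous_wFun P).comp continuous_subtype_val).continuousAt
  have c3 : Continuous fun p : F => coordP (charP1 (nuXi i j) p.1) := by
    have h1 : ContinuousOn (charP1 (T := T) (nuXi i j)) F := by
      refine (continuousOn_charP1 (τ := {rayA i, rayB j}) ?_).mono fun p hp => ?_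
      · rintro ρ (rfl | rfl)
        exacts [nuXi_rayA i j, nuXi_rayB i j]
      · rw [Set.mem_ofPred_eq, hcone p hp]
        obtain ⟨z, w, hz, hw, -⟩ := (hF p).1 hp
        rw [hz, hw]
        rintro ρ (⟨rfl, -⟩ | ⟨rfl, -⟩ | ⟨rfl, h⟩ | ⟨rfl, h⟩)
        · simp
        · simp
        · exact absurd h (OnePoint.coe_ne_infty _)
        · exact absurd h (OnePoint.coe_ne_infty _)
    rw [continuous_iff_continuousAt]
    intro p
    obtain ⟨ξ, hξ, -⟩ := hcξ p
    have h2 := continuousAt_coordP ξ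
    rw [← hξ] at h2
    exact h2.comp (f := fun p : F => charP1 (nuXi i j) p.1)
      (continuousOn_iff_continuous_domRestrict.1 h1).continuousAt
  have n1 : ∀ p : F, ‖(coordP (zFun p.1) - 1) / r₁‖ = 1 := fun p => by
    obtain ⟨z, hz, hz1⟩ := hcz p
    rw [hz, coordP_coe, norm_div, hz1]; simp [abs_of_pos hr₁, hr₁.ne']
  have n2 : ∀ p : F, ‖(coordP (wFun p.1) - 1) / r₂‖ = 1 := fun p => by
    obtain ⟨w, hw, hw1⟩ := hcw p
    rw [hw, coordP_coe, norm_div, hw1]; simp [abs_of_pos hr₂, hr₂.ne']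
  have n0 : ∀ p : F, coordP (charP1 (nuXi i j) p.1) ≠ 0 := fun p => by
    obtain ⟨ξ, hξ, h0⟩ := hcξ p
    rwa [hξ, coordP_coe]
  have n3 : ∀ p : F, ‖coordP (charP1 (nuXi i j) p.1) / ‖coordP (charP1 (nuXi i j) p.1)‖‖ = 1 :=
    fun p => by rw [norm_div]; simp [n0 p]
  let Φ : F → Fin 3 → Circle := fun p => ![⟨_, mem_sphere_zero_iff_norm.2 (n1 p)⟩,
      ⟨_, mem_sphere_zero_iff_norm.2 (n2 p)⟩, ⟨_, mem_sphere_zero_iff_norm.2 (n3 p)⟩]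
  have hΦc : Continuous Φ := by
    refine continuous_pi fun a => ?_
    fin_cases a
    · exact Continuous.subtype_mk ((c1.sub continuous_const).div_const _) _
    · exact Continuous.subtype_mk ((c2.sub continuous_const).div_const _) _
    · exact Continuous.subtype_mk (c3.div (Complex.continuous_ofReal.comp c3.norm)
        fun p => by simpa using n0 p) _
  have hΦΨ : ∀ u, Φ ⟨Ψ u, hΨF u⟩ = u := by
    intro u
    ext a
    fin_cases a
    · change (coordP (zFun (Ψ u)) - 1) / r₁ = u 0
      rw [hΨz, coordP_coe]
      simp only [Z]
      field_simp
      ring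
    · change (coordP (wFun (Ψ u)) - 1) / r₂ = u 1
      rw [hΨw, coordP_coe]
      simp only [W]
      field_simp
      ring
    · change coordP (charP1 (nuXi i j) (Ψ u)) / ‖coordP (charP1 (nuXi i j) (Ψ u))‖ = u 2
      rw [hΨξ, coordP_coe]
      have h1 : ‖Ξ u‖ = Real.exp (s u) := by
        simp only [Ξ, norm_mul, Circle.norm_coe, one_mul, Complex.norm_real]
        exact Real.norm_of_nonneg (Real.exp_pos _).le
      rw [h1]
      exact mul_div_cancel_right₀ _ (hne _)
  refine ⟨{ toFun := Φ, invFun := fun u => ⟨Ψ u, hΨF u⟩, left_inv := ?_, right_inv := hΦΨ,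
            continuous_toFun := hΦc, continuous_invFun := hΨc.subtype_mk _ }⟩
  rintro ⟨p, hp⟩
  obtain ⟨u, rfl⟩ := hsurj p hp
  simp only [hΦΨ]

end

end GenConifold

end

noncomputable section

open scoped Matrix Topology

namespace GenConifold

variable {k l : ℕ} {T : MaxTriangulation k l}

/-! ### The index of a regular fibre -/

section
variable {ω : ToricKahlerForm T} {μ : X T → ℝ}

/-- The points of the open stratum of a ray are dense in its divisor. -/
theorem exists_tendsto_of_mem_orbitCone {p : X T} {ρ : Lat} (h : ρ ∈ orbitCone p) :
    ∃ q : ℕ → X T, (∀ n, orbitCone (q n) = {ρ}) ∧ Filter.Tendsto q Filter.atTop (𝓝 p) := by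
  obtain ⟨V, t, rfl⟩ := exists_pt p
  obtain ⟨a, rfl, ha⟩ := h
  simp only at ha
  let s : ℕ → C3 := fun n b => if b = a then 0 else if t b = 0 then (1 / ((n : ℂ) + 1)) else t b
  refine ⟨fun n => pt V (s n), fun n => ?_, ((continuous_pt V).tendsto t).comp ?_⟩
  · rw [orbitCone_pt]
    have hn : (1 / ((n : ℂ) + 1)) ≠ 0 := one_div_ne_zero (Nat.cast_add_one_ne_zero n)
    have hs : ∀ b, s n b = 0 ↔ b = a := by
      intro b
      simp only [s]
      split_ifs with h1 h2
      · simp [h1]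
      · simpa [h1] using hn
      · simp [h1, h2]
    ext ρ
    constructor
    · rintro ⟨b, rfl, hb⟩
      rw [(hs b).1 hb]
      rfl
    · rintro rfl
      exact ⟨a, rfl, (hs a).2 rfl⟩
  · rw [tendsto_pi_nhds]
    intro b
    simp only [s]
    split_ifs with h1 h2
    · rw [h1, ha]; exact tendsto_const_nhds
    · rw [h2]; exact tendsto_one_div_add_atTop_nhds_zero_nat
    · exact tendsto_const_nhds

/-- The pair `rayA n, rayA (n + 1)` already spans `rayX`, so it alone determines the value of `μ`; a
possible further ray `rayW` plays no role. -/
theorem level_chainA_congr (P : EdgePath T) (hμ : IsMomentMap ω μ) {w w' : OnePoint ℂ}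
    (hw : w ≠ zeroP) (hw' : w' ≠ zeroP) (n : ℕ) :
    (chainA P hw).level μ n = (chainA P hw').level μ n := by
  have key : ∀ {w : OnePoint ℂ} (hw : w ≠ zeroP) (n : ℕ), n < k →
      val μ ((chainA P hw).orbit n ∪ (chainA P hw).orbit (n + 1)) =
        val μ {rayA n, rayA (n + 1)} := by
    intro w hw n hn
    obtain ⟨V, hV⟩ := (chainA P hw).mid n hn
    refine (hμ.val_mono ⟨rayA (n + 1), by simp, rayA n, by simp, .inl (rayA_succ_sub n)⟩ ?_ hV).symm
    rintro _ (rfl | rfl) <;> simp [chainA]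
  cases n with
  | zero => rfl
  | succ n =>
    by_cases hn : n < k
    · have h1 : n < (chainA P hw).L := hn
      have h2 : n < (chainA P hw').L := hn
      rw [FibreChain.level, FibreChain.level, if_pos h1, if_pos h2, key hw n hn, key hw' n hn]
    · have h1 : ¬ n < (chainA P hw).L := hn
      have h2 : ¬ n < (chainA P hw').L := hn
      rw [FibreChain.level, FibreChain.level, if_neg h1, if_neg h2]

theorem level_chainB_congr (P : EdgePath T) (hμ : IsMomentMap ω μ) {z z' : OnePoint ℂ}
    (hz : z ≠ zeroP) (hz' : z' ≠ zeroP) (n : ℕ) :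
    (chainB P hz).level μ n = (chainB P hz').level μ n := by
  have key : ∀ {z : OnePoint ℂ} (hz : z ≠ zeroP) (n : ℕ), n < l →
      val μ ((chainB P hz).orbit n ∪ (chainB P hz).orbit (n + 1)) =
        val μ {rayB n, rayB (n + 1)} := by
    intro z hz n hn
    obtain ⟨V, hV⟩ := (chainB P hz).mid n hn
    refine (hμ.val_mono ⟨rayB (n + 1), by simp, rayB n, by simp, .inl (rayB_succ_sub n)⟩ ?_ hV).symm
    rintro _ (rfl | rfl) <;> simp [chainB]
  cases n with
  | zero => rfl
  | succ n =>
    by_cases hn : n < l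
    · have h1 : n < (chainB P hz).L := hn
      have h2 : n < (chainB P hz').L := hn
      rw [FibreChain.level, FibreChain.level, if_pos h1, if_pos h2, key hz n hn, key hz' n hn]
    · have h1 : ¬ n < (chainB P hz).L := hn
      have h2 : ¬ n < (chainB P hz').L := hn
      rw [FibreChain.level, FibreChain.level, if_neg h1, if_neg h2]

/-- On the open stratum of the divisor of `rayA i` one has `w ≠ 0`, and `μ` lies between two levels
that do not depend on `w`. The stratum is dense in the divisor, so the closed bounds extend to all
of it, in particular to `z = w = 0`. -/
theorem mem_Icc_of_rayA_mem (P : EdgePath T) (hμ : IsMomentMap ω μ) {w : OnePoint ℂ}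
    (hw : w ≠ zeroP) {p : X T} {i : ℤ} (h : rayA i ∈ orbitCone p) :
    ∃ n : ℕ, n ≤ k ∧ i = n ∧
      μ p ∈ Set.Icc ((chainA P hw).level μ (n + 1)) ((chainA P hw).level μ n) := by
  obtain ⟨q, hq, hlim⟩ := exists_tendsto_of_mem_orbitCone h
  have key : ∀ m, ∃ n : ℕ, n ≤ k ∧ i = n ∧
      μ (q m) ∈ Set.Icc ((chainA P hw).level μ (n + 1)) ((chainA P hw).level μ n) := by
    intro m
    have hc := compat_orbitCone P (q m)
    have hz : zFun (q m) = zeroP := hc.z_zero.2 ⟨i, by simp [hq]⟩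
    have hw' : wFun (q m) ≠ zeroP := by
      rw [Ne, hc.w_zero, hq]
      rintro ⟨j, hj⟩
      exact rayA_ne_rayB hj.symm
    rcases (chainA P hw').cases P hμ hz rfl with ⟨n, hn, h, h'⟩ | ⟨n, hn, h, -⟩ | ⟨h, -⟩ | ⟨h, -⟩
    · have hmem : rayA n ∈ (chainA P hw').orbit n := by simp [FibreChain.orbit, chainA]
      rw [← h, hq, Set.mem_singleton_iff, rayA_inj] at hmem
      refine ⟨n, hn, hmem.symm, ?_⟩
      rw [level_chainA_congr P hμ hw hw', level_chainA_congr P hμ hw hw']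
      exact Set.Ioo_subset_Icc_self h'
    · have h1 : rayA n ∈ (chainA P hw').orbit n ∪ (chainA P hw').orbit (n + 1) := by
        simp [FibreChain.orbit, chainA]
      have h2 : rayA (n + 1) ∈ (chainA P hw').orbit n ∪ (chainA P hw').orbit (n + 1) := by
        simp [FibreChain.orbit, chainA]
      rw [← h, hq, Set.mem_singleton_iff, rayA_inj] at h1 h2
      omega
    · have h1 : -rayX ∈ insert (-rayX) ((chainA P hw').orbit 0) := Set.mem_insert _ _
      rw [← h, hq] at h1
      exact absurd h1.symm rayA_ne_neg_rayX
    · have h1 : rayX ∈ insert rayX ((chainA P hw').orbit (chainA P hw').L) := Set.mem_insert _ _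
      rw [← h, hq] at h1
      exact absurd h1.symm rayA_ne_rayX
  obtain ⟨n, hn, rfl, -⟩ := key 0
  refine ⟨n, hn, rfl, isClosed_Icc.mem_of_tendsto ((hμ.continuous.tendsto p).comp hlim)
    (Filter.Eventually.of_forall fun m => ?_)⟩
  obtain ⟨n', -, h1, h2⟩ := key m
  obtain rfl : n = n' := by exact_mod_cast h1
  exact h2

theorem mem_Icc_of_rayB_mem (P : EdgePath T) (hμ : IsMomentMap ω μ) {z : OnePoint ℂ}
    (hz : z ≠ zeroP) {p : X T} {j : ℤ} (h : rayB j ∈ orbitCone p) :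
    ∃ n : ℕ, n ≤ l ∧ j = n ∧
      μ p ∈ Set.Icc ((chainB P hz).level μ (n + 1)) ((chainB P hz).level μ n) := by
  obtain ⟨q, hq, hlim⟩ := exists_tendsto_of_mem_orbitCone h
  have key : ∀ m, ∃ n : ℕ, n ≤ l ∧ j = n ∧
      μ (q m) ∈ Set.Icc ((chainB P hz).level μ (n + 1)) ((chainB P hz).level μ n) := by
    intro m
    have hc := compat_orbitCone P (q m)
    have hw : wFun (q m) = zeroP := hc.w_zero.2 ⟨j, by simp [hq]⟩
    have hz' : zFun (q m) ≠ zeroP := by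
      rw [Ne, hc.z_zero, hq]
      rintro ⟨i, hi⟩
      exact rayA_ne_rayB hi
    rcases (chainB P hz').cases P hμ rfl hw with ⟨n, hn, h, h'⟩ | ⟨n, hn, h, -⟩ | ⟨h, -⟩ | ⟨h, -⟩
    · have hmem : rayB n ∈ (chainB P hz').orbit n := by simp [FibreChain.orbit, chainB]
      rw [← h, hq, Set.mem_singleton_iff, rayB_inj] at hmem
      refine ⟨n, hn, hmem.symm, ?_⟩
      rw [level_chainB_congr P hμ hz hz', level_chainB_congr P hμ hz hz']
      exact Set.Ioo_subset_Icc_self h'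
    · have h1 : rayB n ∈ (chainB P hz').orbit n ∪ (chainB P hz').orbit (n + 1) := by
        simp [FibreChain.orbit, chainB]
      have h2 : rayB (n + 1) ∈ (chainB P hz').orbit n ∪ (chainB P hz').orbit (n + 1) := by
        simp [FibreChain.orbit, chainB]
      rw [← h, hq, Set.mem_singleton_iff, rayB_inj] at h1 h2
      omega
    · have h1 : -rayX ∈ insert (-rayX) ((chainB P hz').orbit 0) := Set.mem_insert _ _
      rw [← h, hq] at h1
      exact absurd h1.symm rayB_ne_neg_rayX
    · have h1 : rayX ∈ insert rayX ((chainB P hz').orbit (chainB P hz').L) := Set.mem_insert _ _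
      rw [← h, hq] at h1
      exact absurd h1.symm rayB_ne_rayX
  obtain ⟨n, hn, rfl, -⟩ := key 0
  refine ⟨n, hn, rfl, isClosed_Icc.mem_of_tendsto ((hμ.continuous.tendsto p).comp hlim)
    (Filter.Eventually.of_forall fun m => ?_)⟩
  obtain ⟨n', -, h1, h2⟩ := key m
  obtain rfl : n = n' := by exact_mod_cast h1
  exact h2

theorem FibreChain.index_unique {z w : OnePoint ℂ} (C : FibreChain T z w) (P : EdgePath T)
    (hμ : IsMomentMap ω μ) {m n : ℕ} (hm : m ≤ C.L) (hn : n ≤ C.L) {b : ℝ}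
    (h : b ∈ Set.Icc (C.level μ (m + 1)) (C.level μ m))
    (h' : b ∈ Set.Ioo (C.level μ (n + 1)) (C.level μ n)) : m = n := by
  rcases lt_trichotomy m n with hlt | heq | hlt
  · have := C.level_anti P hμ (m := m + 1) (n := n) hlt (by omega)
    linarith [h.1, h'.2]
  · exact heq
  · have := C.level_anti P hμ (m := n + 1) (n := m) hlt (by omega)
    linarith [h.2, h'.1]

theorem FibreChain.exists_of_not_spans {z w : OnePoint ℂ} (C : FibreChain T z w) (P : EdgePath T)
    (hμ : IsMomentMap ω μ) {p : X T} (hz : zFun p = z) (hw : wFun p = w)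
    (h : ¬ Spans (orbitCone p)) : ∃ n ≤ C.L, orbitCone p = C.orbit n ∧
      μ p ∈ Set.Ioo (C.level μ (n + 1)) (C.level μ n) := by
  rcases C.cases P hμ hz hw with h' | ⟨n, hn, h', -⟩ | ⟨h', -⟩ | ⟨h', -⟩
  · exact h'
  · exact absurd (h' ▸ C.spans_step hn) h
  · exact absurd (h' ▸ spans_neg_rayX.mono (by simp)) h
  · exact absurd (h' ▸ spans_rayX.mono (by simp)) h

/-- The point `q` is not fixed, so its `μ`-value is strictly between two levels. Every other point
with this value on some `rayA` divisor lies in the corresponding closed interval, and an interior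
value belongs to only one of these. -/
theorem exists_index_A (P : EdgePath T) (hμ : IsMomentMap ω μ) {q : X T} (hz : zFun q = zeroP)
    (hw : wFun q ≠ zeroP) (hq : ¬ Spans (orbitCone q)) :
    ∃ i, ∀ p, μ p = μ q → ∀ i', rayA i' ∈ orbitCone p → i' = i := by
  obtain ⟨n, hn, -, hb⟩ := (chainA P hw).exists_of_not_spans P hμ hz rfl hq
  refine ⟨n, fun p hp i' hi' => ?_⟩
  obtain ⟨m, hm, rfl, h⟩ := mem_Icc_of_rayA_mem P hμ hw hi'
  rw [hp] at h
  rw [(chainA P hw).index_unique P hμ hm hn h hb]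

theorem exists_index_B (P : EdgePath T) (hμ : IsMomentMap ω μ) {q : X T} (hw : wFun q = zeroP)
    (hz : zFun q ≠ zeroP) (hq : ¬ Spans (orbitCone q)) :
    ∃ j, ∀ p, μ p = μ q → ∀ j', rayB j' ∈ orbitCone p → j' = j := by
  obtain ⟨n, hn, -, hb⟩ := (chainB P hz).exists_of_not_spans P hμ rfl hw hq
  refine ⟨n, fun p hp j' hj' => ?_⟩
  obtain ⟨m, hm, rfl, h⟩ := mem_Icc_of_rayB_mem P hμ hz hj'
  rw [hp] at h
  rw [(chainB P hz).index_unique P hμ hm hn h hb]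

theorem IsRegularPt.not_spans (P : EdgePath T) (hμ : IsMomentMap ω μ) {p : X T}
    (h : IsRegularPt μ p) : ¬ Spans (orbitCone p) := by
  intro hs
  obtain ⟨V, t, rfl⟩ := exists_pt p
  obtain ⟨a, ha, hta⟩ :=
    exists_of_surjective_dFib hμ ((notMem_divisorD_iff P).1 h.1) (h.2 V t rfl)
  exact hta ((mem_zeroRows (isUnit_det_chart V)).1 (hs.mem (zeroRows_subset_rays V t) ha))

/-- It remains to see that one pair of indices serves the whole fibre. An index matters only where
`z = 0` or `w = 0`, and there a comparison point with the other function nonzero fixes it. -/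
theorem nonempty_homeomorph_torus_of_regular (P : EdgePath T) (hμ : IsMomentMap ω μ)
    {b : EReal × EReal × ℝ} (hb : b ∈ Set.range (fibMap μ))
    (hreg : ∀ p, fibMap μ p = b → IsRegularPt μ p) :
    Nonempty ((fibMap μ ⁻¹' {b} : Set (X T)) ≃ₜ (Fin 3 → Circle)) := by
  obtain ⟨p₀, rfl⟩ := hb
  have h0 := (hreg p₀ rfl).1
  rw [mem_divisorD_iff_fibMap P hμ, not_not] at h0
  obtain ⟨b₁, b₂, b₃, hb₃, hb⟩ := h0
  rw [hb] at hreg ⊢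
  have hfib : ∀ p, fibMap μ p = ((b₁ : EReal), (b₂ : EReal), b₃) ↔ ∃ z w : ℂ,
      zFun p = (z : OnePoint ℂ) ∧ wFun p = (w : OnePoint ℂ) ∧
      ‖z - 1‖ = Real.exp b₁ ∧ ‖w - 1‖ = Real.exp b₂ ∧ μ p = b₃ := by
    intro p
    simp only [fibMap, Prod.mk.injEq, logDist_eq_coe_iff]
    constructor
    · rintro ⟨⟨z, hz, hz'⟩, ⟨w, hw, hw'⟩, h⟩
      exact ⟨z, w, hz, hw, hz', hw', h⟩
    · rintro ⟨z, w, hz, hw, hz', hw', h⟩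
      exact ⟨⟨z, hz, hz'⟩, ⟨w, hw, hw'⟩, h⟩
  have hex : ∀ z w : ℂ, ‖z - 1‖ = Real.exp b₁ → ‖w - 1‖ = Real.exp b₂ →
      ∃ p, zFun p = (z : OnePoint ℂ) ∧ wFun p = (w : OnePoint ℂ) ∧ μ p = b₃ := by
    intro z w _ _
    obtain ⟨C⟩ := nonempty_chain P (z : OnePoint ℂ) (w : OnePoint ℂ)
    exact C.exists_mu_eq P hμ (Set.Ioo_subset_Icc_self hb₃)
  -- A nonzero point on the circle of radius `e ^ r` about `1`, serving as the other coordinate of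
  -- the comparison point.
  have hpoint : ∀ r : ℝ, ‖(1 + Real.exp r : ℂ) - 1‖ = Real.exp r ∧ (1 + Real.exp r : ℂ) ≠ 0 := by
    intro r
    refine ⟨by rw [add_sub_cancel_left, Complex.norm_real, Real.norm_eq_abs, Real.abs_exp], ?_⟩
    have : 1 + Real.exp r ≠ 0 := (add_pos one_pos (Real.exp_pos r)).ne'
    exact_mod_cast this
  have hA : ∃ i, ∀ p, fibMap μ p = ((b₁ : EReal), (b₂ : EReal), b₃) →
      ∀ i', rayA i' ∈ orbitCone p → i' = i := by
    by_cases h1 : ‖(0 : ℂ) - 1‖ = Real.exp b₁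
    · obtain ⟨q, hz, hw, hq⟩ := hex 0 (1 + Real.exp b₂) h1 (hpoint b₂).1
      have hqr := hreg q ((hfib q).2 ⟨_, _, hz, hw, h1, (hpoint b₂).1, hq⟩)
      obtain ⟨i, hi⟩ := exists_index_A P hμ hz
        (by rw [hw, Ne, OnePoint.coe_eq_coe]; exact (hpoint b₂).2) (hqr.not_spans P hμ)
      refine ⟨i, fun p hp => hi p ?_⟩
      obtain ⟨-, -, -, -, -, -, h⟩ := (hfib p).1 hp
      rw [h, hq]
    -- Here `z` has no zero on the fibre, and the index `0` is a dummy.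
    · refine ⟨0, fun p hp i' hi' => absurd ?_ h1⟩
      obtain ⟨z, w, hz, -, hr, -⟩ := (hfib p).1 hp
      have hz0 := hz.symm.trans ((compat_orbitCone P p).z_zero.2 ⟨i', hi'⟩)
      rw [OnePoint.coe_eq_coe] at hz0
      rwa [hz0] at hr
  have hB : ∃ j, ∀ p, fibMap μ p = ((b₁ : EReal), (b₂ : EReal), b₃) →
      ∀ j', rayB j' ∈ orbitCone p → j' = j := by
    by_cases h1 : ‖(0 : ℂ) - 1‖ = Real.exp b₂
    · obtain ⟨q, hz, hw, hq⟩ := hex (1 + Real.exp b₁) 0 (hpoint b₁).1 h1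
      have hqr := hreg q ((hfib q).2 ⟨_, _, hz, hw, (hpoint b₁).1, h1, hq⟩)
      obtain ⟨i, hi⟩ := exists_index_B P hμ hw
        (by rw [hz, Ne, OnePoint.coe_eq_coe]; exact (hpoint b₁).2) (hqr.not_spans P hμ)
      refine ⟨i, fun p hp => hi p ?_⟩
      obtain ⟨-, -, -, -, -, -, h⟩ := (hfib p).1 hp
      rw [h, hq]
    · refine ⟨0, fun p hp i' hi' => absurd ?_ h1⟩
      obtain ⟨z, w, -, hw, -, hr, -⟩ := (hfib p).1 hp
      have hw0 := hw.symm.trans ((compat_orbitCone P p).w_zero.2 ⟨i', hi'⟩)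
      rw [OnePoint.coe_eq_coe] at hw0
      rwa [hw0] at hr
  obtain ⟨i, hi⟩ := hA
  obtain ⟨j, hj⟩ := hB
  refine nonempty_homeomorph_torus P hμ (Real.exp_pos b₁) (Real.exp_pos b₂) (i := i) (j := j)
    hfib (fun p hp => ?_) hex
  obtain ⟨C⟩ := nonempty_chain P (zFun p) (wFun p)
  obtain ⟨n, -, h, -⟩ := C.exists_of_not_spans P hμ rfl rfl ((hreg p hp).not_spans P hμ)
  have hi' := hi p hp (C.i n)
  have hj' := hj p hp (C.j n)
  rw [h] at hi' hj' ⊢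
  simp only [FibreChain.orbit, rayA_mem_cone, rayB_mem_cone, true_and] at hi' hj' ⊢
  ext ρ
  simp only [cone, Set.mem_ofPred_eq]
  constructor
  · rintro (⟨rfl, h⟩ | ⟨rfl, h⟩ | h | h)
    · exact .inl ⟨by rw [hi' h], h⟩
    · exact .inr (.inl ⟨by rw [hj' h], h⟩)
    · exact .inr (.inr (.inl h))
    · exact .inr (.inr (.inr h))
  · rintro (⟨rfl, h⟩ | ⟨rfl, h⟩ | h | h)
    · exact .inl ⟨by rw [hi' h], h⟩
    · exact .inr (.inl ⟨by rw [hj' h], h⟩)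
    · exact .inr (.inr (.inl h))
    · exact .inr (.inr (.inr h))

end

end GenConifold

end

noncomputable section

open scoped Matrix Topology

namespace GenConifold

variable {k l : ℕ} {T : MaxTriangulation k l}

/-! ### Logarithmic differentials on the open torus -/

theorem holAt_of_mem_torusSet {A : Matrix (Fin 3) (Fin 3) ℤ} {t : C3} (ht : t ∈ torusSet)
    (m : Lat) : HolAt A m t := fun a => .inl (ht a)

theorem mono_ne_zero {V : Chart T} {t : C3} (ht : t ∈ torusSet) (m : Lat) : mono V m t ≠ 0 :=
  Finset.prod_ne_zero_iff.2 fun a _ => zpow_ne_zero _ (ht a)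

/-- The logarithmic differential of a character. -/
def dlog (V : Chart T) (m : Lat) (t u : C3) : ℂ := dMono V m t u / mono V m t

section
variable {V : Chart T} {t : C3}

theorem dlog_eq (ht : t ∈ torusSet) (m : Lat) (u : C3) :
    dlog V m t u = ∑ a, (m ⬝ᵥ V.1 a : ℤ) * (u a / t a) := by
  have h1 : u = fun a => u a / t a * t a := by
    ext a
    rw [div_mul_cancel₀ _ (ht a)]
  have h2 := (holAt_of_mem_torusSet (A := V.1) ht m).dMono_scale fun a => u a / t a
  rw [← h1] at h2
  rw [dlog, h2, mul_div_cancel_right₀ _ (mono_ne_zero ht m)]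
  exact Finset.sum_congr rfl fun a _ => mul_comm _ _

theorem dMono_eq_dlog (ht : t ∈ torusSet) (m : Lat) (u : C3) :
    dMono V m t u = mono V m t * dlog V m t u := by
  rw [dlog, mul_div_cancel₀ _ (mono_ne_zero ht m)]

/-- The coordinate `t a` is the character whose exponent is column `a` of the inverse of `V`. The
coefficients arise by writing the standard basis as `nuX`, `nuW`, `nuZ + nuW`. -/
theorem div_eq_dlog (ht : t ∈ torusSet) (u : C3) (a : Fin 3) :
    u a / t a = (V.1⁻¹ 0 a : ℤ) * dlog V nuX t u + (V.1⁻¹ 2 a : ℤ) * dlog V nuZ t u +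
      ((V.1⁻¹ 1 a + V.1⁻¹ 2 a : ℤ) : ℂ) * dlog V nuW t u := by
  have h1 : ∀ b, (V.1 * V.1⁻¹) b a = if b = a then 1 else 0 := fun b => by
    rw [Matrix.mul_nonsing_inv _ (isUnit_det_chart V), Matrix.one_apply]
  have h2 : ∀ b, ((V.1 b 0 : ℂ) * (V.1⁻¹ 0 a : ℤ) + V.1 b 1 * (V.1⁻¹ 1 a : ℤ) +
      V.1 b 2 * (V.1⁻¹ 2 a : ℤ)) = if b = a then 1 else 0 := fun b => by
    have := h1 b
    rw [Matrix.mul_apply, Fin.sum_univ_three] at this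
    have h3 := congrArg (Int.cast : ℤ → ℂ) this
    push_cast at h3
    exact h3
  have h4 : u a / t a = ∑ b, (if b = a then (1 : ℂ) else 0) * (u b / t b) := by simp
  rw [h4]
  simp only [← h2, dlog_eq ht, Fin.sum_univ_three, nuX_dot, nuZ_dot, nuW_dot]
  push_cast
  ring

theorem eq_zero_of_dlog (ht : t ∈ torusSet) {u : C3} (hx : dlog V nuX t u = 0)
    (hz : dlog V nuZ t u = 0) (hw : dlog V nuW t u = 0) : u = 0 := by
  ext a
  have h := div_eq_dlog (V := V) ht u a
  rw [hx, hz, hw, mul_zero, mul_zero, mul_zero, add_zero, add_zero, div_eq_zero_iff] at h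
  exact h.resolve_right (ht a)

theorem exists_dlog_eq (ht : t ∈ torusSet) (y z w : ℂ) :
    ∃ u, dlog V nuX t u = y ∧ dlog V nuZ t u = z ∧ dlog V nuW t u = w := by
  have key : ∀ (v m : Lat) (c : ℂ), dlog V m t (fun a => c * ((v ᵥ* V.1⁻¹) a : ℤ) * t a) =
      c * (m ⬝ᵥ v : ℤ) := fun v m c => by
    rw [dlog, (holAt_of_mem_torusSet ht m).dMono_lattice,
      mul_div_cancel_right₀ _ (mono_ne_zero ht m)]
  have hadd : ∀ (m : Lat) (u v : C3), dlog V m t (u + v) = dlog V m t u + dlog V m t v :=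
    fun m u v => by rw [dlog, map_add, add_div]; rfl
  -- The three lattice vectors are the basis dual to `nuX`, `nuZ`, `nuW`.
  refine ⟨(fun a => y * ((![1, 0, 0] ᵥ* V.1⁻¹) a : ℤ) * t a) +
    (fun a => z * ((![0, 0, 1] ᵥ* V.1⁻¹) a : ℤ) * t a) +
    (fun a => w * ((![0, 1, 1] ᵥ* V.1⁻¹) a : ℤ) * t a), ?_, ?_, ?_⟩ <;>
  rw [hadd, hadd, key, key, key] <;> simp [nuX, nuZ, nuW, dotProduct, Fin.sum_univ_three]

theorem radialField_ne_zero (ht : t ∈ torusSet) : radialField V t ≠ 0 := by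
  obtain ⟨a, ha⟩ := wt_ne_zero V
  intro h
  have := congrFun h a
  simp [radialField, ha, ht a] at this

variable {ω : ToricKahlerForm T} {μ : X T → ℝ}

/-- The moment map does not change along the compact torus orbits. -/
theorem IsMomentMap.dMu_rotation (hμ : IsMomentMap ω μ) (V : Chart T) (t : C3) (θ : Fin 3 → ℝ) :
    dMu μ V t (fun a => Complex.I * θ a * t a) = 0 := by
  have hd : HasDerivAt (fun s : ℝ => fun a => (Circle.exp (s * θ a) : ℂ) * t a)
      (fun a => Complex.I * θ a * t a) 0 := by
    rw [hasDerivAt_pi]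
    intro a
    have h1 : HasDerivAt (fun s : ℝ => ((s * θ a : ℝ) : ℂ) * Complex.I) (θ a * Complex.I) 0 := by
      have := ((hasDerivAt_id (0 : ℝ)).mul_const (θ a)).ofReal_comp.mul_const Complex.I
      simpa using this
    have h2 := h1.cexp.mul_const (t a)
    simp only [Circle.coe_exp]
    refine h2.congr_deriv ?_
    simp [mul_comm]
  have h0 : (fun a => (Circle.exp (0 * θ a) : ℂ) * t a) = t := by ext a; simp
  have h1 : HasFDerivAt (fun s => μ (pt V s)) (dMu μ V t)
      (fun a => (Circle.exp (0 * θ a) : ℂ) * t a) := by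
    rw [h0]
    exact hμ.hasFDerivAt V t
  have h2 := h1.comp_hasDerivAt (0 : ℝ) hd
  have h3 : ((fun s => μ (pt V s)) ∘ fun s : ℝ => fun a => (Circle.exp (s * θ a) : ℂ) * t a) =
      fun _ => μ (pt V t) := by
    ext s
    exact hμ.invariant V (fun a => Circle.exp (s * θ a)) t
  rw [h3] at h2
  exact h2.unique (hasDerivAt_const 0 _)

/-- Since `dμ` annihilates the directions of the compact torus, it depends only on the real parts of
the logarithmic differentials. The radial field has logarithmic differentials `(1, 0, 0)`, which
identifies the first coefficient. -/
theorem IsMomentMap.dMu_eq (hμ : IsMomentMap ω μ) (ht : t ∈ torusSet) :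
    ∃ B C : ℝ, ∀ u, dMu μ V t u = dMu μ V t (radialField V t) * (dlog V nuX t u).re +
      B * (dlog V nuZ t u).re + C * (dlog V nuW t u).re := by
  let f : (Fin 3 → ℝ) →ₗ[ℝ] ℝ :=
    { toFun := fun c => dMu μ V t (fun a => (c a : ℂ) * t a)
      map_add' := fun c d => by
        rw [← map_add]
        congr 1
        ext a
        simp [add_mul]
      map_smul' := fun r c => by
        rw [RingHom.id_apply, ← map_smul]
        congr 1
        ext a
        simp [mul_assoc] }
  have hu : ∀ u, dMu μ V t u = f fun a => (u a / t a).re := by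
    intro u
    have h1 : u = (fun a => ((u a / t a).re : ℂ) * t a) +
        fun a => Complex.I * ((u a / t a).im : ℝ) * t a := by
      ext a
      have h2 := Complex.re_add_im (u a / t a)
      simp only [Pi.add_apply]
      rw [← add_mul, mul_comm Complex.I, h2, div_mul_cancel₀ _ (ht a)]
    conv_lhs => rw [h1, map_add, hμ.dMu_rotation, add_zero]
    rfl
  refine ⟨f fun a => (V.1⁻¹ 2 a : ℤ), f fun a => (V.1⁻¹ 1 a + V.1⁻¹ 2 a : ℤ), fun u => ?_⟩
  have h1 : dMu μ V t (radialField V t) = f fun a => (V.1⁻¹ 0 a : ℤ) := by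
    have h2 : ∀ a, wt V a = V.1⁻¹ 0 a := fun a => by
      simp [wt, rayX, Matrix.vecMul, dotProduct, Fin.sum_univ_three]
    change _ = dMu μ V t _
    congr 1
    ext a
    simp [radialField, h2]
  have h3 : (fun a => (u a / t a).re) = (dlog V nuX t u).re • (fun a => ((V.1⁻¹ 0 a : ℤ) : ℝ)) +
      (dlog V nuZ t u).re • (fun a => ((V.1⁻¹ 2 a : ℤ) : ℝ)) +
      (dlog V nuW t u).re • (fun a => ((V.1⁻¹ 1 a + V.1⁻¹ 2 a : ℤ) : ℝ)) := by
    ext a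
    rw [div_eq_dlog (V := V) ht u a]
    simp [mul_comm]
  rw [hu, h1, h3, map_add, map_add, map_smul, map_smul, map_smul]
  simp only [smul_eq_mul]
  ring

theorem iWedgeBar_I_mul {a : C3 →L[ℝ] ℂ} {u v : C3} (h : a v = Complex.I * a u) :
    iWedgeBar a u v = 2 * Complex.normSq (a u) := by
  simp [iWedgeBar, h, Complex.normSq_apply]
  ring

theorem iWedgeBar_of_eq_zero {a : C3 →L[ℝ] ℂ} {u v : C3} (h : a v = 0) : iWedgeBar a u v = 0 := by
  simp [iWedgeBar, h]

/-- Both values lie on the real line through `i c`, where `a ∧ ā` vanishes. -/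
theorem iWedgeBar_of_re {a : C3 →L[ℝ] ℂ} {u v : C3} {c : ℂ} (hc : c ≠ 0) (hu : (a u / c).re = 0)
    (hv : (a v / c).re = 0) : iWedgeBar a u v = 0 := by
  have h1 : ∀ {s : ℂ}, (s / c).re = 0 → s = c * (Complex.I * (s / c).im) := by
    intro s hs
    have h2 := Complex.re_add_im (s / c)
    rw [hs, Complex.ofReal_zero, zero_add, mul_comm] at h2
    rw [h2, mul_div_cancel₀ _ hc]
  rw [iWedgeBar, h1 hu, h1 hv]
  simp
  ring

/-- Testing against vectors with logarithmic differentials `(i,0,0)` and `(1,0,0)` isolates `dμ(u)`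
and `dθ(u)`. The vectors `(0, i dlog z(u), 0)` and `(0, 0, i dlog w(u))` then give squared norms of
`dz(u)` and `dw(u)`. Finally `dμ(u) = 0`, with positive coefficient at `Re dlog x`, removes the last
component. -/
theorem displayedForm_nondegenerate (hμ : IsMomentMap ω μ) {c₁ c₂ : ℝ} (hc₁ : 0 < c₁)
    (hc₂ : 0 < c₂) (ht : t ∈ torusSet) {u : C3}
    (h : ∀ v, displayedForm μ c₁ c₂ V t u v = 0) : u = 0 := by
  have hA := hμ.dMu_radialField_pos (radialField_ne_zero (V := V) ht)
  obtain ⟨B, C, hdMu⟩ := hμ.dMu_eq (V := V) ht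
  have hform : ∀ v, dMu μ V t u * (dlog V nuX t v).im - dMu μ V t v * (dlog V nuX t u).im
    + 1 / (c₁ * (1 + ‖mono V nuZ t‖ ^ 2) ^ 2) * iWedgeBar (dMono V nuZ t) u v
    + 1 / (c₂ * (1 + ‖mono V nuW t‖ ^ 2) ^ 2) * iWedgeBar (dMono V nuW t) u v = 0 := h
  have hu : dMu μ V t u = 0 := by
    obtain ⟨v, hx, hz, hw⟩ := exists_dlog_eq (V := V) ht Complex.I 0 0
    have h1 := hform v
    rw [iWedgeBar_of_eq_zero (by rw [dMono_eq_dlog ht, hz, mul_zero]),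
      iWedgeBar_of_eq_zero (by rw [dMono_eq_dlog ht, hw, mul_zero]), hdMu v, hx, hz, hw] at h1
    simpa using h1
  have him : (dlog V nuX t u).im = 0 := by
    obtain ⟨v, hx, hz, hw⟩ := exists_dlog_eq (V := V) ht 1 0 0
    have h1 := hform v
    rw [iWedgeBar_of_eq_zero (by rw [dMono_eq_dlog ht, hz, mul_zero]),
      iWedgeBar_of_eq_zero (by rw [dMono_eq_dlog ht, hw, mul_zero]), hdMu v, hx, hz, hw] at h1
    simpa [hA.ne', hu] using h1
  have hzz : dlog V nuZ t u = 0 := by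
    obtain ⟨v, hx, hz, hw⟩ := exists_dlog_eq (V := V) ht 0 (Complex.I * dlog V nuZ t u) 0
    have h1 := hform v
    rw [iWedgeBar_I_mul (a := dMono V nuZ t) (u := u) (v := v)
      (by rw [dMono_eq_dlog ht, dMono_eq_dlog ht, hz]; ring),
      iWedgeBar_of_eq_zero (a := dMono V nuW t) (by rw [dMono_eq_dlog ht, hw, mul_zero]), hu, him] at h1
    have h2 : (1 / (c₁ * (1 + ‖mono V nuZ t‖ ^ 2) ^ 2)) ≠ 0 := by positivity
    rw [zero_mul, mul_zero, sub_zero, zero_add, mul_zero, add_zero] at h1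
    have h3 := (mul_eq_zero.1 h1).resolve_left h2
    rw [mul_eq_zero, or_iff_right two_ne_zero, Complex.normSq_eq_zero, dMono_eq_dlog ht] at h3
    exact (mul_eq_zero.1 h3).resolve_left (mono_ne_zero ht _)
  have hww : dlog V nuW t u = 0 := by
    obtain ⟨v, hx, hz, hw⟩ := exists_dlog_eq (V := V) ht 0 0 (Complex.I * dlog V nuW t u)
    have h1 := hform v
    rw [iWedgeBar_I_mul (a := dMono V nuW t) (u := u) (v := v)
      (by rw [dMono_eq_dlog ht, dMono_eq_dlog ht, hw]; ring),
      iWedgeBar_of_eq_zero (a := dMono V nuZ t) (by rw [dMono_eq_dlog ht, hz, mul_zero]), hu, him] at h1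
    have h2 : (1 / (c₂ * (1 + ‖mono V nuW t‖ ^ 2) ^ 2)) ≠ 0 := by positivity
    rw [zero_mul, mul_zero, sub_zero, zero_add, mul_zero, zero_add] at h1
    have h3 := (mul_eq_zero.1 h1).resolve_left h2
    rw [mul_eq_zero, or_iff_right two_ne_zero, Complex.normSq_eq_zero, dMono_eq_dlog ht] at h3
    exact (mul_eq_zero.1 h3).resolve_left (mono_ne_zero ht _)
  refine eq_zero_of_dlog (V := V) ht (Complex.ext ?_ him) hzz hww
  have h1 := hdMu u
  rw [hu, hzz, hww] at h1
  simpa [hA.ne'] using h1.symm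

/-! ### The fibres at points of the open torus -/

theorem finrank_ker_dFib (hs : Function.Surjective (dFib μ V t)) :
    Module.finrank ℝ (LinearMap.ker (dFib μ V t).toLinearMap) = 3 := by
  have h1 := LinearMap.finrank_range_add_finrank_ker (dFib μ V t).toLinearMap
  rw [LinearMap.range_eq_top.2 hs, finrank_top] at h1
  have h2 : Module.finrank ℝ C3 = 6 := by
    simp [Module.finrank_pi_fintype, Complex.finrank_real_complex]
  have h3 : Module.finrank ℝ (ℝ × ℝ × ℝ) = 3 := by simp
  omega

theorem OffD.of_dFib_eq_zero (h : OffD V t) (hμ : IsMomentMap ω μ) {u : C3}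
    (hu : dFib μ V t u = 0) : (dMono V nuZ t u / (mono V nuZ t - 1)).re = 0 ∧
      (dMono V nuW t u / (mono V nuW t - 1)).re = 0 ∧ dMu μ V t u = 0 := by
  rw [h.dFib_apply hμ] at hu
  exact ⟨congrArg (fun x => x.1) hu, congrArg (fun x => x.2.1) hu, congrArg (fun x => x.2.2) hu⟩

/-- The real part of row `0` is dependent on the two imaginary rows and contributes nothing; its
imaginary part contributes `i³` times a real determinant. -/
theorem re_det_eq_zero {M : Matrix (Fin 3) (Fin 3) ℂ} {α β : ℝ} (h1 : ∀ b, (M 1 b).re = 0)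
    (h2 : ∀ b, (M 2 b).re = 0) (h0 : ∀ b, (M 0 b).re = α * (M 1 b).im + β * (M 2 b).im) :
    M.det.re = 0 := by
  rw [Matrix.det_fin_three]
  simp only [Complex.add_re, Complex.sub_re, Complex.mul_re, Complex.mul_im, h0, h1, h2]
  ring

theorem re_det_logForms_eq_zero (hμ : IsMomentMap ω μ) (ht : t ∈ torusSet) (h : OffD V t)
    {u : Fin 3 → C3} (hu : ∀ a, dFib μ V t (u a) = 0) :
    (Matrix.det (Matrix.of fun a b => logForms V t (u b) a)).re = 0 := by
  have hA := hμ.dMu_radialField_pos (radialField_ne_zero (V := V) ht)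
  obtain ⟨B, C, hdMu⟩ := hμ.dMu_eq (V := V) ht
  have hz := sub_ne_zero.2 h.z_ne
  have hw := sub_ne_zero.2 h.w_ne
  -- This passes from `dlog (z - 1)`, imaginary on the kernel, to the real part of `dlog z`, which
  -- enters `dμ`.
  have key : ∀ {s c m : ℂ}, m ≠ 0 → c ≠ 0 → (s / c).re = 0 →
      (s / m).re = -(c / m).im * (s / c).im := by
    intro s c m hm hc hs
    have h1 : s / m = c / m * (s / c) := by field_simp
    rw [h1, Complex.mul_re, hs]
    ring
  refine re_det_eq_zero
    (α := B * ((mono V nuZ t - 1) / mono V nuZ t).im / dMu μ V t (radialField V t))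
    (β := C * ((mono V nuW t - 1) / mono V nuW t).im / dMu μ V t (radialField V t))
    (fun b => (h.of_dFib_eq_zero hμ (hu b)).1) (fun b => (h.of_dFib_eq_zero hμ (hu b)).2.1)
    fun b => ?_
  obtain ⟨h1, h2, h3⟩ := h.of_dFib_eq_zero hμ (hu b)
  have h4 := hdMu (u b)
  rw [h3, dlog, dlog, dlog, key (mono_ne_zero ht _) hz h1, key (mono_ne_zero ht _) hw h2] at h4
  change (dMono V nuX t (u b) / mono V nuX t).re =
    _ * (dMono V nuZ t (u b) / (mono V nuZ t - 1)).im +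
    _ * (dMono V nuW t (u b) / (mono V nuW t - 1)).im
  rw [div_mul_eq_mul_div, div_mul_eq_mul_div, ← add_div, eq_div_iff hA.ne']
  linarith

theorem displayedForm_eq_zero (hμ : IsMomentMap ω μ) (h : OffD V t) (c₁ c₂ : ℝ) {u v : C3}
    (hu : dFib μ V t u = 0) (hv : dFib μ V t v = 0) : displayedForm μ c₁ c₂ V t u v = 0 := by
  obtain ⟨h1, h2, h3⟩ := h.of_dFib_eq_zero hμ hu
  obtain ⟨h1', h2', h3'⟩ := h.of_dFib_eq_zero hμ hv
  rw [displayedForm, iWedgeBar_of_re (sub_ne_zero.2 h.z_ne) h1 h1',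
    iWedgeBar_of_re (sub_ne_zero.2 h.w_ne) h2 h2', h3, h3']
  ring

theorem IsSplit.form_eq_zero (hs : IsSplit ω μ) (hμ : IsMomentMap ω μ) (h : OffD V t)
    (ht : t ∈ torusSet) {u v : C3} (hu : dFib μ V t u = 0) (hv : dFib μ V t v = 0) :
    ω.form V t ![u, v] = 0 := by
  obtain ⟨h1, h2, h3⟩ := h.of_dFib_eq_zero hμ hu
  obtain ⟨h1', h2', h3'⟩ := h.of_dFib_eq_zero hμ hv
  obtain ⟨Θ, f, g, hfg⟩ := hs V t ht
  rw [hfg, iWedgeBar_of_re (sub_ne_zero.2 h.z_ne) h1 h1',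
    iWedgeBar_of_re (sub_ne_zero.2 h.w_ne) h2 h2', h3, h3']
  ring

end

/-! ### The holomorphic volume form -/

/-- The determinant as a continuous alternating form. -/
def detForm : C3 [⋀^Fin 3]→L[ℂ] ℂ :=
  { toMultilinearMap := (Matrix.detRowAlternating (R := ℂ) (n := Fin 3)).toMultilinearMap
    cont := Continuous.matrix_det continuous_id
    map_eq_zero_of_eq' := (Matrix.detRowAlternating (R := ℂ) (n := Fin 3)).map_eq_zero_of_eq' }

theorem detForm_apply (u : Fin 3 → C3) : detForm u = (Matrix.of u).det := rfl

/-- The coefficient of the volume form in a chart. -/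
def volCoeff (V : Chart T) (t : C3) : ℂ :=
  -(V.1.det : ℂ) * (∏ a, t a ^ (V.1 a 2 - 1)) / ((mono V nuZ t - 1) * (mono V nuW t - 1))

/-- The holomorphic volume form. -/
def volForm (V : Chart T) (t : C3) : C3 [⋀^Fin 3]→L[ℂ] ℂ := volCoeff V t • detForm

section
variable {V : Chart T} {t : C3}

/-- The rays of the two rows lie at height one, so `Ω` has neither a zero nor a pole along their
divisors. -/
theorem OffD.zpow_ne (h : OffD V t) (a : Fin 3) : t a ≠ 0 ∨ V.1 a 2 - 1 = 0 := by
  by_cases ha : t a = 0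
  · right
    rcases h.rows a ha with ⟨i, hi⟩ | ⟨i, hi⟩ <;> simp [hi, rayA, rayB]
  · exact .inl ha

theorem OffD.differentiableAt_volForm (h : OffD V t) : DifferentiableAt ℂ (volForm V) t := by
  have h1 : ∀ a, DifferentiableAt ℂ (fun t : C3 => t a ^ (V.1 a 2 - 1)) t := fun a =>
    DifferentiableAt.zpow (differentiableAt_apply a t) ((h.zpow_ne a).imp_right fun h => h.ge)
  have h2 : DifferentiableAt ℂ (fun t : C3 => ∏ a, t a ^ (V.1 a 2 - 1)) t := by
    simp only [Fin.prod_univ_three]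
    exact ((h1 0).mul (h1 1)).mul (h1 2)
  have h4 : DifferentiableAt ℂ (fun t => (mono V nuZ t - 1) * (mono V nuW t - 1)) t :=
    (h.holZ.differentiableAt.sub_const 1).fun_mul (h.holW.differentiableAt.sub_const 1)
  have h3 := (h2.const_mul (-(V.1.det : ℂ))).fun_mul
    (h4.fun_inv (mul_ne_zero (sub_ne_zero.2 h.z_ne) (sub_ne_zero.2 h.w_ne)))
  simp only [← div_eq_mul_inv] at h3
  exact DifferentiableAt.fun_smul h3 (differentiableAt_const detForm)

theorem OffD.volForm_ne_zero (h : OffD V t) : volForm V t ≠ 0 := by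
  intro h0
  have h1 : volForm V t (fun a => Pi.single a 1) = 0 := by rw [h0]; rfl
  have h2 : detForm (fun a => Pi.single a 1) = 1 := by
    rw [detForm_apply, ← Matrix.det_one (n := Fin 3) (R := ℂ)]
    congr 1
    ext a b
    simp [Matrix.one_apply, Pi.single_apply, eq_comm]
  have h3 : volCoeff V t = 0 := by
    have : volForm V t (fun a => Pi.single a 1) = volCoeff V t * detForm (fun a => Pi.single a 1) :=
      rfl
    rwa [this, h2, mul_one] at h1
  refine div_ne_zero (mul_ne_zero (neg_ne_zero.2 ?_) (Finset.prod_ne_zero_iff.2 fun a _ => ?_))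
    (mul_ne_zero (sub_ne_zero.2 h.z_ne) (sub_ne_zero.2 h.w_ne)) h3
  · exact_mod_cast (isUnit_det_chart V).ne_zero
  · rcases h.zpow_ne a with ha | ha
    · exact zpow_ne_zero _ ha
    · rw [ha, zpow_zero]
      exact one_ne_zero

/-- The matrix factors through `dt / t`: exponents give `-det V`, and replacing `dlog z`, `dlog w`
by `dlog (z-1)`, `dlog (w-1)` gives the factor `zw / ((z-1)(w-1))`. The monomial `zw` has exponent
`(0,0,1)`, which is the height occurring in `volCoeff`. -/
theorem volForm_eq_det (ht : t ∈ torusSet) (h : OffD V t) (u : Fin 3 → C3) :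
    volForm V t u = Matrix.det (Matrix.of fun a b => logForms V t (u b) a) := by
  have hz := sub_ne_zero.2 h.z_ne
  have hw := sub_ne_zero.2 h.w_ne
  let M : Matrix (Fin 3) (Fin 3) ℤ := Matrix.of ![nuX, nuZ, nuW]
  have hM : M.det = -1 := by
    rw [Matrix.det_fin_three]
    simp [M, nuX, nuZ, nuW]
  let N : Matrix (Fin 3) (Fin 3) ℂ := (M * V.1ᵀ).map (Int.cast : ℤ → ℂ)
  have hN : N.det = -(V.1.det : ℂ) := by
    have : N.det = ((M * V.1ᵀ).det : ℤ) := ((Int.castRingHom ℂ).map_det (M * V.1ᵀ)).symm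
    rw [this, Matrix.det_mul, Matrix.det_transpose, hM]
    simp
  let d : Fin 3 → ℂ := ![1, mono V nuZ t / (mono V nuZ t - 1), mono V nuW t / (mono V nuW t - 1)]
  have hL : (Matrix.of fun a b => logForms V t (u b) a) =
      Matrix.diagonal d * (N * (Matrix.diagonal (fun c => (t c)⁻¹) * (Matrix.of u)ᵀ)) := by
    ext a b
    rw [Matrix.diagonal_mul, Matrix.mul_apply]
    have h1 : ∀ m : Lat, dlog V m t (u b) = ∑ c, (m ⬝ᵥ V.1 c : ℤ) * ((t c)⁻¹ * u b c) := fun m => by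
      rw [dlog_eq ht]
      exact Finset.sum_congr rfl fun c _ => by rw [div_eq_inv_mul]
    have h2 : ∀ c, (Matrix.diagonal (fun c => (t c)⁻¹) * (Matrix.of u)ᵀ) c b = (t c)⁻¹ * u b c :=
      fun c => by rw [Matrix.diagonal_mul]; rfl
    simp only [h2]
    fin_cases a
    · exact (h1 nuX).trans (one_mul _).symm
    · change dMono V nuZ t (u b) / (mono V nuZ t - 1) =
        mono V nuZ t / (mono V nuZ t - 1) * ∑ c, ((nuZ ⬝ᵥ V.1 c : ℤ) : ℂ) * ((t c)⁻¹ * u b c)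
      rw [← h1, dMono_eq_dlog ht, mul_div_right_comm]
    · change dMono V nuW t (u b) / (mono V nuW t - 1) =
        mono V nuW t / (mono V nuW t - 1) * ∑ c, ((nuW ⬝ᵥ V.1 c : ℤ) : ℂ) * ((t c)⁻¹ * u b c)
      rw [← h1, dMono_eq_dlog ht, mul_div_right_comm]
  have hprod : (∏ a, t a ^ (V.1 a 2 - 1)) = mono V nuZ t * mono V nuW t * ∏ c, (t c)⁻¹ := by
    rw [mono, mono, ← Finset.prod_mul_distrib, ← Finset.prod_mul_distrib]
    refine Finset.prod_congr rfl fun a _ => ?_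
    rw [← zpow_add₀ (ht a), zpow_sub_one₀ (ht a), nuZ_dot, nuW_dot]
    congr 2
    ring
  rw [hL, Matrix.det_mul, Matrix.det_mul, Matrix.det_mul, Matrix.det_diagonal,
    Matrix.det_diagonal, Matrix.det_transpose, hN]
  have hv : volForm V t u = volCoeff V t * (Matrix.of u).det := rfl
  rw [hv, volCoeff, hprod, Fin.prod_univ_three d]
  simp only [d, Matrix.cons_val_zero, Matrix.cons_val_one, Matrix.cons_val]
  field_simp

theorem isVolumeForm_volForm (P : EdgePath T) : IsVolumeForm (volForm (T := T)) := fun _ =>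
  ⟨fun _ ht => ((notMem_divisorD_iff P).1 ht).differentiableAt_volForm.differentiableWithinAt,
    fun _ ht => ((notMem_divisorD_iff P).1 ht).volForm_ne_zero,
    fun _ ht h u => volForm_eq_det ht ((notMem_divisorD_iff P).1 h) u⟩

end

/-! ### Regular points off the open torus -/

theorem frequently_mem_torusSet (t : C3) : ∃ᶠ s in 𝓝 t, s ∈ torusSet := by
  rw [← mem_closure_iff_frequently]
  have h : Dense (Set.pi Set.univ fun _ : Fin 3 => ({0}ᶜ : Set ℂ)) :=
    dense_pi _ fun _ _ => dense_compl_singleton 0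
  have h' : torusSet = Set.pi Set.univ fun _ : Fin 3 => ({0}ᶜ : Set ℂ) := by
    ext s
    simp [torusSet]
  rw [h']
  exact h t

/-- The kernels of a continuous family of linear maps vary continuously at surjective ones. -/
theorem exists_continuousAt_ker {E F : Type*} [TopologicalSpace E]
    [NormedAddCommGroup F] [NormedSpace ℝ F] [FiniteDimensional ℝ F]
    {D : E → C3 →L[ℝ] F} {t₀ : E} (hD : ContinuousAt D t₀) (hs : Function.Surjective (D t₀))
    {u : C3} (hu : D t₀ u = 0) :
    ∃ U : E → C3, ContinuousAt U t₀ ∧ U t₀ = u ∧ ∀ᶠ t in 𝓝 t₀, D t (U t) = 0 := by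
  have : CompleteSpace F := FiniteDimensional.complete ℝ F
  obtain ⟨R, hR⟩ := (D t₀).toLinearMap.exists_rightInverse_of_surjective
    (LinearMap.range_eq_top.2 hs)
  let R' : F →L[ℝ] C3 := LinearMap.toContinuousLinearMap R
  let G : E → F →L[ℝ] F := fun t => (D t).comp R'
  have hG : ContinuousAt G t₀ := hD.clm_comp continuousAt_const
  have hG₀ : G t₀ = 1 := by
    ext x
    exact LinearMap.congr_fun hR x
  have hinv : ContinuousAt (fun t => Ring.inverse (G t)) t₀ := by
    refine ContinuousAt.comp (g := Ring.inverse) ?_ hG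
    rw [hG₀]
    exact NormedRing.inverse_continuousAt (1 : (F →L[ℝ] F)ˣ)
  have hunit : ∀ᶠ t in 𝓝 t₀, IsUnit (G t) :=
    hG.eventually (Units.isOpen.mem_nhds (by rw [hG₀]; exact isUnit_one))
  -- A right inverse of `D t₀`, corrected by `(G t)⁻¹`, is a right inverse of `D t` nearby;
  -- subtracting the lift of `D t u` projects `u` to the kernel.
  refine ⟨fun t => u - R' (Ring.inverse (G t) (D t u)), ?_, ?_, ?_⟩
  · exact continuousAt_const.sub (R'.continuous.continuousAt.comp
      (hinv.clm_apply (hD.clm_apply continuousAt_const)))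
  · simp [hu]
  · filter_upwards [hunit] with t ht
    rw [map_sub]
    have h1 : G t (Ring.inverse (G t) (D t u)) = D t u := by
      have := Ring.mul_inverse_cancel _ ht
      exact congrArg (fun f : F →L[ℝ] F => f (D t u)) this
    have h2 : D t (R' (Ring.inverse (G t) (D t u))) = D t u := h1
    rw [h2, sub_self]

section
variable {V : Chart T} {t : C3} {ω : ToricKahlerForm T} {μ : X T → ℝ}

theorem eventually_offD (P : EdgePath T) (hμ : IsMomentMap ω μ) (h : OffD V t) :
    ∀ᶠ s in 𝓝 t, OffD V s := by
  have hD : (divisorD T)ᶜ = zFun ⁻¹' {((1 : ℂ) : OnePoint ℂ), inftyP}ᶜ ∩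
      wFun ⁻¹' {((1 : ℂ) : OnePoint ℂ), inftyP}ᶜ ∩
      μ ⁻¹' Set.Ioo (val μ {rayX}) (val μ {-rayX}) := by
    ext p
    obtain ⟨h1, h2, h3, h4⟩ := mu_bounds P hμ p
    simp only [Set.mem_compl_iff, mem_divisorD_iff, ← h3, ← h4, Set.mem_inter_iff,
      Set.mem_preimage, Set.mem_insert_iff, Set.mem_singleton_iff, Set.mem_Ioo, h1.lt_iff_ne',
      h2.lt_iff_ne]
    tauto
  have hopen : IsOpen (divisorD T)ᶜ := by
    rw [hD]
    have hfin : IsOpen ({((1 : ℂ) : OnePoint ℂ), inftyP}ᶜ : Set (OnePoint ℂ)) :=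
      (Set.toFinite _).isClosed.isOpen_compl
    exact ((hfin.preimage (continuous_zFun P)).inter (hfin.preimage (continuous_wFun P))).inter
      (isOpen_Ioo.preimage hμ.continuous)
  filter_upwards [(hopen.preimage (continuous_pt V)).mem_nhds ((notMem_divisorD_iff P).2 h)]
    with s hs
  exact (notMem_divisorD_iff P).1 hs

theorem HolAt.contDiffAt {A : Matrix (Fin 3) (Fin 3) ℤ} {m : Lat} (h : HolAt A m t) :
    ContDiffAt ℝ 1 (monoM A m) t := by
  have : monoM A m = fun t => ∏ a, t a ^ (m ⬝ᵥ A a) := rfl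
  rw [this]
  refine contDiffAt_prod fun a _ => ?_
  have ha : ContDiffAt ℝ 1 (fun t : C3 => t a) t := contDiffAt_apply ℝ ℂ a t
  by_cases hm : 0 ≤ m ⬝ᵥ A a
  · obtain ⟨n, hn⟩ := Int.eq_ofNat_of_zero_le hm
    simp only [hn, zpow_natCast]
    exact ha.pow n
  · obtain ⟨n, hn⟩ := Int.eq_ofNat_of_zero_le (a := -(m ⬝ᵥ A a)) (by omega)
    have h1 : ∀ x : ℂ, x ^ (m ⬝ᵥ A a) = (x ^ n)⁻¹ := fun x => by
      rw [← zpow_natCast, ← zpow_neg, ← hn, neg_neg]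
    simp only [h1]
    exact (ha.pow n).inv (pow_ne_zero _ ((h a).resolve_right hm))

theorem HolAt.continuousAt_dMono {m : Lat} (h : HolAt V.1 m t) : ContinuousAt (dMono V m) t :=
  h.contDiffAt.continuousAt_fderiv one_ne_zero

theorem continuous_form (ω : ToricKahlerForm T) (V : Chart T) : Continuous (ω.form V) :=
  (ω.smooth V).continuous

/-- The moment map is only assumed differentiable; continuity of its differential comes from the
formula through the smooth form `ω`. -/
theorem IsMomentMap.continuous_dMu (hμ : IsMomentMap ω μ) (V : Chart T) :
    Continuous (dMu μ V) := by
  rw [continuous_clm_apply]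
  intro u
  simp only [hμ.dMu_apply]
  refine continuous_eval.comp ((continuous_form ω V).prodMk ?_)
  refine continuous_pi fun a => ?_
  fin_cases a
  · exact continuous_const
  · exact continuous_pi fun a => continuous_const.mul (continuous_apply a)

theorem OffD.continuousAt_dFib (P : EdgePath T) (hμ : IsMomentMap ω μ) (h : OffD V t) :
    ContinuousAt (dFib μ V) t := by
  have h1 : ContinuousOn (dFib μ V) {s | OffD V s} := by
    rw [continuousOn_clm_apply]
    intro u s hs
    have hs' : OffD V s := hs
    have hz : ContinuousAt (fun s => (dMono V nuZ s u / (mono V nuZ s - 1)).re) s :=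
      Complex.continuous_re.continuousAt.comp ((hs'.holZ.continuousAt_dMono.clm_apply
        continuousAt_const).div (hs'.holZ.differentiableAt.continuousAt.sub continuousAt_const)
        (sub_ne_zero.2 hs'.z_ne))
    have hw : ContinuousAt (fun s => (dMono V nuW s u / (mono V nuW s - 1)).re) s :=
      Complex.continuous_re.continuousAt.comp ((hs'.holW.continuousAt_dMono.clm_apply
        continuousAt_const).div (hs'.holW.differentiableAt.continuousAt.sub continuousAt_const)
        (sub_ne_zero.2 hs'.w_ne))
    have hm : ContinuousAt (fun s => dMu μ V s u) s :=
      ((hμ.continuous_dMu V).clm_apply continuous_const).continuousAt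
    exact (hz.prodMk (hw.prodMk hm)).continuousWithinAt.congr
      (fun y hy => OffD.dFib_apply hy hμ u) (hs'.dFib_apply hμ u)
  exact h1.continuousAt (eventually_offD P hμ h)

theorem OffD.isSpecialLagrangianAt_displayedForm (P : EdgePath T) (hμ : IsMomentMap ω μ)
    (h : OffD V t) (ht : t ∈ torusSet) (c₁ c₂ : ℝ) :
    IsSpecialLagrangianAt μ V t (displayedForm μ c₁ c₂ V t) (volForm V t) := by
  obtain ⟨a, ha⟩ := wt_ne_zero V
  refine ⟨finrank_ker_dFib (h.surjective_dFib P hμ ⟨a, ha, ht a⟩),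
    fun u v => displayedForm_eq_zero hμ h c₁ c₂, fun u hu => ?_⟩
  rw [volForm_eq_det ht h]
  exact re_det_logForms_eq_zero hμ ht h hu

/-- The split shape is known only on the open torus. Kernel vectors at a regular point extend
continuously to kernel vectors at nearby points, among them torus points arbitrarily close, and the
vanishing there passes to the limit. -/
theorem OffD.isSpecialLagrangianAt_form (P : EdgePath T) (hμ : IsMomentMap ω μ)
    (hsplit : IsSplit ω μ) (h : OffD V t) (hs : Function.Surjective (dFib μ V t)) :
    IsSpecialLagrangianAt μ V t (fun u v => ω.form V t ![u, v]) (volForm V t) := by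
  have hcont := h.continuousAt_dFib P hμ
  refine ⟨finrank_ker_dFib hs, fun u v hu hv => ?_, fun u hu => ?_⟩
  · obtain ⟨U, hU, rfl, hU0⟩ := exists_continuousAt_ker hcont hs hu
    obtain ⟨W, hW, rfl, hW0⟩ := exists_continuousAt_ker hcont hs hv
    have h1 : ContinuousAt (fun s => ω.form V s ![U s, W s]) t := by
      refine continuous_eval.continuousAt.comp ((continuous_form ω V).continuousAt.prodMk ?_)
      refine continuousAt_pi.2 fun a => ?_
      fin_cases a
      exacts [hU, hW]
    refine Set.mem_singleton_iff.1
      ((isClosed_singleton (x := (0 : ℝ))).mem_of_frequently_of_tendsto ?_ h1)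
    refine ((frequently_mem_torusSet t).and_eventually
      ((eventually_offD P hμ h).and (hU0.and hW0))).mono ?_
    rintro s ⟨hst, hsD, hsU, hsW⟩
    exact hsplit.form_eq_zero hμ hsD hst hsU hsW
  · choose U hU hU' hU0 using fun a => exists_continuousAt_ker hcont hs (hu a)
    obtain rfl : (fun a => U a t) = u := funext hU'
    have h1 : ContinuousAt (fun s => (volForm V s fun a => U a s).re) t := by
      refine Complex.continuous_re.continuousAt.comp (continuous_eval.continuousAt.comp
        (h.differentiableAt_volForm.continuousAt.prodMk ?_))
      exact continuousAt_pi.2 hU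
    refine Set.mem_singleton_iff.1
      ((isClosed_singleton (x := (0 : ℝ))).mem_of_frequently_of_tendsto ?_ h1)
    refine ((frequently_mem_torusSet t).and_eventually
      ((eventually_offD P hμ h).and (Filter.eventually_all.2 hU0))).mono ?_
    rintro s ⟨hst, hsD, hsU⟩
    rw [Set.mem_singleton_iff, volForm_eq_det hst hsD]
    exact re_det_logForms_eq_zero hμ hst hsD hsU

end

end GenConifold

end

/-! ### Assembly of the theorem. -/

theorem mainTheorem9 (k l : ℕ) (hl : 1 ≤ l) (hlk : l ≤ k)
    (T : GenConifold.MaxTriangulation k l) (ω : GenConifold.ToricKahlerForm T)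
    (μ : GenConifold.X T → ℝ) (hμ : GenConifold.IsMomentMap ω μ) :
    -- `π` is a fibration over `B = [-∞, ∞]² × I` with general fibre a 3-torus
    (Continuous (GenConifold.fibMap μ) ∧
      (∃ m M : ℝ, m < M ∧
        Set.range (GenConifold.fibMap μ) = Set.univ ×ˢ Set.univ ×ˢ Set.Icc m M ∧
        ∀ p, p ∈ GenConifold.divisorD T ↔
          ¬ ∃ b₁ b₂ : ℝ, ∃ b₃ ∈ Set.Ioo m M,
            GenConifold.fibMap μ p = ((b₁ : EReal), (b₂ : EReal), b₃)) ∧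
      (∃ S : Set ℝ, S.Finite ∧
        ∀ p, p ∉ GenConifold.divisorD T → μ p ∉ S → GenConifold.IsRegularPt μ p) ∧
      ∀ b ∈ Set.range (GenConifold.fibMap μ),
        (∀ p, GenConifold.fibMap μ p = b → GenConifold.IsRegularPt μ p) →
        Nonempty ((GenConifold.fibMap μ ⁻¹' {b} : Set (GenConifold.X T)) ≃ₜ (Fin 3 → Circle))) ∧
    ∃ Ω : GenConifold.Chart T → GenConifold.C3 → GenConifold.C3 [⋀^Fin 3]→L[ℂ] ℂ,
      GenConifold.IsVolumeForm Ω ∧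
      -- special Lagrangian for the displayed form, where it is defined
      (∀ c₁ c₂ : ℝ, 0 < c₁ → 0 < c₂ → ∀ (V : GenConifold.Chart T),
        ∀ t ∈ GenConifold.torusSet,
          (∀ u, (∀ v, GenConifold.displayedForm μ c₁ c₂ V t u v = 0) → u = 0) ∧
          (GenConifold.pt V t ∉ GenConifold.divisorD T →
            GenConifold.IsSpecialLagrangianAt μ V t
              (GenConifold.displayedForm μ c₁ c₂ V t) (Ω V t))) ∧
      -- special Lagrangian for the Kähler form at all regular points, if it is of split form
      (GenConifold.IsSplit ω μ → ∀ (V : GenConifold.Chart T) (t : GenConifold.C3),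
        GenConifold.IsRegularPt μ (GenConifold.pt V t) →
          GenConifold.IsSpecialLagrangianAt μ V t
            (fun u v => ω.form V t ![u, v]) (Ω V t)) := by
  obtain ⟨P⟩ := GenConifold.nonempty_edgePath T (hl.trans hlk)
  refine ⟨⟨GenConifold.continuous_fibMap P hμ,
    ⟨_, _, GenConifold.val_rayX_lt P hμ, GenConifold.range_fibMap P hμ,
      GenConifold.mem_divisorD_iff_fibMap P hμ⟩,
    GenConifold.exists_critical_values P hμ,
    fun _ hb hreg => GenConifold.nonempty_homeomorph_torus_of_regular P hμ hb hreg⟩,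
    GenConifold.volForm, GenConifold.isVolumeForm_volForm P,
    fun c₁ c₂ hc₁ hc₂ V t ht => ⟨fun u hu =>
      GenConifold.displayedForm_nondegenerate hμ hc₁ hc₂ ht hu, fun hD =>
      ((GenConifold.notMem_divisorD_iff P).1 hD).isSpecialLagrangianAt_displayedForm P hμ ht c₁ c₂⟩,
    fun hsplit V t hreg => ((GenConifold.notMem_divisorD_iff P).1 hreg.1).isSpecialLagrangianAt_form
      P hμ hsplit (hreg.2 V t rfl)⟩
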